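/- Let $k\ge 1$ and $e\ge 0$ be integers with $3\nmid k$, put $n=3^{e}k$, and let $K_{3[n]}$ be the complete tripartite graph with three parts of $n$ vertices each. Maps are cellular embeddings of connected graphs in closed oriented surfaces; isomorphisms of maps are orientation-preserving, and $\mathrm{Aut}^{+}(\mathcal M)$ is the group of orientation-preserving automorphisms of $\mathcal M$. A map is orientably-regular if $\mathrm{Aut}^{+}(\mathcal M)$ acts regularly on the arcs, and chiral if moreover it has no orientation-reversing automorphism. It has type $\{s,t\}$ if all faces are $s$-gons and all vertices have valency $t$. For a group $G$ generated by an element $a$ and an involution $b$, let $\mathcal M(G;a,b)$ be the map whose arcs are the elements of $G$, where $g$ is the arc from the vertex $\langle a\rangle g$ to the vertex $\langle a\rangle bg$, where the rotation at the initial vertex sends $g$ to $ag$, and where $bg$ is the reverse of $g$. With $u^{v}=v^{-1}uv$ and $[u,v]=u^{-1}v^{-1}uv$, for $e\ge 2$ and $l\in\{0,1,-1\}$ put $$G_4(k,e,1,l)=\langle a,b\mid a^{2n}=b^2=1,\ a^2=x,\ x^b=y,\ [x,y]=x^{\frac n3}y^{-\frac n3},\ y^a=x^{-1}y^{-1},\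 (ab)^3=x^{\frac{ln}3}y^{-\frac{ln}3}\rangle,$$ and for $j=\pm1$ let $\mathcal M_4(k,e,1,l,j)=\mathcal M(G_4(k,e,1,l);a^{j},b)$. (1) Let $\mathcal M$ be an orientably-regular embedding of $K_{3[n]}$, let $H\le \mathrm{Aut}^{+}(\mathcal M)$ be the subgroup of the automorphisms that preserve each part setwise, and let $P$ be a Sylow $3$-subgroup of $\mathrm{Aut}^{+}(\mathcal M)$. If $H$ is nonabelian and $P$ has exponent $3^{e}$, then $e\ge 2$ and $\mathcal M$ is isomorphic to $\mathcal M_4(k,e,1,l,j)$ for some $l\in\{0,1,-1\}$ and $j\in\{1,-1\}$. (2) Conversely, if $e\ge 2$, then for all $l\in\{0,1,-1\}$ and $j\in\{1,-1\}$ the map $\mathcal M_4(k,e,1,l,j)$ is a chiral orientably-regular embedding of $K_{3[n]}$, of type $\{3,2n\}$ if $l=0$ and of type $\{9,2n\}$ if $l=\pm1$. -/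

import Mathlib

universe u

/-- An oriented map, in the standard combinatorial encoding: a set of darts (arcs), a permutation
`rot` that rotates every arc to the next arc (in the chosen orientation) with the same initial
vertex, and a fixed-point-free involution `inv` that reverses every arc, such that the group
generated by the two is transitive (the surface is connected).  Vertices, edges and faces are the
cycles of `rot`, of `inv` and of `rot ∘ inv`.  Closed surfaces are the case of finitely many darts,
which is automatic for embeddings of finite graphs. -/
structure OrientedMap where
  Dart : Type u
  rot : Equiv.Perm Dart
  inv : Equiv.Perm Dart
  inv_inv : ∀ d, inv (inv d) = d
  inv_ne : ∀ d, inv d ≠ d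
  connected : ∀ d d', ∃ g ∈ Subgroup.closure {rot, inv}, g d = d'

namespace OrientedMap

/-- Orientation-preserving isomorphism of oriented maps. -/
def Iso (M : OrientedMap) (N : OrientedMap) : Prop :=
  ∃ f : M.Dart ≃ N.Dart, ∀ d, f (M.rot d) = N.rot (f d) ∧ f (M.inv d) = N.inv (f d)

/-- The group `Aut⁺(M)` of orientation-preserving automorphisms: the permutations of the darts that
commute with the rotation and with the arc reversal. -/
def autPlus (M : OrientedMap) : Subgroup (Equiv.Perm M.Dart) :=
  Subgroup.centralizer {M.rot, M.inv}

/-- `Aut⁺(M)` acts regularly on the arcs. -/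
def IsOrientablyRegular (M : OrientedMap) : Prop :=
  ∀ d d', ∃! g : M.autPlus, (g : Equiv.Perm M.Dart) d = d'

/-- `M` admits an orientation-reversing automorphism. -/
def HasReversingAut (M : OrientedMap) : Prop :=
  ∃ f : Equiv.Perm M.Dart, ∀ d, f (M.rot d) = M.rot.symm (f d) ∧ f (M.inv d) = M.inv (f d)

/-- A chiral map: orientably-regular, without orientation-reversing automorphisms. -/
def IsChiral (M : OrientedMap) : Prop :=
  M.IsOrientablyRegular ∧ ¬ M.HasReversingAut

/-- Type `{s, t}`: all faces are `s`-gons and all vertices have valency `t`.  Going along an arc,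
turning it round at its end and rotating gives the next arc of the boundary of a face. -/
def HasType (M : OrientedMap) (s t : ℕ) : Prop :=
  (∀ d, Function.minimalPeriod (fun c => M.rot (M.inv c)) d = s) ∧
    ∀ d, Function.minimalPeriod M.rot d = t

/-- `M` is an embedding of the simple graph `Γ`: an identification of the darts of `M` with the arcs
of `Γ` under which reversal is reversal and two darts have the same vertex (they lie in the same
cycle of the rotation) exactly if the arcs have the same initial vertex. -/
structure Embedding (M : OrientedMap) {V : Type*} (Γ : SimpleGraph V) where
  toEquiv : M.Dart ≃ Γ.Dart
  map_inv : ∀ d, toEquiv (M.inv d) = (toEquiv d).symm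
  sameCycle_iff : ∀ d d', M.rot.SameCycle d d' ↔ (toEquiv d).fst = (toEquiv d').fst
  exists_dart : ∀ v : V, ∃ d, (toEquiv d).fst = v

end OrientedMap

/-- The complete multipartite graph `K_{m[n]}` with `m` parts of `n` vertices each; the part of a
vertex is its first component. -/
abbrev completeEquipartite (m n : ℕ) : SimpleGraph (Σ _ : Fin m, Fin n) :=
  SimpleGraph.completeMultipartiteGraph fun _ : Fin m => Fin n

/-- The subgroup `Aut⁺₀(M)` of those orientation-preserving automorphisms of an embedding `M` of
`K_{m[n]}` that preserve each part setwise. -/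
def OrientedMap.autZero {M : OrientedMap} {m n : ℕ}
    (φ : M.Embedding (completeEquipartite m n)) : Subgroup M.autPlus where
  carrier := {g | ∀ d, (φ.toEquiv ((g : Equiv.Perm M.Dart) d)).fst.1 = (φ.toEquiv d).fst.1}
  one_mem' := fun _ => rfl
  mul_mem' := fun {g h} hg hh d => (hg ((h : Equiv.Perm M.Dart) d)).trans (hh d)
  inv_mem' := fun {g} hg d => by
    have h := hg ((g : Equiv.Perm M.Dart)⁻¹ d)
    have h2 : (g : Equiv.Perm M.Dart) ((g : Equiv.Perm M.Dart)⁻¹ d) = d :=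
      Equiv.apply_symm_apply (g : Equiv.Perm M.Dart) d
    rw [h2] at h
    exact h.symm

/-- The algebraic map `M(G; a, b)` of a group `G` generated by an element `a` and an involution `b`.
The element `g` stands for the arc from the coset `⟨a⟩g` to the coset `⟨a⟩bg`; the rotation sends
this arc to the arc from `⟨a⟩g` to `⟨a⟩bag`, which is the arc of `ag`, and the reversed arc is that
of `bg`. -/
def algebraicMap {G : Type u} [Group G] (a b : G) (hb : b * b = 1) (hb1 : b ≠ 1)
    (hgen : Subgroup.closure {a, b} = ⊤) : OrientedMap.{u} where
  Dart := G
  rot := Equiv.mulLeft a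
  inv := Equiv.mulLeft b
  inv_inv := fun d => by simp [← mul_assoc, hb]
  inv_ne := fun d => by simpa using hb1
  connected := fun d d' => by
    have h : d' * d⁻¹ ∈ Subgroup.closure {a, b} := by rw [hgen]; trivial
    have h2 := Subgroup.mem_map_of_mem (MulAction.toPermHom G G) h
    rw [MonoidHom.map_closure, Set.image_pair] at h2
    exact ⟨_, h2, by simp⟩

namespace G4

/-- The two generators of `G₄(k,e,i,l)`. -/
inductive Gen
  | a
  | b

/-- The free generator `a`. -/
def fa : FreeGroup Gen := FreeGroup.of Gen.a

/-- The free generator `b`. -/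
def fb : FreeGroup Gen := FreeGroup.of Gen.b

/-- `x = a²`. -/
def fx : FreeGroup Gen := fa ^ 2

/-- `y = x^b = b⁻¹xb`. -/
def fy : FreeGroup Gen := fb⁻¹ * fx * fb

/-- The relators of `G₄(k,e,i,l)`, one for each of the relations (with `n = 3^e k`)
`a^{2n} = 1`, `b² = 1`, `[x,y] = x^{in/3}y^{-in/3}`, `y^a = x⁻¹y⁻¹`, `(ab)³ = x^{ln/3}y^{-ln/3}`,
where `[x,y] = x⁻¹y⁻¹xy`. -/
def rels (k e : ℕ) (i l : ℤ) : Set (FreeGroup Gen) :=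
  {fa ^ (2 * (3 ^ e * k)),
    fb ^ 2,
    (fx⁻¹ * fy⁻¹ * fx * fy) *
      (fx ^ (i * (3 ^ e * k / 3 : ℕ)) * fy ^ (-(i * (3 ^ e * k / 3 : ℕ))))⁻¹,
    (fa⁻¹ * fy * fa) * (fx⁻¹ * fy⁻¹)⁻¹,
    (fa * fb) ^ 3 *
      (fx ^ (l * (3 ^ e * k / 3 : ℕ)) * fy ^ (-(l * (3 ^ e * k / 3 : ℕ))))⁻¹}

end G4

/-- The group `G₄(k,e,i,l)`. -/
abbrev G4 (k e : ℕ) (i l : ℤ) : Type := PresentedGroup (G4.rels k e i l)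

namespace G4

/-- The generator `a` of `G₄(k,e,i,l)`. -/
def a (k e : ℕ) (i l : ℤ) : G4 k e i l := PresentedGroup.of Gen.a

/-- The generator `b` of `G₄(k,e,i,l)`. -/
def b (k e : ℕ) (i l : ℤ) : G4 k e i l := PresentedGroup.of Gen.b

theorem b_mul_b (k e : ℕ) (i l : ℤ) : b k e i l * b k e i l = 1 := by
  have h : PresentedGroup.mk (rels k e i l) (fb ^ 2) = 1 :=
    PresentedGroup.one_of_mem (by simp [rels])
  rw [pow_two, map_mul] at h
  exact h

theorem b_ne_one (k e : ℕ) (i l : ℤ) : b k e i l ≠ 1 := by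
  intro h
  let s : Gen → Multiplicative (ZMod 2) := fun _ => Multiplicative.ofAdd 1
  have hsq : ∀ z : Multiplicative (ZMod 2), z ^ 2 = 1 := by decide
  have hx : FreeGroup.lift s fx = 1 := by rw [fx, map_pow, hsq]
  have hy : FreeGroup.lift s fy = 1 := by simp [fy, hx]
  have hr : ∀ r ∈ rels k e i l, FreeGroup.lift s r = 1 := by
    intro r hr
    simp only [rels, Set.mem_insert_iff, Set.mem_singleton_iff] at hr
    rcases hr with rfl | rfl | rfl | rfl | rfl
    · rw [map_pow, pow_mul, hsq, one_pow]
    · rw [map_pow, hsq]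
    · simp [hx, hy]
    · simp [hx, hy]
    · simp only [map_mul, map_inv, map_zpow, map_pow, hx, hy, fa, fb, FreeGroup.lift_apply_of, s]
      simp
      decide
  have h2 := congrArg (PresentedGroup.toGroup hr) h
  rw [b, PresentedGroup.toGroup.of, map_one] at h2
  exact absurd h2 (by decide)

theorem closure_eq_top (k e : ℕ) (i l : ℤ) (j : ℤˣ) :
    Subgroup.closure {a k e i l ^ (j : ℤ), b k e i l} = ⊤ := by
  rw [eq_top_iff, ← PresentedGroup.closure_range_of, Subgroup.closure_le]
  rintro _ ⟨g, rfl⟩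
  cases g with
  | a =>
    have h : a k e i l ^ (j : ℤ) ∈ Subgroup.closure {a k e i l ^ (j : ℤ), b k e i l} :=
      Subgroup.subset_closure (by simp)
    have h2 := Subgroup.zpow_mem _ h (j : ℤ)
    rwa [← zpow_mul, ← Units.val_mul, Int.units_mul_self, Units.val_one, zpow_one] at h2
  | b => exact Subgroup.subset_closure (by simp [b])

end G4

/-- The map `M₄(k,e,i,l,j) = M(G₄(k,e,i,l); a^j, b)` for `j = ±1`. -/
def M4 (k e : ℕ) (i l : ℤ) (j : ℤˣ) : OrientedMap.{0} :=
  algebraicMap (G4.a k e i l ^ (j : ℤ)) (G4.b k e i l) (G4.b_mul_b k e i l) (G4.b_ne_one k e i l)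
    (G4.closure_eq_top k e i l j)

/-! Fix an arc of an orientably-regular embedding. The automorphism group is generated by an element
`a` of order 2n that turns the arc about its initial vertex and an involution `b` that reverses it.
With x = a² and y = x^b, the part-preserving subgroup H is the product ⟨x⟩⟨y⟩ with trivial
intersection, and (ab)³ lies in H (`OrientedMap.Embedding.triFact`). The rest of the classification
is group theory of such factorizations (`TriFact`).

Counting shows that ⟨x⟩ meets ⟨x⟩^y nontrivially, so for some prime p the subgroup of order p of ⟨x⟩
is normalised by y. It is then central in H, and an induction gives this for every prime p dividing
n (`TriFact.commute_x_pow`). So ⟨x^(n/p), y^(n/p)⟩ is a central layer of order p², normal in the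
whole group, and its quotient is a factorization of the same kind for n/p. On a layer `a` fixes
x^(n/p) and sends y^(n/p) to x^(-n/p)y^(-n/p). An element of a layer inverted by `a` and `b`, as
[x,y] is, must be trivial for p ≠ 3 and a power of x^(n/3)y^(-n/3) for p = 3.
`zpow_eq_one_of_layers` prevents the commutator from reaching below one 3-layer. This yields the
relations of H (`TriFact.relations`).

The exponent of P enters at one point. The map h ↦ h^(n/3) is multiplicative on coordinates
(`TriFact.mul_pow_third`), and the exponent gives (ab)^n = 1, so both coordinates of (ab)³ are
multiples of 3. Invariance of (ab)³ under conjugation by ab then determines it up to l mod 3. The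
sign of the exponent of [x,y] is absorbed by replacing `a` with its inverse, which is the parameter
j.

Conversely, the relations of G₄ bound its order by 6n² (`TypeFour.finite_and_card_le`), while an
explicit action on 3n points is transitive on the 6n² arcs of K_{3[n]}
(`TripartiteModel.Rep.arc_surjective`). Hence arcs and group elements correspond. The same bound
turns the epimorphism from G₄ onto the automorphism group into an isomorphism of maps. Chirality
holds because inverting `a` would invert the nontrivial value of [x,y]. -/

/-! ### Conjugation and products of two cyclic groups -/

/-- Conjugation `v ↦ g⁻¹vg` by an element of a group. -/
def cj {G : Type*} [Group G] (g : G) : G →* G := (MulAut.conj g⁻¹).toMonoidHom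

theorem cj_apply {G : Type*} [Group G] (g v : G) : cj g v = g⁻¹ * v * g := by simp [cj]

theorem cj_mul {G : Type*} [Group G] (g h v : G) : cj (g * h) v = cj h (cj g v) := by
  simp only [cj_apply]; group

theorem cj_eq_self_iff {G : Type*} [Group G] {g v : G} : cj g v = v ↔ Commute g v := by
  rw [cj_apply, mul_assoc, inv_mul_eq_iff_eq_mul]
  exact ⟨fun h => h.symm, fun h => h.symm⟩

theorem cj_injective {G : Type*} [Group G] (g : G) : Function.Injective (cj g) :=
  (MulAut.conj g⁻¹).injective

theorem Commute.map_cj {G : Type*} [Group G] {v w : G} (h : Commute v w) (g : G) :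
    Commute (cj g v) (cj g w) := h.map (cj g)

/-- If `v ∈ ⟨x⟩` and `v` is conjugated by `g` into a power of itself for one generator, the same
holds for all powers. -/
theorem cj_pow_mem_zpowers {G : Type*} [Group G] {g v : G} {r : ℤ} (h : cj g v = v ^ r) (j : ℕ) :
    cj (g ^ j) v = v ^ (r ^ j) := by
  induction j with
  | zero => simp [cj_apply]
  | succ j ih => rw [pow_succ, cj_mul, ih, map_zpow, h, ← zpow_mul, pow_succ, mul_comm]

/-- Two elements that normalise each other's cyclic groups commute if these intersect trivially. -/
theorem commute_of_normalize {G : Type*} [Group G] {v w : G} {r s : ℤ} (h1 : cj w v = v ^ r)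
    (h2 : cj v w = w ^ s) (hd : ∀ i j : ℤ, v ^ i = w ^ j → v ^ i = 1) : Commute v w := by
  have h3 : v ^ (-1 + r) = w ^ (-s + 1) := by
    have h1' : v ^ r = w⁻¹ * v * w := by rw [← h1, cj_apply]
    have h2' : w ^ s = v⁻¹ * w * v := by rw [← h2, cj_apply]
    rw [zpow_add, zpow_add, h1', zpow_neg w, h2']; group
  have h4 := hd _ _ h3
  rw [zpow_add, zpow_neg_one, inv_mul_eq_one] at h4
  rw [← h4] at h1
  exact (cj_eq_self_iff.1 h1).symm

/-- A group generated by `a` and an involution `b`, with a normal subgroup `H` that is the product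
`⟨x⟩⟨y⟩` of two cyclic groups of order `n` with trivial intersection, where `x = a²` and `y = x^b`,
and that contains `(ab)³`. -/
structure TriFact {G : Type*} [Group G] (a b x y : G) (H : Subgroup G) (n : ℕ) : Prop where
  pos : 0 < n
  gen : Subgroup.closure {a, b} = ⊤
  b_sq : b * b = 1
  x_eq : x = a ^ 2
  y_eq : y = cj b x
  normal : H.Normal
  x_mem : x ∈ H
  cube_mem : (a * b) ^ 3 ∈ H
  x_pow : x ^ n = 1
  span : ∀ h ∈ H, ∃ i j : ℤ, h = x ^ i * y ^ j
  disj : ∀ i j : ℤ, x ^ i = y ^ j → (n : ℤ) ∣ i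

theorem zpow_sub_of_mul_eq {G : Type*} [Group G] {v w : G} {i j k l : ℤ}
    (h : v ^ i * w ^ j = v ^ k * w ^ l) : v ^ (i - k) = w ^ (l - j) := by
  have h1 : v ^ (-k) * (v ^ i * w ^ j) * w ^ (-j) = v ^ (-k) * (v ^ k * w ^ l) * w ^ (-j) := by
    rw [h]
  calc v ^ (i - k) = v ^ (-k) * (v ^ i * w ^ j) * w ^ (-j) := by group
    _ = _ := h1
    _ = _ := by group

namespace TriFact

variable {G : Type u} [Group G] {a b x y : G} {H : Subgroup G} {n : ℕ}

theorem cj_a_x (T : TriFact a b x y H n) : cj a x = x := by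
  rw [T.x_eq, cj_apply]; group

theorem cj_b_x (T : TriFact a b x y H n) : cj b x = y := T.y_eq.symm

theorem cj_b_b (T : TriFact a b x y H n) (v : G) : cj b (cj b v) = v := by
  rw [← cj_mul, T.b_sq, cj_apply]; group

theorem cj_b_y (T : TriFact a b x y H n) : cj b y = x := by rw [T.y_eq, T.cj_b_b]

theorem cj_a_a (T : TriFact a b x y H n) (v : G) : cj a (cj a v) = cj x v := by
  rw [← cj_mul, T.x_eq, pow_two]

theorem cj_cube (_ : TriFact a b x y H n) (v : G) :
    cj b (cj a (cj b (cj a (cj b (cj a v))))) = cj ((a * b) ^ 3) v := by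
  simp only [← cj_mul]; congr 1; simp only [pow_succ, pow_zero, one_mul, mul_assoc]

theorem cj_mem (T : TriFact a b x y H n) {h : G} (hh : h ∈ H) (g : G) : cj g h ∈ H := by
  rw [cj_apply]
  simpa using T.normal.conj_mem h hh g⁻¹

theorem y_mem (T : TriFact a b x y H n) : y ∈ H := T.y_eq ▸ T.cj_mem T.x_mem b

theorem y_pow (T : TriFact a b x y H n) : y ^ n = 1 := by
  rw [T.y_eq, ← map_pow, T.x_pow, map_one]

theorem x_zpow_eq_one (T : TriFact a b x y H n) {i : ℤ} : x ^ i = 1 ↔ (n : ℤ) ∣ i := by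
  refine ⟨fun h => T.disj i 0 (by simpa using h), ?_⟩
  rintro ⟨k, rfl⟩
  rw [zpow_mul, zpow_natCast, T.x_pow, one_zpow]

theorem y_zpow_eq_one (T : TriFact a b x y H n) {i : ℤ} : y ^ i = 1 ↔ (n : ℤ) ∣ i := by
  rw [← T.x_zpow_eq_one, T.y_eq, ← map_zpow, map_eq_one_iff _ (cj_injective b)]

theorem disj' (T : TriFact a b x y H n) {i j : ℤ} (h : x ^ i = y ^ j) :
    (n : ℤ) ∣ i ∧ (n : ℤ) ∣ j := by
  have h1 := T.disj i j h
  exact ⟨h1, T.y_zpow_eq_one.1 (h ▸ T.x_zpow_eq_one.2 h1)⟩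

theorem uniq (T : TriFact a b x y H n) {i j k l : ℤ} (h : x ^ i * y ^ j = x ^ k * y ^ l) :
    (n : ℤ) ∣ i - k ∧ (n : ℤ) ∣ l - j := by
  exact T.disj' (zpow_sub_of_mul_eq h)

theorem zpow_toNat {v : G} {n : ℕ} (hn : 0 < n) (hv : v ^ n = 1) (i : ℤ) :
    v ^ i = v ^ (i % n).toNat := by
  have h : ((i % n).toNat : ℤ) = i % n := Int.toNat_of_nonneg (Int.emod_nonneg _ (by omega))
  rw [← zpow_natCast, h]
  conv_lhs => rw [← Int.emod_add_mul_ediv i n, zpow_add, zpow_mul, zpow_natCast, hv, one_zpow, mul_one]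

theorem span_nat (T : TriFact a b x y H n) {h : G} (hh : h ∈ H) :
    ∃ i < n, ∃ j < n, h = x ^ i * y ^ j := by
  obtain ⟨i, j, rfl⟩ := T.span h hh
  have hn := T.pos
  refine ⟨(i % n).toNat, ?_, (j % n).toNat, ?_, ?_⟩
  · have := Int.emod_lt_of_pos i (by omega : (0 : ℤ) < n); omega
  · have := Int.emod_lt_of_pos j (by omega : (0 : ℤ) < n); omega
  · rw [zpow_toNat hn T.x_pow i, zpow_toNat hn T.y_pow j]

/-- The cyclic groups `⟨x⟩` and `⟨x⟩^y` have a nontrivial intersection. -/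
theorem exists_inter (T : TriFact a b x y H n) (hn : 1 < n) :
    ∃ i j : ℤ, x ^ i = cj y (x ^ j) ∧ ¬ (n : ℤ) ∣ i := by
  classical
  -- If the intersection were trivial, the products in ⟨x⟩⟨x⟩^y would be n² distinct elements of H,
  -- hence all of H. Writing y = x^i · y⁻¹x^j y and cancelling then puts y in ⟨x⟩.
  by_contra! hc
  let S := (Finset.range n) ×ˢ (Finset.range n)
  let f : ℕ × ℕ → G := fun p => x ^ p.1 * y ^ p.2
  let g : ℕ × ℕ → G := fun p => x ^ p.1 * cj y (x ^ p.2)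
  have hg : Set.InjOn g S := by
    rintro ⟨i, j⟩ h1 ⟨k, l⟩ h2 h
    simp only [S, Finset.coe_product, Finset.coe_range, Set.mem_prod, Set.mem_Iio] at h1 h2
    have h3 : x ^ ((i : ℤ) - k) = cj y (x ^ ((l : ℤ) - j)) := by
      rw [map_zpow]
      apply zpow_sub_of_mul_eq
      simpa [g] using h
    have h5 := hc _ _ h3
    have h6 : x ^ ((l : ℤ) - j) = 1 := by
      rw [T.x_zpow_eq_one.2 h5] at h3
      exact (map_eq_one_iff _ (cj_injective y)).1 h3.symm
    have h7 := T.x_zpow_eq_one.1 h6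
    have e1 : (i : ℤ) - k = 0 := Int.eq_zero_of_abs_lt_dvd h5 (by rw [abs_lt]; omega)
    have e2 : (l : ℤ) - j = 0 := Int.eq_zero_of_abs_lt_dvd h7 (by rw [abs_lt]; omega)
    ext <;> simp <;> omega
  have hsub : S.image g ⊆ S.image f := by
    intro v hv
    obtain ⟨p, -, rfl⟩ := Finset.mem_image.1 hv
    obtain ⟨i, hi, j, hj, h⟩ := T.span_nat (H.mul_mem (H.pow_mem T.x_mem p.1)
      (T.cj_mem (H.pow_mem T.x_mem p.2) y))
    exact Finset.mem_image.2 ⟨(i, j), by simp [S, hi, hj], h.symm⟩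
  have heq := Finset.eq_of_subset_of_card_le hsub
    (by rw [Finset.card_image_of_injOn hg]; exact Finset.card_image_le)
  have hy : y ∈ S.image g := by
    rw [heq]; exact Finset.mem_image.2 ⟨(0, 1), by simp [S]; omega, by simp [f]⟩
  obtain ⟨⟨i, j⟩, -, h⟩ := Finset.mem_image.1 hy
  have h1 : y ^ (1 : ℤ) = x ^ ((j : ℤ) + i) := by
    simp only [g, cj_apply] at h
    rw [zpow_add, zpow_natCast, zpow_natCast, zpow_one]
    have h2 : x ^ i * (y⁻¹ * x ^ j) * y = 1 * y := by rw [one_mul]; simpa [mul_assoc] using h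
    have h3 := mul_right_cancel h2
    rw [← mul_assoc, mul_eq_one_iff_eq_inv] at h3
    rw [mul_inv_eq_iff_eq_mul] at h3
    have h4 : x ^ i = (x ^ j)⁻¹ * y := h3
    rw [h4]; group
  have := (T.disj' h1.symm).2
  have := Int.le_of_dvd one_pos this
  omega

/-- Elements of order dividing `p` of `⟨x⟩`. -/
theorem zpow_of_mul_dvd {p m : ℕ} (hp : 0 < p) {i : ℤ} (h : ((p * m : ℕ) : ℤ) ∣ i * p) (v : G) :
    ∃ r : ℤ, v ^ i = (v ^ m) ^ r := by
  obtain ⟨r, hr⟩ := h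
  have : i = m * r := by
    have h2 : (p : ℤ) ≠ 0 := by exact_mod_cast hp.ne'
    apply mul_left_cancel₀ h2
    rw [mul_comm, hr]; push_cast; ring
  exact ⟨r, by rw [this, zpow_mul, zpow_natCast]⟩

theorem x_pow_zpow_eq_one {p m : ℕ} (T : TriFact a b x y H (p * m)) {i : ℤ} :
    (x ^ m) ^ i = 1 ↔ (p : ℤ) ∣ i := by
  have hm : (m : ℤ) ≠ 0 := by
    have := T.pos
    exact_mod_cast (Nat.pos_of_mul_pos_left this).ne'
  rw [← zpow_natCast, ← zpow_mul, T.x_zpow_eq_one, Nat.cast_mul, mul_comm (m : ℤ),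
    mul_dvd_mul_iff_right hm]

theorem y_pow_zpow_eq_one {p m : ℕ} (T : TriFact a b x y H (p * m)) {i : ℤ} :
    (y ^ m) ^ i = 1 ↔ (p : ℤ) ∣ i := by
  rw [← T.x_pow_zpow_eq_one, T.y_eq, ← map_pow, ← map_zpow, map_eq_one_iff _ (cj_injective b)]

theorem disj_pow {p m : ℕ} (T : TriFact a b x y H (p * m)) {i j : ℤ}
    (h : (x ^ m) ^ i = (y ^ m) ^ j) : (p : ℤ) ∣ i ∧ (p : ℤ) ∣ j := by
  have h2 : x ^ (m * i : ℤ) = y ^ (m * j : ℤ) := by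
    simpa [zpow_mul, zpow_natCast] using h
  have h3 := T.disj' h2
  rw [← T.x_zpow_eq_one, ← T.y_zpow_eq_one, zpow_mul, zpow_mul, zpow_natCast, zpow_natCast,
    T.x_pow_zpow_eq_one, T.y_pow_zpow_eq_one] at h3
  exact h3

theorem uniq_pow {p m : ℕ} (T : TriFact a b x y H (p * m)) {i j k l : ℤ}
    (h : (x ^ m) ^ i * (y ^ m) ^ j = (x ^ m) ^ k * (y ^ m) ^ l) :
    (p : ℤ) ∣ i - k ∧ (p : ℤ) ∣ l - j := by
  exact T.disj_pow (zpow_sub_of_mul_eq h)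

/-- For some prime divisor `p` of `n` the subgroup of order `p` of `⟨x⟩` is normalised by `y`. -/
theorem exists_prime (T : TriFact a b x y H n) (hn : 1 < n) :
    ∃ p m : ℕ, p.Prime ∧ n = p * m ∧ ∃ r : ℤ, cj y (x ^ m) = (x ^ m) ^ r := by
  obtain ⟨i, j, h, hi⟩ := T.exists_inter hn
  have h1 : x ^ i ≠ 1 := fun h => hi (T.x_zpow_eq_one.1 h)
  obtain ⟨p, hp, d, hd⟩ := Nat.exists_prime_and_dvd (n := orderOf (x ^ i)) (by
    rwa [Ne, orderOf_eq_one_iff])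
  have hdn : orderOf (x ^ i) ∣ n := orderOf_dvd_of_pow_eq_one (by
    rw [← zpow_natCast, ← zpow_mul, T.x_zpow_eq_one]; exact dvd_mul_left _ _)
  have hpn : p ∣ n := (hd ▸ dvd_mul_right p d).trans hdn
  obtain ⟨m, rfl⟩ := hpn
  have hpow : (x ^ i) ^ (d * p) = 1 := by rw [mul_comm, ← hd, pow_orderOf_eq_one]
  have e1 : x ^ (i * d * p) = 1 := by
    rw [← hpow, mul_assoc, zpow_mul, ← Nat.cast_mul, zpow_natCast]
  have e2 : x ^ (j * d * p) = 1 := by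
    apply cj_injective y
    rw [map_one, mul_assoc, zpow_mul, ← Nat.cast_mul, zpow_natCast, map_pow, ← h, hpow]
  -- Raising to the power d = order/p leaves elements of order dividing p. A cyclic group has only
  -- one subgroup of order p, so both sides lie in ⟨x^m⟩.
  obtain ⟨r, hr⟩ := zpow_of_mul_dvd hp.pos (T.x_zpow_eq_one.1 e1) x
  obtain ⟨s, hs⟩ := zpow_of_mul_dvd hp.pos (T.x_zpow_eq_one.1 e2) x
  have h3 : cj y ((x ^ m) ^ s) = (x ^ m) ^ r := by
    rw [← hr, ← hs, zpow_mul, zpow_mul, map_zpow, ← h]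
  have h4 : ¬ (p : ℤ) ∣ s := by
    intro h5
    rw [T.x_pow_zpow_eq_one.2 h5, map_one, ← hr, zpow_mul, zpow_natCast, eq_comm] at h3
    have h6 := orderOf_dvd_of_pow_eq_one h3
    rw [hd] at h6
    have h7 : 0 < orderOf (x ^ i) := Nat.pos_of_dvd_of_pos hdn T.pos
    rw [hd] at h7
    have := Nat.le_of_dvd (Nat.pos_of_mul_pos_left h7) h6
    have := hp.two_le
    nlinarith
  -- Since s is invertible mod p, (x^m)^s is again a generator of ⟨x^m⟩.
  obtain ⟨t, k, htk⟩ : IsCoprime (s : ℤ) p :=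
    ((Nat.prime_iff_prime_int.1 hp).coprime_iff_not_dvd.2 h4).symm
  refine ⟨p, m, hp, rfl, r * t, ?_⟩
  rw [zpow_mul, ← h3, ← map_zpow, ← zpow_mul]
  congr 1
  have h9 : (x ^ m) ^ (k * p) = 1 := T.x_pow_zpow_eq_one.2 (dvd_mul_left _ _)
  calc x ^ m = (x ^ m) ^ (t * s + k * p) := by rw [htk, zpow_one]
    _ = _ := by rw [zpow_add, h9, mul_one, mul_comm]

end TriFact

/-! ### Central layers of prime exponent and their quotients -/

namespace TriFact

variable {G : Type u} [Group G] {a b x y : G} {H : Subgroup G} {n p m : ℕ}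

theorem normalize_mem (T : TriFact a b x y H n) {r : ℤ} (hr : cj y (x ^ m) = (x ^ m) ^ r)
    {h : G} (hh : h ∈ H) : ∃ s : ℤ, cj h (x ^ m) = (x ^ m) ^ s := by
  obtain ⟨i, -, j, -, rfl⟩ := T.span_nat hh
  refine ⟨r ^ j, ?_⟩
  have h1 : cj (x ^ i) (x ^ m) = x ^ m := cj_eq_self_iff.2 ((Commute.refl x).pow_pow i m)
  rw [cj_mul, h1, cj_pow_mem_zpowers hr]

theorem conj_cj (g h v : G) : cj (cj g h) (cj g v) = cj g (cj h v) := by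
  simp only [cj_apply]; group

theorem cj_inv_self (g v : G) : cj g (cj g⁻¹ v) = v := by
  simp only [cj_apply]; group

theorem normalize_mem_b (T : TriFact a b x y H n) {r : ℤ} (hr : cj y (x ^ m) = (x ^ m) ^ r)
    {h : G} (hh : h ∈ H) : ∃ s : ℤ, cj h (y ^ m) = (y ^ m) ^ s := by
  obtain ⟨s, hs⟩ := T.normalize_mem hr (T.cj_mem hh b)
  refine ⟨s, ?_⟩
  have := congrArg (cj b) hs
  rwa [← conj_cj, T.cj_b_b, map_zpow, map_pow, T.cj_b_x] at this

/-- A subgroup of prime order `p` of `⟨x⟩` that is normalised by `y` is central in `H`, and together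
with its conjugates generates a group of order `p²`. -/
theorem central_of_normalize (T : TriFact a b x y H (p * m)) (hp : p.Prime) {r : ℤ}
    (hr : cj y (x ^ m) = (x ^ m) ^ r) : Commute (x ^ m) y ∧
      ∃ i j : ℤ, cj a (y ^ m) = (x ^ m) ^ i * (y ^ m) ^ j ∧ ¬ (p : ℤ) ∣ i := by
  have hax : cj a (x ^ m) = x ^ m := by rw [map_pow, T.cj_a_x]
  have hbx : cj b (x ^ m) = y ^ m := by rw [map_pow, T.cj_b_x]
  have hby : cj b (y ^ m) = x ^ m := by rw [map_pow, T.cj_b_y]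
  have hpi : Prime (p : ℤ) := Nat.prime_iff_prime_int.1 hp
  set x1 := x ^ m
  set y1 := y ^ m with hy1
  set w1 := cj a y1 with hw1
  have hxy : Commute x1 y1 := by
    have h1 : cj y1 x1 = x1 ^ (r ^ m) := cj_pow_mem_zpowers hr m
    obtain ⟨s, hs⟩ := T.normalize_mem_b hr (H.pow_mem T.x_mem m)
    exact commute_of_normalize h1 hs fun i j h => T.x_pow_zpow_eq_one.2 (T.disj_pow h).1
  have hcx : cj ((a * b) ^ 3) x1 = cj b (cj a (cj b w1)) := by
    rw [← T.cj_cube, hax, hbx]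
  obtain ⟨s, hs⟩ := T.normalize_mem hr T.cube_mem
  obtain ⟨s', hs'⟩ := T.normalize_mem hr (H.inv_mem T.cube_mem)
  -- Conjugation by ab carries the commuting pair (x1, y1) onwards. After three turns x1 has become
  -- a generator of ⟨x1⟩ again, because (ab)³ ∈ H normalises this group.
  have hyw : Commute y1 w1 := by
    have h1 := ((hxy.map_cj a).map_cj b)
    rw [hax, hbx] at h1
    have h2 := ((h1.map_cj a).map_cj b)
    rw [← hw1, ← hcx, hs] at h2
    have h3 : x1 = (x1 ^ s) ^ s' := by
      rw [← hs, ← map_zpow, ← hs', cj_inv_self]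
    have h4 := h2.zpow_right s'
    rw [← h3] at h4
    have h5 := h4.map_cj b
    rw [T.cj_b_b, hbx] at h5
    exact h5.symm
  have hw1H : w1 ∈ H := T.cj_mem (H.pow_mem T.y_mem m) a
  obtain ⟨i, j, hij⟩ := T.span w1 hw1H
  have hyx : Commute y1 (x ^ i) := by
    have h1 : x ^ i = w1 * (y ^ j)⁻¹ := by rw [hij]; group
    rw [h1]
    exact hyw.mul_right (((Commute.pow_self y m).zpow_right j).inv_right)
  have hwx : Commute w1 (x ^ i) := by
    have h1 := hyx.map_cj a
    rwa [map_zpow, T.cj_a_x] at h1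
  have hwp : w1 ^ p = 1 := by
    rw [hw1, ← map_pow, hy1, ← pow_mul, mul_comm, T.y_pow, map_one]
  have h1 : y ^ j = (x ^ i)⁻¹ * w1 := by rw [hij]; group
  -- As w1 has order dividing p and commutes with x^i, the pth powers of its two coordinates cancel.
  -- By trivial intersection both vanish, so w1 lies in the layer ⟨x1, y1⟩.
  have h2 : y ^ (j * p) = x ^ (-i * p) := by
    rw [zpow_mul, zpow_mul, zpow_natCast, zpow_natCast, h1, (hwx.symm.inv_left).mul_pow, hwp,
      mul_one, zpow_neg]
  have h3 := T.disj' h2.symm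
  obtain ⟨r1, hr1⟩ := zpow_of_mul_dvd hp.pos h3.1 x
  obtain ⟨s1, hs1⟩ := zpow_of_mul_dvd hp.pos h3.2 y
  have hw : w1 = x1 ^ (-r1) * y1 ^ s1 := by
    rw [hij, zpow_neg, ← hr1, ← hs1]; group
  -- If w1 were in ⟨y1⟩, then (ab)³ would carry x1 into ⟨y1⟩, although it normalises ⟨x1⟩.
  have hr1p : ¬ (p : ℤ) ∣ -r1 := by
    intro hd
    rw [T.x_pow_zpow_eq_one.2 hd, one_mul] at hw
    have e1 : x1 ^ s = y1 ^ s1 := by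
      rw [← hs, hcx, hw, map_zpow, hby, map_zpow, hax, map_zpow, hbx]
    have e2 := T.x_pow_zpow_eq_one.2 (T.disj_pow e1).1
    rw [← hs, map_eq_one_iff _ (cj_injective _)] at e2
    have e3 : x1 ^ (1 : ℤ) = 1 := by rw [zpow_one]; exact e2
    have e4 := T.x_pow_zpow_eq_one.1 e3
    exact hpi.not_isUnit (isUnit_of_dvd_one e4)
  refine ⟨?_, -r1, s1, hw, hr1p⟩
  -- Conjugation by x raises y1 to the power l, hence also w1 = y1^a, since `a` centralises x. But
  -- it fixes x1, and w1 has a nontrivial x1-coordinate, so l ≡ 1 mod p.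
  obtain ⟨l, hl⟩ := T.normalize_mem_b hr T.x_mem
  have e1 : cj x w1 = w1 ^ l := by
    have := congrArg (cj a) hl
    rwa [← conj_cj, T.cj_a_x, map_zpow] at this
  have e2 : x1 ^ (-r1) * y1 ^ (l * s1) = x1 ^ (-r1 * l) * y1 ^ (s1 * l) := by
    have h5 : cj x x1 = x1 := cj_eq_self_iff.2 (Commute.self_pow x m)
    rw [hw, map_mul, map_zpow, map_zpow, h5, hl, (hxy.zpow_zpow _ _).mul_zpow, ← zpow_mul,
      ← zpow_mul, ← zpow_mul] at e1
    exact e1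
  have e3 := (T.uniq_pow e2).1
  have e4 : (p : ℤ) ∣ -r1 * (1 - l) := by convert e3 using 1; ring
  have e5 := (hpi.dvd_or_dvd e4).resolve_left hr1p
  have e6 : y1 ^ l = y1 := by
    have := T.y_pow_zpow_eq_one.2 e5
    rw [zpow_sub, zpow_one, mul_inv_eq_one] at this
    exact this.symm
  have e7 : cj x y1 = y1 := hl.trans e6
  have e8 := (cj_eq_self_iff.1 e7).map_cj b
  rw [T.cj_b_x, hby] at e8
  exact e8.symm

theorem commute_b (T : TriFact a b x y H n) (hc : Commute (x ^ m) y) : Commute (y ^ m) x := by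
  have := hc.map_cj b
  rwa [map_pow, T.cj_b_x, T.cj_b_y] at this

theorem x_central (T : TriFact a b x y H n) (hc : Commute (x ^ m) y) {h : G} (hh : h ∈ H) :
    Commute (x ^ m) h := by
  obtain ⟨i, j, rfl⟩ := T.span h hh
  exact ((Commute.pow_self x m).zpow_right i).mul_right (hc.zpow_right j)

theorem y_central (T : TriFact a b x y H n) (hc : Commute (x ^ m) y) {h : G} (hh : h ∈ H) :
    Commute (y ^ m) h := by
  obtain ⟨i, j, rfl⟩ := T.span h hh
  exact ((T.commute_b hc).zpow_right i).mul_right ((Commute.pow_self y m).zpow_right j)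

/-- The action of `a` on the central subgroup `⟨x^m, y^m⟩` of order `p²`. -/
theorem cj_a_y_pow (T : TriFact a b x y H (p * m)) (hp : p.Prime) (hc : Commute (x ^ m) y) :
    cj a (y ^ m) = (x ^ m)⁻¹ * (y ^ m)⁻¹ := by
  have hpi : Prime (p : ℤ) := Nat.prime_iff_prime_int.1 hp
  have hax : cj a (x ^ m) = x ^ m := by rw [map_pow, T.cj_a_x]
  have hbx : cj b (x ^ m) = y ^ m := by rw [map_pow, T.cj_b_x]
  have hby : cj b (y ^ m) = x ^ m := by rw [map_pow, T.cj_b_y]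
  obtain ⟨-, r, s, hrs, hr⟩ := T.central_of_normalize hp (r := 1)
    (by rw [zpow_one]; exact cj_eq_self_iff.2 hc.symm)
  have hxy : Commute (x ^ m) (y ^ m) := hc.pow_right m
  have hxx : cj x (y ^ m) = y ^ m := cj_eq_self_iff.2 (T.commute_b hc).symm
  -- `a²` = x acts trivially on the layer; the x-coordinate gives r(s+1) ≡ 0, so s ≡ -1.
  have e1 : (x ^ m) ^ (r + r * s) * (y ^ m) ^ (s * s) = (x ^ m) ^ (0 : ℤ) * (y ^ m) ^ (1 : ℤ) := by
    have := T.cj_a_a (y ^ m)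
    rw [hrs, map_mul, map_zpow, map_zpow, hax, hrs, (hxy.zpow_zpow _ _).mul_zpow, ← mul_assoc,
      ← zpow_mul, ← zpow_mul, ← zpow_add, hxx] at this
    rw [this]; simp
  have e2 := (T.uniq_pow e1).1
  have e3 : (p : ℤ) ∣ s + 1 := by
    refine (hpi.dvd_or_dvd (?_ : (p : ℤ) ∣ r * (s + 1))).resolve_left hr
    convert e2 using 1; ring
  have hs : (y ^ m) ^ s = (y ^ m)⁻¹ := by
    have := T.y_pow_zpow_eq_one.2 e3
    rw [zpow_add, zpow_one] at this
    exact eq_inv_of_mul_eq_one_left this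
  rw [hs] at hrs
  have hu : cj ((a * b) ^ 3) (x ^ m) = x ^ m :=
    cj_eq_self_iff.2 (T.x_central hc T.cube_mem).symm
  have hcy : cj b (cj a (y ^ m)) = (y ^ m) ^ r * (x ^ m)⁻¹ := by
    rw [hrs, map_mul, map_inv, map_zpow, hbx, hby]
  -- (ab)³ ∈ H also acts trivially on the layer; this forces r ≡ -1.
  have e4 : (x ^ m) ^ (-r) * (y ^ m) ^ (r * r - 1) = (x ^ m) ^ (1 : ℤ) * (y ^ m) ^ (0 : ℤ) := by
    rw [← T.cj_cube, hax, hbx, hcy, map_mul, map_inv, map_zpow, hax, map_mul, map_inv, map_zpow,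
      hbx, hcy, (hxy.symm.zpow_left r).inv_right.mul_zpow] at hu
    have h5 : Commute ((x ^ m)⁻¹ ^ r) (y ^ m)⁻¹ := (hxy.inv_inv).zpow_left r
    rw [mul_assoc, h5.eq, ← mul_assoc, ← zpow_mul, inv_zpow', ← zpow_sub_one,
      ← (hxy.zpow_zpow _ _).eq] at hu
    rw [hu, zpow_one, zpow_zero, mul_one]
  have e5 : (p : ℤ) ∣ r + 1 := by
    obtain ⟨c, hc⟩ := (T.uniq_pow e4).1
    exact ⟨-c, by rw [mul_neg, ← hc]; ring⟩
  have hr' : (x ^ m) ^ r = (x ^ m)⁻¹ := by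
    have := T.x_pow_zpow_eq_one.2 e5
    rw [zpow_add, zpow_one] at this
    exact eq_inv_of_mul_eq_one_left this
  rw [hrs, hr']

end TriFact

theorem normal_of_cj_mem {G : Type*} [Group G] {a b : G} (hgen : Subgroup.closure {a, b} = ⊤)
    (hb2 : b * b = 1) {K : Subgroup G} (ha : ∀ v ∈ K, cj a v ∈ K) (ha' : ∀ v ∈ K, cj a⁻¹ v ∈ K)
    (hb : ∀ v ∈ K, cj b v ∈ K) : K.Normal := by
  have hbi : b⁻¹ = b := inv_eq_of_mul_eq_one_left hb2
  rw [← Subgroup.normalizer_eq_top_iff, eq_top_iff, ← hgen, Subgroup.closure_le]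
  rintro g (rfl | rfl)
  · rw [SetLike.mem_coe, Subgroup.mem_normalizer_iff]
    intro h
    refine ⟨fun hh => ?_, fun hh => ?_⟩
    · simpa [cj_apply] using ha' h hh
    · simpa [cj_apply, mul_assoc] using ha _ hh
  · rw [SetLike.mem_coe, Subgroup.mem_normalizer_iff]
    intro h
    refine ⟨fun hh => ?_, fun hh => ?_⟩
    · simpa [cj_apply, hbi] using hb h hh
    · simpa [cj_apply, mul_assoc] using hb _ hh

theorem mem_closure_pair_of_commute {G : Type*} [Group G] {v w : G} (h : Commute v w) {g : G} :
    g ∈ Subgroup.closure {v, w} ↔ ∃ i j : ℤ, g = v ^ i * w ^ j := by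
  constructor
  · intro hg
    induction hg using Subgroup.closure_induction with
    | mem z hz =>
      rcases hz with rfl | rfl
      · exact ⟨1, 0, by simp⟩
      · exact ⟨0, 1, by simp⟩
    | one => exact ⟨0, 0, by simp⟩
    | mul _ _ _ _ h1 h2 =>
      obtain ⟨i, j, rfl⟩ := h1
      obtain ⟨k, l, rfl⟩ := h2
      refine ⟨i + k, j + l, ?_⟩
      rw [zpow_add, zpow_add, mul_assoc, mul_assoc, ← mul_assoc (w ^ j),
        ← (h.zpow_zpow k j).eq, mul_assoc]
    | inv _ _ h1 =>
      obtain ⟨i, j, rfl⟩ := h1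
      refine ⟨-i, -j, ?_⟩
      rw [(h.zpow_zpow i j).eq, mul_inv_rev, zpow_neg, zpow_neg]
  · rintro ⟨i, j, rfl⟩
    exact Subgroup.mul_mem _ (Subgroup.zpow_mem _ (Subgroup.subset_closure (by simp)) _)
      (Subgroup.zpow_mem _ (Subgroup.subset_closure (by simp)) _)

theorem map_cj_apply {G G' : Type*} [Group G] [Group G'] (f : G →* G') (g v : G) :
    f (cj g v) = cj (f g) (f v) := by simp [cj_apply]

namespace TriFact

variable {G : Type u} [Group G] {a b x y : G} {H : Subgroup G} {n p m : ℕ}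

theorem layer_pow (T : TriFact a b x y H (p * m)) (hc : Commute (x ^ m) y) (i j : ℤ) :
    ((x ^ m) ^ i * (y ^ m) ^ j) ^ p = 1 := by
  have h1 : ((x ^ m) ^ i) ^ p = 1 := by
    rw [← zpow_natCast ((x ^ m) ^ i), ← zpow_mul, T.x_pow_zpow_eq_one]; exact dvd_mul_left _ _
  have h2 : ((y ^ m) ^ j) ^ p = 1 := by
    rw [← zpow_natCast ((y ^ m) ^ j), ← zpow_mul, T.y_pow_zpow_eq_one]; exact dvd_mul_left _ _
  rw [((hc.pow_right m).zpow_zpow i j).mul_pow, h1, h2, one_mul]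

/-- The quotient by a central subgroup of order `p²` generated by elements of `⟨x⟩` and `⟨y⟩`. -/
theorem exists_quotient (T : TriFact a b x y H (p * m)) (hp : p.Prime)
    (hc : Commute (x ^ m) y) : ∃ (N : Subgroup G) (_ : N.Normal),
      (∀ g, g ∈ N ↔ ∃ i j : ℤ, g = (x ^ m) ^ i * (y ^ m) ^ j) ∧
      TriFact (a : G ⧸ N) b x y (H.map (QuotientGroup.mk' N)) m := by
  have hax : cj a (x ^ m) = x ^ m := by rw [map_pow, T.cj_a_x]
  have hbx : cj b (x ^ m) = y ^ m := by rw [map_pow, T.cj_b_x]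
  have hby : cj b (y ^ m) = x ^ m := by rw [map_pow, T.cj_b_y]
  have hay := T.cj_a_y_pow hp hc
  have hxy : Commute (x ^ m) (y ^ m) := hc.pow_right m
  let N := Subgroup.closure {x ^ m, y ^ m}
  have hN : ∀ g, g ∈ N ↔ ∃ i j : ℤ, g = (x ^ m) ^ i * (y ^ m) ^ j :=
    fun g => mem_closure_pair_of_commute hxy
  have hx1 : x ^ m ∈ N := Subgroup.subset_closure (by simp)
  have hy1 : y ^ m ∈ N := Subgroup.subset_closure (by simp)
  have ha : ∀ v ∈ N, cj a v ∈ N := by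
    intro v hv
    obtain ⟨i, j, rfl⟩ := (hN v).1 hv
    rw [map_mul, map_zpow, map_zpow, hax, hay]
    exact N.mul_mem (N.zpow_mem hx1 _) (N.zpow_mem (N.mul_mem (N.inv_mem hx1) (N.inv_mem hy1)) _)
  have haa : ∀ v ∈ N, cj a (cj a v) = v := by
    intro v hv
    obtain ⟨i, j, rfl⟩ := (hN v).1 hv
    rw [T.cj_a_a, cj_eq_self_iff]
    exact (((T.x_central hc T.x_mem).zpow_left i).mul_left
      ((T.y_central hc T.x_mem).zpow_left j)).symm
  have ha' : ∀ v ∈ N, cj a⁻¹ v ∈ N := by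
    intro v hv
    have : cj a⁻¹ v = cj a v := by
      conv_lhs => rw [← haa v hv]
      rw [← cj_mul, mul_inv_cancel, cj_apply]; group
    rw [this]
    exact ha v hv
  have hb : ∀ v ∈ N, cj b v ∈ N := by
    intro v hv
    obtain ⟨i, j, rfl⟩ := (hN v).1 hv
    rw [map_mul, map_zpow, map_zpow, hbx, hby]
    exact N.mul_mem (N.zpow_mem hy1 _) (N.zpow_mem hx1 _)
  have hnorm : N.Normal := normal_of_cj_mem T.gen T.b_sq ha ha' hb
  have hpos := T.pos
  have hsurj : Function.Surjective (QuotientGroup.mk' N) := QuotientGroup.mk'_surjective N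
  refine ⟨N, hnorm, hN, Nat.pos_of_mul_pos_left hpos, ?_, ?_, ?_, ?_, ?_, ?_, ?_, ?_, ?_, ?_⟩
  · have := congrArg (Subgroup.map (QuotientGroup.mk' N)) T.gen
    rw [MonoidHom.map_closure, Set.image_pair, Subgroup.map_top_of_surjective _ hsurj] at this
    exact this
  · rw [← QuotientGroup.mk_mul, T.b_sq, QuotientGroup.mk_one]
  · rw [T.x_eq, QuotientGroup.mk_pow]
  · rw [T.y_eq]; exact map_cj_apply (QuotientGroup.mk' N) b x
  · exact T.normal.map _ hsurj
  · exact ⟨x, T.x_mem, rfl⟩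
  · exact ⟨_, T.cube_mem, rfl⟩
  · rw [← QuotientGroup.mk_pow]; exact (QuotientGroup.eq_one_iff _).2 hx1
  · rintro _ ⟨h, hh, rfl⟩
    obtain ⟨i, j, rfl⟩ := T.span h hh
    exact ⟨i, j, by simp⟩
  · intro i j h
    rw [← QuotientGroup.mk_zpow, ← QuotientGroup.mk_zpow, QuotientGroup.eq, hN] at h
    obtain ⟨r, s, h⟩ := h
    have h1 : x ^ (i + m * r) * y ^ (m * s) = x ^ (0 : ℤ) * y ^ j := by
      rw [zpow_add, mul_assoc, zpow_mul, zpow_natCast, zpow_mul, zpow_natCast, ← h]; simp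
    obtain ⟨c, hc⟩ := (T.uniq h1).1
    refine ⟨p * c - r, ?_⟩
    push_cast at hc
    linear_combination hc

/-- All elements of prime order of `⟨x⟩` are central in `H`. -/
theorem commute_x_pow : ∀ (n : ℕ) {G : Type u} [Group G] {a b x y : G} {H : Subgroup G},
    TriFact a b x y H n → ∀ {p m : ℕ}, p.Prime → n = p * m → Commute (x ^ m) y := by
  intro n
  induction n using Nat.strong_induction_on with
  | _ n ih =>
  intro G _ a b x y H T p m hp hn
  have hn1 : 1 < n := by
    have := T.pos
    have := hp.two_le
    rcases Nat.eq_zero_or_pos m with rfl | hm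
    · omega
    · nlinarith
  obtain ⟨q, l, hq, rfl, r, hr⟩ := T.exists_prime hn1
  have hcq := (T.central_of_normalize hq hr).1
  by_cases hpq : p = q
  · subst hpq
    rwa [← Nat.eq_of_mul_eq_mul_left hp.pos hn]
  obtain ⟨N, hN, hmem, T'⟩ := T.exists_quotient hq hcq
  have hpl : p ∣ l := by
    have : p ∣ q * l := hn ▸ dvd_mul_right p m
    exact ((Nat.coprime_primes hp hq).2 hpq).dvd_of_dvd_mul_left this
  obtain ⟨k, rfl⟩ := hpl
  have hm : m = k * q := by
    apply Nat.eq_of_mul_eq_mul_left hp.pos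
    rw [← hn]; ring
  have h1 := ih (p * k) (by have := hq.two_le; nlinarith) T' hp rfl
  have h2 : cj y (x ^ k) * (x ^ k)⁻¹ ∈ N := by
    rw [← QuotientGroup.eq_one_iff, QuotientGroup.mk_mul, QuotientGroup.mk_inv, mul_inv_eq_one]
    have := map_cj_apply (QuotientGroup.mk' N) y (x ^ k)
    simp only [QuotientGroup.mk'_apply] at this
    rw [this, cj_eq_self_iff]
    exact h1.symm
  have h3 : ∀ v ∈ N, Commute v x ∧ v ^ q = 1 := by
    intro v hv
    obtain ⟨i, j, rfl⟩ := (hmem v).1 hv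
    exact ⟨((T.x_central hcq T.x_mem).zpow_left i).mul_left
      ((T.y_central hcq T.x_mem).zpow_left j), T.layer_pow hcq i j⟩
  obtain ⟨h4, h5⟩ := h3 _ h2
  set v := cj y (x ^ k) * (x ^ k)⁻¹ with hv
  -- The claim holds modulo the q-layer, with a central defect v satisfying v^q = 1. Taking qth
  -- powers removes it, and m = kq.
  have h6 : cj y (x ^ k) = v * x ^ k := by rw [hv]; group
  have h7 : cj y (x ^ m) = x ^ m := by
    rw [hm, pow_mul, map_pow, h6, (h4.pow_right k).mul_pow, h5, one_mul]
  exact (cj_eq_self_iff.1 h7).symm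

end TriFact

/-! ### Multiplicativity of the power n/3 -/

/-- Collecting the factors moves an h past a g three times, so the correction is d³. -/
theorem mul_cube_of_comm {G : Type*} [Group G] {g h d : G} (hd : h * g = g * h * d)
    (hg : Commute d g) (hh : Commute d h) (h3 : d ^ 3 = 1) : (g * h) ^ 3 = g ^ 3 * h ^ 3 := by
  have e1 : ∀ v, d * (h * v) = h * (d * v) := fun v => by rw [← mul_assoc, hh.eq, mul_assoc]
  have e2 : ∀ v, d * (g * v) = g * (d * v) := fun v => by rw [← mul_assoc, hg.eq, mul_assoc]
  have e3 : ∀ v, h * (g * v) = g * (h * (d * v)) := fun v => by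
    rw [← mul_assoc, hd, mul_assoc, mul_assoc]
  have e4 : (g * h) ^ 3 = g ^ 3 * h ^ 3 * d ^ 3 := by
    simp only [pow_succ, pow_zero, one_mul, mul_assoc, e1, e2, e3, hh.eq]
  rw [e4, h3, mul_one]

theorem eq_one_of_pow_coprime {G : Type*} [Group G] {d : G} {p q : ℕ} (h : Nat.Coprime p q)
    (h1 : d ^ p = 1) (h2 : d ^ q = 1) : d = 1 := by
  have := Nat.dvd_gcd (orderOf_dvd_of_pow_eq_one h1) (orderOf_dvd_of_pow_eq_one h2)
  rw [h.gcd_eq_one, Nat.dvd_one, orderOf_eq_one_iff] at this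
  exact this

namespace TriFact

/-- The map `h ↦ h^(n/3)` is a homomorphism on `H`, in coordinates. -/
theorem mul_pow_third : ∀ (m : ℕ) {G : Type u} [Group G] {a b x y : G} {H : Subgroup G},
    TriFact a b x y H (3 * m) → ∀ i j : ℤ,
      (x ^ i * y ^ j) ^ m = (x ^ i) ^ m * (y ^ j) ^ m := by
  intro m
  induction m using Nat.strong_induction_on with
  | _ m ih =>
  intro G _ a b x y H T i j
  by_cases hm1 : m = 1
  · subst hm1; simp
  obtain ⟨p, hp, l, rfl⟩ := Nat.exists_prime_and_dvd hm1
  have hl : 0 < l := by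
    have := T.pos
    rcases Nat.eq_zero_or_pos l with rfl | h
    · simp at this
    · exact h
  rw [show 3 * (p * l) = p * (3 * l) by ring] at T
  have hc := commute_x_pow _ T hp rfl
  obtain ⟨N, hN, hmem, T'⟩ := T.exists_quotient hp hc
  have hNc : ∀ v ∈ N, v ^ p = 1 ∧ ∀ h ∈ H, Commute v h := by
    intro v hv
    obtain ⟨r, s, rfl⟩ := (hmem v).1 hv
    exact ⟨T.layer_pow hc r s, fun h hh => ((T.x_central hc hh).zpow_left r).mul_left
      ((T.y_central hc hh).zpow_left s)⟩
  have hx := commute_x_pow _ T' Nat.prime_three rfl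
  have hq := ih l (by have := hp.two_le; nlinarith) T' i j
  set g := (x ^ i) ^ l with hg
  set h := (y ^ j) ^ l with hh
  have hgH : g ∈ H := H.pow_mem (H.zpow_mem T.x_mem i) l
  have hhH : h ∈ H := H.pow_mem (H.zpow_mem T.y_mem j) l
  have e1 : (g * h)⁻¹ * (x ^ i * y ^ j) ^ l ∈ N := by
    rw [← QuotientGroup.eq]; simpa [g, h] using hq.symm
  have e2 : (g * h)⁻¹ * (h * g) ∈ N := by
    rw [← QuotientGroup.eq]
    have : Commute ((x : G ⧸ N) ^ l) ((y : G ⧸ N) ^ (j * l)) := hx.zpow_right _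
    have := this.zpow_left i
    simpa [g, h, ← zpow_natCast, ← zpow_mul, mul_comm] using this.eq
  set d := (g * h)⁻¹ * (h * g) with hd
  have hd' : h * g = g * h * d := by rw [hd]; group
  obtain ⟨hd1, hd2⟩ := hNc d e2
  obtain ⟨f1, f2⟩ := hNc _ e1
  set v := (g * h)⁻¹ * (x ^ i * y ^ j) ^ l with hv
  have hv' : (x ^ i * y ^ j) ^ l = (g * h) * v := by rw [hv]; group
  -- The elements g and h commute up to a central d with d^p = 1. For p = 3 the correction d³
  -- vanishes; for p ≠ 3, g³ lies in the central layer, so d³ = 1 as well and d = 1.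
  have key : (g * h) ^ p = g ^ p * h ^ p := by
    by_cases hp3 : p = 3
    · subst hp3
      exact mul_cube_of_comm hd' (hd2 g hgH) (hd2 h hhH) hd1
    · have hgc : Commute (g ^ 3) h := by
        have := (T.x_central hc hhH).zpow_left i
        rw [← zpow_natCast, ← zpow_mul] at this
        rw [hg, ← pow_mul, ← zpow_natCast, ← zpow_mul]
        convert this using 2; push_cast; ring
      have hd3 : d ^ 3 = 1 := by
        have h1 : cj h⁻¹ g = g * d := by
          rw [cj_apply, inv_inv, hd', mul_assoc, (hd2 h hhH).inv_right.eq]; group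
        have h2 : cj h⁻¹ (g ^ 3) = g ^ 3 := cj_eq_self_iff.2 hgc.symm.inv_left
        rw [map_pow, h1, (hd2 g hgH).symm.mul_pow] at h2
        exact mul_eq_left.1 h2
      have hdo := eq_one_of_pow_coprime ((Nat.coprime_primes hp Nat.prime_three).2 hp3) hd1 hd3
      rw [hdo, mul_one] at hd'
      exact Commute.mul_pow (hd'.symm) p
  rw [mul_comm p l, pow_mul, hv', (f2 _ (H.mul_mem hgH hhH)).symm.mul_pow, f1, mul_one, key,
    pow_mul, pow_mul]

end TriFact

/-! ### The commutator of x and y, and the action of `a` on y -/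

theorem cj_eq_mul_commutator {G : Type*} [Group G] (x y : G) : cj y x = x * (x⁻¹ * y⁻¹ * x * y) := by
  rw [cj_apply]; group

theorem cj_pow_eq {G : Type*} [Group G] {g v d : G} (h : cj g v = v * d) (hd : Commute d g) (k : ℕ) :
    cj (g ^ k) v = v * d ^ k := by
  induction k with
  | zero => simp [cj_apply]
  | succ k ih =>
    rw [pow_succ, cj_mul, ih, map_mul, h, cj_eq_self_iff.2 (hd.pow_left k).symm, pow_succ', mul_assoc]

/-- If `[x,y]` is central of order dividing three, cubes are central. -/
theorem commute_pow_three {G : Type*} [Group G] {x y : G}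
    (hy : Commute (x⁻¹ * y⁻¹ * x * y) y) (h3 : (x⁻¹ * y⁻¹ * x * y) ^ 3 = 1) :
    Commute (y ^ 3) x := by
  rw [← cj_eq_self_iff, cj_pow_eq (cj_eq_mul_commutator x y) hy, h3, mul_one]

/-- If `x^a = x` and `y^a = x⁻¹y⁻¹v` with a central `v`, then `[x,y]^a` is conjugate to `[x,y]⁻¹`. -/
theorem cj_commutator {G : Type*} [Group G] {a x y v : G} (hx : cj a x = x)
    (hy : cj a y = x⁻¹ * y⁻¹ * v) (hvx : Commute v x) (hvy : Commute v y)
    (hz : Commute (x⁻¹ * y⁻¹ * x * y) y) :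
    cj a (x⁻¹ * y⁻¹ * x * y) = (x⁻¹ * y⁻¹ * x * y)⁻¹ := by
  have h1 : cj a (x⁻¹ * y⁻¹ * x * y) = y * (x⁻¹ * y⁻¹ * x * y)⁻¹ * y⁻¹ := by
    simp only [map_mul, map_inv, hx, hy, mul_inv_rev, inv_inv]
    have h2 : Commute v (x⁻¹ * y * x * y⁻¹) :=
      ((hvx.inv_right.mul_right hvy).mul_right hvx).mul_right hvy.inv_right
    calc x⁻¹ * (v⁻¹ * (y * x)) * x * (x⁻¹ * y⁻¹ * v)
        = x⁻¹ * v⁻¹ * (y * x * y⁻¹ * v) := by group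
      _ = v⁻¹ * (x⁻¹ * y * x * y⁻¹ * v) := by rw [hvx.symm.inv_inv.eq]; group
      _ = x⁻¹ * y * x * y⁻¹ := by rw [← h2.eq]; group
      _ = _ := by group
  rw [h1, hz.symm.inv_right.eq]; group

/-- The obstruction to a commutator reaching two 3-layers deep, after identifying X^(9q) with
Y^(9q). Put g = X^(3q), h = Y^(3q), commuting with g³ = h³ = X1. Then Z = [X,Y] turns out to be
(gh⁻¹)^s, is central, and is inverted by A. But A maps gh⁻¹ to g²h, and the product of these two is
g³ = X1; so Z · Z^A = 1 reads X1^s = 1. -/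
theorem zpow_eq_one_of_layers {Q : Type*} [Group Q] {A B X Y X1 : Q} {q : ℕ} {s i j k : ℤ}
    (hAX : cj A X = X) (hBX : cj B X = Y) (hBY : cj B Y = X) (hX1 : X1 = X ^ (9 * q))
    (hY1 : X1 = Y ^ (9 * q)) (h3 : X1 ^ 3 = 1) (hcX : Commute X1 X) (hcY : Commute X1 Y)
    (hW : cj A Y = X⁻¹ * Y⁻¹ * X1 ^ i)
    (hZ : X⁻¹ * Y⁻¹ * X * Y = (X ^ (3 * q) * (Y ^ (3 * q))⁻¹) ^ s * X1 ^ j)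
    (hg : cj Y (X ^ (3 * q)) = X ^ (3 * q) * X1 ^ k) : X1 ^ s = 1 := by
  have hX1z : ∀ t : ℤ, (X1 ^ t) ^ 3 = 1 := fun t => by
    rw [← zpow_natCast, ← zpow_mul, mul_comm, zpow_mul, zpow_natCast, h3, one_zpow]
  set Z := X⁻¹ * Y⁻¹ * X * Y with hZdef
  have hg3 : (X ^ (3 * q)) ^ 3 = X1 := by rw [hX1, ← pow_mul]; congr 1; ring
  have hh3 : (Y ^ (3 * q)) ^ 3 = X1 := by rw [hY1, ← pow_mul]; congr 1; ring
  have hB1 : cj B X1 = X1 := by rw [hX1, map_pow, hBX, ← hY1, hX1]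
  have hgh : Commute (X ^ (3 * q)) (Y ^ (3 * q)) := by
    symm
    rw [← cj_eq_self_iff, cj_pow_eq hg (hcY.zpow_left k), pow_mul (X1 ^ k), hX1z, one_pow, mul_one]
  have hh : cj X (Y ^ (3 * q)) = Y ^ (3 * q) * X1 ^ k := by
    have := congrArg (cj B) hg
    rwa [map_cj_apply, hBY, map_mul, map_zpow, hB1, map_pow, hBX] at this
  have hZX : cj X Z = Z * X1 ^ (-k * s) := by
    have h1 : cj X (X ^ (3 * q)) = X ^ (3 * q) := cj_eq_self_iff.2 (Commute.self_pow X _)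
    have h2 : cj X (X1 ^ j) = X1 ^ j := cj_eq_self_iff.2 (hcX.symm.zpow_right j)
    have h4 : Commute (X ^ (3 * q) * (Y ^ (3 * q))⁻¹) (X1 ^ (-k)) :=
      (((hcX.pow_right _).mul_right (hcY.pow_right _).inv_right).zpow_left _).symm
    have h5 : Commute (Y ^ (3 * q)) (X1 ^ k) := ((hcY.pow_right _).zpow_left _).symm
    rw [hZ, map_mul, map_zpow, map_mul, map_inv, h1, hh, h2, mul_inv_rev, h5.inv_inv.symm.eq,
      ← mul_assoc, ← zpow_neg, h4.mul_zpow, ← zpow_mul, mul_assoc, mul_assoc, ← zpow_add,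
      ← zpow_add, add_comm]
  have hZ3 : Z ^ 3 = 1 := by
    have hpow : ∀ v : Q, (v ^ s) ^ 3 = (v ^ 3) ^ s := fun v => by
      rw [← zpow_natCast, ← zpow_natCast, ← zpow_mul, ← zpow_mul, mul_comm]
    have h4 : Commute ((X ^ (3 * q) * (Y ^ (3 * q))⁻¹) ^ s) (X1 ^ j) :=
      ((((hcX.pow_right _).mul_right (hcY.pow_right _).inv_right).zpow_left _).symm.zpow_left s)
    rw [hZ, h4.mul_pow, hX1z, mul_one, hgh.inv_right.mul_zpow, inv_zpow,
      (hgh.zpow_zpow s s).inv_right.mul_pow, inv_pow, hpow, hpow, hg3, hh3, mul_inv_cancel]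
  have hZ1 : Commute X1 Z := by
    rw [hZdef]
    exact ((hcX.inv_right.mul_right hcY.inv_right).mul_right hcX).mul_right hcY
  -- Y conjugates X to XZ, where X and Z commute up to a central element with trivial cube, and Z³ =
  -- 1; so X³ is fixed. Then Z, apart from a central factor, is built from powers of X³ and Y³ and
  -- is central.
  have hX3 : Commute (X ^ 3) Y := by
    symm
    have h1 : Z * X = X * Z * X1 ^ (-k * s) := by
      rw [mul_assoc X, ← hZX, cj_apply]; group
    rw [← cj_eq_self_iff, map_pow, cj_eq_mul_commutator, ← hZdef,
      mul_cube_of_comm h1 (hcX.zpow_left _) (hZ1.zpow_left _) (hX1z _), hZ3, mul_one]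
  have hY3 : Commute (Y ^ 3) X := by
    have := hX3.map_cj B
    rwa [map_pow, hBX, hBY] at this
  have hZY : Commute Z Y := by
    rw [hZ, pow_mul, pow_mul]
    exact (((hX3.pow_left q).mul_left
      (((Commute.pow_self Y 3).pow_left q).inv_left)).zpow_left s).mul_left (hcY.zpow_left j)
  have hZX' : Commute Z X := by
    rw [hZ, pow_mul, pow_mul]
    exact ((((Commute.pow_self X 3).pow_left q).mul_left
      ((hY3.pow_left q).inv_left)).zpow_left s).mul_left (hcX.zpow_left j)
  -- B inverts both Z and gh⁻¹ but fixes X1, so X1^j equals its own inverse; its cube is trivial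
  -- too.
  have hj : X1 ^ j = 1 := by
    have h1 : cj B Z = Z⁻¹ := by
      rw [hZdef]; simp only [map_mul, map_inv, hBX, hBY]; group
    have h4 : Commute ((X ^ (3 * q) * (Y ^ (3 * q))⁻¹) ^ s)⁻¹ (X1 ^ j)⁻¹ :=
      ((((hcX.pow_right _).mul_right (hcY.pow_right _).inv_right).zpow_left _).symm.zpow_left
        s).inv_inv
    rw [hZ, map_mul, map_zpow, map_mul, map_inv, map_pow, map_pow, hBX, hBY, map_zpow, hB1,
      mul_inv_rev, ← h4.eq, ← inv_zpow, mul_inv_rev, inv_inv] at h1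
    have h2 := mul_left_cancel h1
    apply eq_one_of_pow_coprime (p := 2) (q := 3) (by norm_num) _ (hX1z j)
    rw [pow_two]
    nth_rewrite 1 [h2]
    exact inv_mul_cancel _
  rw [hj, mul_one] at hZ
  have hA1 : cj A Z = Z⁻¹ := cj_commutator hAX hW (hcX.zpow_left i) (hcY.zpow_left i) hZY
  have hAh : cj A (Y ^ (3 * q)) = (X ^ (3 * q))⁻¹ * (Y ^ (3 * q))⁻¹ := by
    have h1 : Y⁻¹ * X⁻¹ = X⁻¹ * Y⁻¹ * Z⁻¹ := by
      rw [← (hZX'.inv_inv.mul_right hZY.inv_inv).eq, hZdef]; group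
    have h2 : Commute (X⁻¹ * Y⁻¹) (X1 ^ i) :=
      ((hcX.inv_right.mul_right hcY.inv_right).zpow_left i).symm
    rw [map_pow, hW, pow_mul, h2.mul_pow, hX1z, mul_one,
      mul_cube_of_comm h1 hZX'.inv_inv hZY.inv_inv (by rw [inv_pow, hZ3, inv_one]),
      inv_pow, inv_pow, (hX3.pow_right 3).inv_inv.mul_pow, inv_pow, inv_pow, ← pow_mul, ← pow_mul]
  rw [hZ, map_zpow, map_mul, map_inv, hAh, map_pow, hAX] at hA1
  have h5 : X ^ (3 * q) * ((X ^ (3 * q))⁻¹ * (Y ^ (3 * q))⁻¹)⁻¹ *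
      (X ^ (3 * q) * (Y ^ (3 * q))⁻¹) = X1 := by
    rw [← hg3, mul_inv_rev, inv_inv, inv_inv]
    calc _ = X ^ (3 * q) * (Y ^ (3 * q) * (X ^ (3 * q)) ^ 2) * (Y ^ (3 * q))⁻¹ := by
          simp only [pow_two, mul_assoc]
      _ = _ := by rw [← (hgh.pow_left 2).eq, pow_succ' _ 2]; simp only [mul_assoc, mul_inv_cancel,
        mul_one]
  have h6 : Commute (X ^ (3 * q) * ((X ^ (3 * q))⁻¹ * (Y ^ (3 * q))⁻¹)⁻¹)
      (X ^ (3 * q) * (Y ^ (3 * q))⁻¹) := by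
    have e1 : Commute (X ^ (3 * q)) (X ^ (3 * q) * (Y ^ (3 * q))⁻¹) :=
      (Commute.refl _).mul_right hgh.inv_right
    have e2 : Commute (Y ^ (3 * q)) (X ^ (3 * q) * (Y ^ (3 * q))⁻¹) :=
      hgh.symm.mul_right (Commute.refl _).inv_right
    exact e1.mul_left (e1.inv_left.mul_left e2.inv_left).inv_left
  rw [← h5, h6.mul_zpow, hA1, inv_mul_cancel]

theorem commute_iff_commutator_eq_one {G : Type*} [Group G] {x y : G} :
    Commute x y ↔ x⁻¹ * y⁻¹ * x * y = 1 := by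
  rw [mul_assoc, ← mul_inv_rev, inv_mul_eq_one]
  exact eq_comm

namespace TriFact

variable {G : Type u} [Group G] {a b x y : G} {H : Subgroup G} {n p m : ℕ}

theorem cj_b_commutator (T : TriFact a b x y H n) :
    cj b (x⁻¹ * y⁻¹ * x * y) = (x⁻¹ * y⁻¹ * x * y)⁻¹ := by
  simp only [map_mul, map_inv, T.cj_b_x, T.cj_b_y]; group

/-- Elements of a central layer that are inverted by `a` and `b`. -/
theorem layer_inverted (T : TriFact a b x y H (p * m)) (hp : p.Prime) (hc : Commute (x ^ m) y)
    {i j : ℤ} (ha : cj a ((x ^ m) ^ i * (y ^ m) ^ j) = ((x ^ m) ^ i * (y ^ m) ^ j)⁻¹)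
    (hb : cj b ((x ^ m) ^ i * (y ^ m) ^ j) = ((x ^ m) ^ i * (y ^ m) ^ j)⁻¹) :
    (x ^ m) ^ i * (y ^ m) ^ j = (x ^ m * (y ^ m)⁻¹) ^ i ∧
      (p ≠ 3 → (x ^ m) ^ i * (y ^ m) ^ j = 1) := by
  have hpi : Prime (p : ℤ) := Nat.prime_iff_prime_int.1 hp
  have hxy : Commute (x ^ m) (y ^ m) := hc.pow_right m
  have hinv : ((x ^ m) ^ i * (y ^ m) ^ j)⁻¹ = (x ^ m) ^ (-i) * (y ^ m) ^ (-j) := by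
    rw [mul_inv_rev, ← zpow_neg, ← zpow_neg, (hxy.zpow_zpow _ _).eq]
  have e1 : (x ^ m) ^ j * (y ^ m) ^ i = (x ^ m) ^ (-i) * (y ^ m) ^ (-j) := by
    rw [← hinv, ← hb, map_mul, map_zpow, map_zpow, map_pow, map_pow, T.cj_b_x, T.cj_b_y,
      (hxy.zpow_zpow _ _).eq]
  have h1 := (T.uniq_pow e1).1
  have e2 : (x ^ m) ^ (i + -j) * (y ^ m) ^ (-j) = (x ^ m) ^ (-i) * (y ^ m) ^ (-j) := by
    rw [← hinv, ← ha, map_mul, map_zpow, map_zpow, T.cj_a_y_pow hp hc, map_pow, T.cj_a_x,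
      hxy.inv_inv.mul_zpow, inv_zpow', inv_zpow', ← mul_assoc, ← zpow_add]
  have h2 := (T.uniq_pow e2).1
  have hj : (y ^ m) ^ j = (y ^ m) ^ (-i) := by
    rw [← mul_inv_eq_one, ← zpow_neg, ← zpow_add, T.y_pow_zpow_eq_one, neg_neg]
    simpa using h1
  refine ⟨by rw [hj, hxy.inv_right.mul_zpow, inv_zpow'], fun hp3 => ?_⟩
  have h3 : (p : ℤ) ∣ 3 * i := by
    have := dvd_add h1 h2; ring_nf at this ⊢; exact this
  have h4 : ¬ (p : ℤ) ∣ 3 := by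
    intro h
    have : p ∣ 3 := by exact_mod_cast h
    exact hp3 ((Nat.prime_dvd_prime_iff_eq hp Nat.prime_three).1 this)
  have h5 := (hpi.dvd_or_dvd h3).resolve_left h4
  rw [hj, T.x_pow_zpow_eq_one.2 h5, T.y_pow_zpow_eq_one.2 (dvd_neg.2 h5), one_mul]

/-- Conjugating twice by `a` is conjugating by x. For the central error term v this says v^a = v,
which kills its y-coordinate. -/
theorem layer_x (T : TriFact a b x y H (p * m)) (hp : p.Prime) (hc : Commute (x ^ m) y)
    {i j : ℤ} (h : cj a y = x⁻¹ * y⁻¹ * ((x ^ m) ^ i * (y ^ m) ^ j)) :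
    cj a y = x⁻¹ * y⁻¹ * (x ^ m) ^ i := by
  have hxy : Commute (x ^ m) (y ^ m) := hc.pow_right m
  have hax : cj a (x ^ m) = x ^ m := by rw [map_pow, T.cj_a_x]
  have h1 := congrArg (cj a) h
  rw [T.cj_a_a, map_mul, map_mul, map_inv, map_inv, T.cj_a_x, h, map_mul, map_zpow, map_zpow, hax,
    T.cj_a_y_pow hp hc, hxy.inv_inv.mul_zpow, cj_apply, mul_inv_rev (x⁻¹ * y⁻¹), mul_inv_rev x⁻¹,
    inv_inv, inv_inv] at h1
  have hvx : Commute ((x ^ m) ^ i * (y ^ m) ^ j) x := ((Commute.pow_self x m).zpow_left i).mul_left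
    ((T.commute_b hc).zpow_left j)
  have h2 : x⁻¹ * (((x ^ m) ^ i * (y ^ m) ^ j)⁻¹ * (y * x)) *
      ((x ^ m) ^ i * ((x ^ m)⁻¹ ^ j * (y ^ m)⁻¹ ^ j)) =
      ((x ^ m) ^ i * (y ^ m) ^ j)⁻¹ * (x⁻¹ * y * x) *
      ((x ^ m) ^ i * ((x ^ m)⁻¹ ^ j * (y ^ m)⁻¹ ^ j)) := by
    rw [← mul_assoc x⁻¹, hvx.symm.inv_inv.eq]; simp only [mul_assoc]
  have hvH : Commute ((x ^ m) ^ i * (y ^ m) ^ j) (x⁻¹ * y * x) := by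
    have hvy : Commute ((x ^ m) ^ i * (y ^ m) ^ j) y := (hc.zpow_left i).mul_left
      ((Commute.pow_self y m).zpow_left j)
    exact (hvx.inv_right.mul_right hvy).mul_right hvx
  rw [h2, hvH.inv_left.eq, mul_assoc (x⁻¹ * y * x), eq_comm, mul_eq_left, inv_mul_eq_one] at h1
  have h3 : (x ^ m) ^ i * (y ^ m) ^ j = (x ^ m) ^ (i + -j) * (y ^ m) ^ (-j) := by
    rw [h1, inv_zpow', inv_zpow', ← mul_assoc, ← zpow_add]
  have h4 := (T.uniq_pow h3).1
  have h5 : (p : ℤ) ∣ j := by convert h4 using 1; ring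
  rw [h, T.y_pow_zpow_eq_one.2 h5, mul_one]

/-- Taking x three times round by ab multiplies it by (x^m)^(-i) (y^m)^(-2i); if (ab)³ centralises
x, then p divides i. -/
theorem cj_a_y_of_commute (T : TriFact a b x y H (p * m)) (hp : p.Prime) (hc : Commute (x ^ m) y)
    {i : ℤ} (h : cj a y = x⁻¹ * y⁻¹ * (x ^ m) ^ i) (hu : Commute ((a * b) ^ 3) x) :
    cj a y = x⁻¹ * y⁻¹ := by
  have hbx : cj b (x ^ m) = y ^ m := by rw [map_pow, T.cj_b_x]
  have hby : cj b (y ^ m) = x ^ m := by rw [map_pow, T.cj_b_y]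
  have hxy : Commute (x ^ m) (y ^ m) := hc.pow_right m
  have hcy : cj b (cj a y) = y⁻¹ * x⁻¹ * (y ^ m) ^ i := by
    rw [h, map_mul, map_mul, map_inv, map_inv, map_zpow, T.cj_b_x, T.cj_b_y, hbx]
  have h1 := cj_eq_self_iff.2 hu
  have hcx : cj b (cj a x) = y := by rw [T.cj_a_x, T.cj_b_x]
  have hcy' : cj b (cj a (y ^ m)) = (y ^ m)⁻¹ * (x ^ m)⁻¹ := by
    rw [T.cj_a_y_pow hp hc, map_mul, map_inv, map_inv, hbx, hby]
  rw [← T.cj_cube, hcx, hcy] at h1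
  simp only [map_mul, map_inv, map_zpow, hcx, hcy, hcy', mul_inv_rev, inv_inv] at h1
  have h2 : Commute ((y ^ m) ^ i) x := (T.commute_b hc).zpow_left i
  have h3 : ((y ^ m) ^ i)⁻¹ * (x * y) * y⁻¹ * ((y ^ m)⁻¹ * (x ^ m)⁻¹) ^ i
      = x * (((y ^ m) ^ i)⁻¹ * ((y ^ m)⁻¹ * (x ^ m)⁻¹) ^ i) := by
    rw [← mul_assoc x, ← h2.inv_left.eq]; group
  rw [h3, mul_eq_left, hxy.symm.inv_inv.mul_zpow, inv_zpow', inv_zpow', ← zpow_neg, ← mul_assoc,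
    ← zpow_add, ← (hxy.zpow_zpow _ _).eq] at h1
  have h4 : (x ^ m) ^ (-i) * (y ^ m) ^ (-i + -i) = (x ^ m) ^ (0 : ℤ) * (y ^ m) ^ (0 : ℤ) := by
    simpa using h1
  have h5 := (T.uniq_pow h4).1
  have h6 : (p : ℤ) ∣ i := by simpa using h5
  rw [h, T.x_pow_zpow_eq_one.2 h6, mul_one]

/-- `(ab)³` is a product of a third power in `⟨x⟩` and one in `⟨y⟩`, if three divides `n`. -/
def CubeCond (a b x y : G) (n : ℕ) : Prop :=
  3 ∣ n → ∃ i j : ℤ, (a * b) ^ 3 = x ^ (3 * i) * y ^ (3 * j)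

theorem commute_cube {i j : ℤ} (hxz : Commute (x⁻¹ * y⁻¹ * x * y) y)
    (h3 : (x⁻¹ * y⁻¹ * x * y) ^ 3 = 1) (h : (a * b) ^ 3 = x ^ (3 * i) * y ^ (3 * j)) :
    Commute ((a * b) ^ 3) x := by
  rw [h]
  refine ((Commute.refl x).zpow_left _).mul_left ?_
  rw [zpow_mul, show y ^ (3 : ℤ) = y ^ 3 from zpow_natCast y 3]
  exact (commute_pow_three hxz h3).zpow_left j

/-- The case of a commutator inside the bottom layer. Being inverted by `a` and `b`, it vanishes for
p ≠ 3. For p = 3 it is a power of x^m y^(-m); if moreover 3 ∤ m, centrality of x^m gives [x,y]^m = 1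
and it vanishes again. In each case (ab)³ centralises x, which removes the error in y^a. -/
theorem relations_of_commutator_mem (T : TriFact a b x y H (p * m)) (hp : p.Prime)
    (hc : Commute (x ^ m) y) {i j k l : ℤ}
    (ha : cj a y = x⁻¹ * y⁻¹ * ((x ^ m) ^ i * (y ^ m) ^ j))
    (hz : x⁻¹ * y⁻¹ * x * y = (x ^ m) ^ k * (y ^ m) ^ l) (hu : CubeCond a b x y (p * m)) :
    cj a y = x⁻¹ * y⁻¹ ∧ (Commute x y ∨ ∃ q : ℕ, p * m = 9 * q ∧
      ∃ s : ℤ, x⁻¹ * y⁻¹ * x * y = (x ^ (3 * q) * (y ^ (3 * q))⁻¹) ^ s) := by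
  have hax := T.layer_x hp hc ha
  have hzy : Commute (x⁻¹ * y⁻¹ * x * y) y := by
    rw [hz]; exact (hc.zpow_left k).mul_left ((Commute.pow_self y m).zpow_left l)
  have hza : cj a (x⁻¹ * y⁻¹ * x * y) = (x⁻¹ * y⁻¹ * x * y)⁻¹ :=
    cj_commutator T.cj_a_x hax ((Commute.pow_self x m).zpow_left i) (hc.zpow_left i) hzy
  have hzb := T.cj_b_commutator
  rw [hz] at hza hzb
  obtain ⟨h1, h2⟩ := T.layer_inverted hp hc hza hzb
  rw [← hz] at h1 h2
  have hcomm : Commute x y → Commute ((a * b) ^ 3) x := by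
    intro h
    obtain ⟨r, s, h3⟩ := T.span _ T.cube_mem
    rw [h3]
    exact ((Commute.refl x).zpow_left r).mul_left (h.symm.zpow_left s)
  by_cases hp3 : p = 3
  · subst hp3
    have hz3 : (x⁻¹ * y⁻¹ * x * y) ^ 3 = 1 := by rw [hz]; exact T.layer_pow hc k l
    by_cases hm : 3 ∣ m
    · obtain ⟨q, rfl⟩ := hm
      obtain ⟨r, s, h3⟩ := hu (dvd_mul_right 3 _)
      exact ⟨T.cj_a_y_of_commute hp hc hax (commute_cube hzy hz3 h3),
        Or.inr ⟨q, by ring, k, h1⟩⟩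
    · have h4 : (x⁻¹ * y⁻¹ * x * y) ^ m = 1 := by
        have hzx : Commute (x⁻¹ * y⁻¹ * x * y) x := by
          rw [hz]; exact ((Commute.pow_self x m).zpow_left k).mul_left
            ((T.commute_b hc).zpow_left l)
        have h5 := cj_eq_self_iff.2 hc.symm
        rwa [map_pow, cj_eq_mul_commutator, hzx.symm.mul_pow, mul_eq_left] at h5
      have h6 := commute_iff_commutator_eq_one.2
        (eq_one_of_pow_coprime ((Nat.Prime.coprime_iff_not_dvd Nat.prime_three).2 hm) hz3 h4)
      exact ⟨T.cj_a_y_of_commute hp hc hax (hcomm h6), Or.inl h6⟩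
  · have h6 := commute_iff_commutator_eq_one.2 (h2 hp3)
    exact ⟨T.cj_a_y_of_commute hp hc hax (hcomm h6), Or.inl h6⟩

end TriFact

theorem mk_commutator {G : Type*} [Group G] (N : Subgroup G) [N.Normal] (x y : G) :
    ((x⁻¹ * y⁻¹ * x * y : G) : G ⧸ N) = (x : G ⧸ N)⁻¹ * (y : G ⧸ N)⁻¹ * x * y := rfl

theorem mk_cj {G : Type*} [Group G] (N : Subgroup G) [N.Normal] (g v : G) :
    ((cj g v : G) : G ⧸ N) = cj (g : G ⧸ N) (v : G ⧸ N) := map_cj_apply (QuotientGroup.mk' N) g v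

namespace TriFact

variable {G : Type u} [Group G] {a b x y : G} {H : Subgroup G} {n p m : ℕ}

/-- The element `x^m y^{-m}` of order three is inverted by `a`. -/
theorem cj_a_zeta (T : TriFact a b x y H (3 * m)) (hc : Commute (x ^ m) y) :
    cj a (x ^ m * (y ^ m)⁻¹) = (x ^ m * (y ^ m)⁻¹)⁻¹ := by
  have hxy : Commute (x ^ m) (y ^ m) := hc.pow_right m
  have h3 : (x ^ m) ^ 3 = 1 := by rw [← pow_mul, mul_comm, T.x_pow]
  have h4 : x ^ m * x ^ m = (x ^ m)⁻¹ := by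
    rw [eq_inv_iff_mul_eq_one, ← h3]; simp only [pow_succ, pow_zero, one_mul]
  rw [map_mul, map_inv, T.cj_a_y_pow Nat.prime_three hc, map_pow, T.cj_a_x]
  simp only [mul_inv_rev, inv_inv]
  rw [← hxy.eq, ← mul_assoc, h4, hxy.inv_left.eq]

theorem cj_b_zeta (T : TriFact a b x y H n) :
    cj b (x ^ m * (y ^ m)⁻¹) = (x ^ m * (y ^ m)⁻¹)⁻¹ := by
  rw [map_mul, map_inv, map_pow, map_pow, T.cj_b_x, T.cj_b_y, mul_inv_rev, inv_inv]

/-- Factoring out the normal subgroup ⟨x^(9q)y^(-9q)⟩ identifies the two generators of the layer, so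
that `zpow_eq_one_of_layers` applies. In the original group it says that x^(9qs) is a power of
x^(9q)y^(-9q), and uniqueness of coordinates gives 3 ∣ s. -/
theorem three_dvd_of_commutator {q : ℕ} (T : TriFact a b x y H (3 * (9 * q)))
    (hc : Commute (x ^ (9 * q)) y) {i s j k r r' : ℤ}
    (ha : cj a y = x⁻¹ * y⁻¹ * (x ^ (9 * q)) ^ i)
    (hz : x⁻¹ * y⁻¹ * x * y = (x ^ (3 * q) * (y ^ (3 * q))⁻¹) ^ s *
      ((x ^ (9 * q)) ^ j * (y ^ (9 * q)) ^ k))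
    (hg : cj y (x ^ (3 * q)) = x ^ (3 * q) * ((x ^ (9 * q)) ^ r * (y ^ (9 * q)) ^ r')) :
    (3 : ℤ) ∣ s := by
  have hxy : Commute (x ^ (9 * q)) (y ^ (9 * q)) := hc.pow_right _
  set ζ := x ^ (9 * q) * (y ^ (9 * q))⁻¹
  let K := Subgroup.zpowers ζ
  have hζa : cj a ζ = ζ⁻¹ := T.cj_a_zeta hc
  have hζb : cj b ζ = ζ⁻¹ := T.cj_b_zeta
  have hζa' : cj a⁻¹ ζ = ζ⁻¹ := by
    rw [← inv_inj, inv_inv, ← map_inv, ← hζa, ← cj_mul, mul_inv_cancel, cj_apply]; group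
  have hK : K.Normal := by
    apply normal_of_cj_mem T.gen T.b_sq <;>
    · rintro _ ⟨t, rfl⟩
      simp only [map_zpow, hζa, hζb, hζa']
      exact K.zpow_mem (K.inv_mem (Subgroup.mem_zpowers ζ)) t
  have hX1 : ((y ^ (9 * q) : G) : G ⧸ K) = ((x ^ (9 * q) : G) : G ⧸ K) := by
    rw [QuotientGroup.eq]
    exact (hxy.symm.inv_left.eq ▸ Subgroup.mem_zpowers ζ : (y ^ (9 * q))⁻¹ * x ^ (9 * q) ∈ K)
  have hcx : Commute (x ^ (9 * q)) x := Commute.pow_self x _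
  have key := zpow_eq_one_of_layers (Q := G ⧸ K) (A := a) (B := b) (X := x) (Y := y)
    (X1 := ((x ^ (9 * q) : G) : G ⧸ K)) (q := q) (s := s) (i := i) (j := j + k) (k := r + r')
    (by rw [← mk_cj, T.cj_a_x]) (by rw [← mk_cj, T.cj_b_x]) (by rw [← mk_cj, T.cj_b_y]) rfl
    hX1.symm (by
      rw [← QuotientGroup.mk_pow, ← pow_mul, mul_comm, T.x_pow, QuotientGroup.mk_one])
    (hcx.map (QuotientGroup.mk' K)) (hc.map (QuotientGroup.mk' K))
    (by rw [← mk_cj, ha]; rfl)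
    (by
      rw [← mk_commutator, hz, zpow_add, QuotientGroup.mk_mul, QuotientGroup.mk_mul,
        QuotientGroup.mk_zpow, QuotientGroup.mk_zpow, QuotientGroup.mk_zpow, hX1]; rfl)
    (by
      rw [← QuotientGroup.mk_pow, ← mk_cj, hg, zpow_add, QuotientGroup.mk_mul, QuotientGroup.mk_mul,
        QuotientGroup.mk_zpow, QuotientGroup.mk_zpow, hX1])
  rw [← QuotientGroup.mk_zpow, QuotientGroup.eq_one_iff] at key
  obtain ⟨t, ht⟩ := key
  have h1 : (x ^ (9 * q)) ^ t * (y ^ (9 * q)) ^ (-t) =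
      (x ^ (9 * q)) ^ s * (y ^ (9 * q)) ^ (0 : ℤ) := by
    rw [zpow_zero, mul_one, ← inv_zpow', ← hxy.inv_right.mul_zpow]; exact ht
  obtain ⟨h2, h3⟩ := T.uniq_pow h1
  simp only [zero_sub, neg_neg, Nat.cast_ofNat] at h2 h3
  have := dvd_sub h3 h2
  rwa [sub_sub_cancel] at this

/-- The structure of `H`, provided that `(ab)³` is a product of third powers. -/
theorem relations : ∀ (n : ℕ) {G : Type u} [Group G] {a b x y : G} {H : Subgroup G},
    TriFact a b x y H n → CubeCond a b x y n → cj a y = x⁻¹ * y⁻¹ ∧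
      (Commute x y ∨ ∃ q : ℕ, n = 9 * q ∧
        ∃ s : ℤ, x⁻¹ * y⁻¹ * x * y = (x ^ (3 * q) * (y ^ (3 * q))⁻¹) ^ s) := by
  intro n
  induction n using Nat.strong_induction_on with
  | _ n ih =>
  intro G _ a b x y H T hu
  by_cases hn : n = 1
  · subst hn
    have hx : x = 1 := by simpa using T.x_pow
    have hy : y = 1 := by simpa using T.y_pow
    subst hx hy
    exact ⟨by simp, Or.inl (Commute.refl _)⟩
  obtain ⟨p, hp, m, rfl⟩ := Nat.exists_prime_and_dvd hn
  have hc := commute_x_pow _ T hp rfl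
  obtain ⟨N, hN, hmem, T'⟩ := T.exists_quotient hp hc
  have hm0 : 0 < m := T'.pos
  have hu' : CubeCond (a : G ⧸ N) b x y m := by
    intro h3
    obtain ⟨i, j, hij⟩ := hu (h3.mul_left p)
    exact ⟨i, j, by rw [← QuotientGroup.mk_mul, ← QuotientGroup.mk_pow, hij]; simp⟩
  obtain ⟨h1, h2⟩ := ih m (by have := hp.two_le; nlinarith) T' hu'
  have hν : (x⁻¹ * y⁻¹)⁻¹ * cj a y ∈ N := by
    rw [← QuotientGroup.eq, mk_cj, h1]; rfl
  obtain ⟨i, j, hij⟩ := (hmem _).1 hν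
  have ha : cj a y = x⁻¹ * y⁻¹ * ((x ^ m) ^ i * (y ^ m) ^ j) := by rw [← hij]; group
  have hmain : x⁻¹ * y⁻¹ * x * y ∈ N → cj a y = x⁻¹ * y⁻¹ ∧ (Commute x y ∨ ∃ q : ℕ, p * m = 9 * q ∧
      ∃ s : ℤ, x⁻¹ * y⁻¹ * x * y = (x ^ (3 * q) * (y ^ (3 * q))⁻¹) ^ s) := by
    intro h
    obtain ⟨k, l, hkl⟩ := (hmem _).1 h
    exact T.relations_of_commutator_mem hp hc ha hkl hu
  rcases h2 with h2 | ⟨q, rfl, s, hs⟩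
  · apply hmain
    rw [← QuotientGroup.eq_one_iff, mk_commutator]
    exact commute_iff_commutator_eq_one.1 h2
  have hcq : Commute ((x : G ⧸ N) ^ (3 * q)) y :=
    commute_x_pow _ T' Nat.prime_three (by ring)
  have hcq' : Commute ((x : G ⧸ N) ^ (3 * q)) ((y : G ⧸ N) ^ (3 * q)) := hcq.pow_right _
  have hg3 : ((x : G ⧸ N) ^ (3 * q) * ((y : G ⧸ N) ^ (3 * q))⁻¹) ^ 3 = 1 := by
    rw [hcq'.inv_right.mul_pow, inv_pow, ← pow_mul, ← pow_mul, show 3 * q * 3 = 9 * q by ring,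
      T'.x_pow, T'.y_pow, inv_one, one_mul]
  have hzN : ((x ^ (3 * q) * (y ^ (3 * q))⁻¹) ^ s)⁻¹ * (x⁻¹ * y⁻¹ * x * y) ∈ N := by
    rw [← QuotientGroup.eq, mk_commutator, hs]; rfl
  obtain ⟨k, l, hkl⟩ := (hmem _).1 hzN
  have hz : x⁻¹ * y⁻¹ * x * y = (x ^ (3 * q) * (y ^ (3 * q))⁻¹) ^ s *
      ((x ^ (9 * q)) ^ k * (y ^ (9 * q)) ^ l) := by rw [← hkl]; group
  have hax := T.layer_x hp hc ha
  -- In the quotient, [x,y] is (x^(3q)y^(-3q))^s, whose base has trivial cube. For p = 3 the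
  -- obstruction gives 3 ∣ s, so [x,y] already lies in the bottom layer.
  by_cases hp3 : p = 3
  · subst hp3
    have hgN : (x ^ (3 * q))⁻¹ * cj y (x ^ (3 * q)) ∈ N := by
      rw [← QuotientGroup.eq, mk_cj]
      exact (cj_eq_self_iff.2 hcq.symm).symm
    obtain ⟨r, r', hr⟩ := (hmem _).1 hgN
    obtain ⟨t, rfl⟩ := T.three_dvd_of_commutator hc hax hz
      (r := r) (r' := r') (by rw [← hr]; group)
    apply hmain
    rw [← QuotientGroup.eq_one_iff, mk_commutator, hs, zpow_mul]
    have : ((x : G ⧸ N) ^ (3 * q) * ((y : G ⧸ N) ^ (3 * q))⁻¹) ^ (3 : ℤ) = 1 := by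
      exact_mod_cast hg3
    rw [this, one_zpow]
  · have hn3 : p * (9 * q) = 3 * (3 * (p * q)) := by ring
    have T3 := T
    rw [hn3] at T3
    have hc3 := commute_x_pow _ T3 Nat.prime_three rfl
    set ζ := x ^ (3 * (p * q)) * (y ^ (3 * (p * q)))⁻¹
    have hζc : ∀ h ∈ H, Commute ζ h := fun h hh =>
      (T3.x_central hc3 hh).mul_left (T3.y_central hc3 hh).inv_left
    have hζ3 : ζ ^ 3 = 1 := by
      have := T3.layer_pow hc3 1 (-1)
      rwa [zpow_one, zpow_neg_one] at this
    -- The summand 3d is invisible modulo N, and the pth power of the base is the image of ζ. Hence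
    -- [x,y] = ζ^t v with v in N.
    obtain ⟨t, d, htd⟩ : ∃ t d : ℤ, s = p * t + 3 * d := by
      have : IsCoprime (p : ℤ) 3 := by
        exact_mod_cast (Nat.coprime_primes hp Nat.prime_three).2 hp3
      obtain ⟨u, v, huv⟩ := this
      exact ⟨u * s, v * s, by linear_combination (-s) * huv⟩
    have hvN : (ζ ^ t)⁻¹ * (x⁻¹ * y⁻¹ * x * y) ∈ N := by
      rw [← QuotientGroup.eq, mk_commutator, hs, QuotientGroup.mk_zpow]
      have e1 : (ζ : G ⧸ N) = ((x : G ⧸ N) ^ (3 * q) * ((y : G ⧸ N) ^ (3 * q))⁻¹) ^ p := by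
        rw [hcq'.inv_right.mul_pow, inv_pow, ← pow_mul, ← pow_mul,
          show 3 * q * p = 3 * (p * q) by ring]
        rfl
      rw [e1, htd, zpow_add, zpow_mul, zpow_mul, zpow_natCast]
      have : ((x : G ⧸ N) ^ (3 * q) * ((y : G ⧸ N) ^ (3 * q))⁻¹) ^ (3 : ℤ) = 1 := by
        exact_mod_cast hg3
      rw [this, one_zpow, mul_one]
    obtain ⟨k', l', hv⟩ := (hmem _).1 hvN
    have hz' : x⁻¹ * y⁻¹ * x * y = ζ ^ t * ((x ^ (9 * q)) ^ k' * (y ^ (9 * q)) ^ l') := by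
      rw [← hv]; group
    have hzy : Commute (x⁻¹ * y⁻¹ * x * y) y := by
      rw [hz']
      exact ((hζc y T.y_mem).zpow_left t).mul_left
        ((hc.zpow_left k').mul_left ((Commute.pow_self y _).zpow_left l'))
    have hζz : Commute ζ (x⁻¹ * y⁻¹ * x * y) :=
      hζc _ (H.mul_mem (H.mul_mem (H.mul_mem (H.inv_mem T.x_mem) (H.inv_mem T.y_mem)) T.x_mem)
        T.y_mem)
    have hza : cj a (x⁻¹ * y⁻¹ * x * y) = (x⁻¹ * y⁻¹ * x * y)⁻¹ :=
      cj_commutator T.cj_a_x hax ((Commute.pow_self x _).zpow_left i) (hc.zpow_left i) hzy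
    have hζa : cj a ζ = ζ⁻¹ := T3.cj_a_zeta hc3
    have hζb : cj b ζ = ζ⁻¹ := T.cj_b_zeta
    have hζt := (hζz.zpow_left t).inv_left
    have hva : cj a ((ζ ^ t)⁻¹ * (x⁻¹ * y⁻¹ * x * y)) = ((ζ ^ t)⁻¹ * (x⁻¹ * y⁻¹ * x * y))⁻¹ := by
      rw [map_mul, hza, map_inv, map_zpow, hζa, inv_zpow, hζt.eq, mul_inv_rev _ (ζ ^ t)⁻¹]
    have hvb : cj b ((ζ ^ t)⁻¹ * (x⁻¹ * y⁻¹ * x * y)) = ((ζ ^ t)⁻¹ * (x⁻¹ * y⁻¹ * x * y))⁻¹ := by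
      rw [map_mul, T.cj_b_commutator, map_inv, map_zpow, hζb, inv_zpow, hζt.eq, mul_inv_rev _ (ζ ^ t)⁻¹]
    rw [hv] at hva hvb
    -- Both [x,y] and ζ^t are inverted by `a` and `b`, hence so is v; as p ≠ 3 it is trivial.
    have hv1 := (T.layer_inverted hp hc hva hvb).2 hp3
    rw [hv1, mul_one] at hz'
    have hz3 : (x⁻¹ * y⁻¹ * x * y) ^ 3 = 1 := by
      rw [hz', ← zpow_natCast, ← zpow_mul, mul_comm, zpow_mul, zpow_natCast, hζ3, one_zpow]
    obtain ⟨r, r', hr⟩ := hu (by rw [hn3]; exact dvd_mul_right 3 _)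
    exact ⟨T.cj_a_y_of_commute hp hc hax (commute_cube hzy hz3 hr),
      Or.inr ⟨p * q, by ring, t, hz'⟩⟩

end TriFact

/-! ### The relations of G₄ in a triangular factorization -/

/-- The defining relations of `G₄(k,e,1,l)`, with `3m` in place of `n`. -/
structure TypeFour {G : Type*} [Group G] (a b x y : G) (m : ℕ) (l : ℤ) : Prop where
  x_eq : x = a ^ 2
  y_eq : y = cj b x
  b_sq : b * b = 1
  x_pow : x ^ (3 * m) = 1
  comm : x⁻¹ * y⁻¹ * x * y = x ^ m * (y ^ m)⁻¹
  cj_a_y : cj a y = x⁻¹ * y⁻¹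
  cube : (a * b) ^ 3 = x ^ (l * m) * y ^ (-(l * m))

theorem TypeFour.of_dvd {G : Type*} [Group G] {a b x y : G} {m : ℕ} {l l' : ℤ}
    (h : TypeFour a b x y m l) (hl : (3 : ℤ) ∣ l - l') : TypeFour a b x y m l' := by
  refine { h with cube := ?_ }
  have hy : y ^ (3 * m) = 1 := by rw [h.y_eq, ← map_pow, h.x_pow, map_one]
  have key : ∀ v : G, v ^ (3 * m) = 1 → v ^ (l * m) = v ^ (l' * m) := by
    intro v hv
    obtain ⟨c, hc⟩ := hl
    rw [show l * m = l' * m + ((3 * m : ℕ) : ℤ) * c by push_cast; linear_combination (m : ℤ) * hc,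
      zpow_add, zpow_mul v ((3 * m : ℕ) : ℤ), zpow_natCast v (3 * m), hv, one_zpow, mul_one]
  rw [h.cube, key x h.x_pow, zpow_neg, zpow_neg, key y hy]

theorem exists_residue (l : ℤ) : ∃ l' : ℤ, (l' = 0 ∨ l' = 1 ∨ l' = -1) ∧ (3 : ℤ) ∣ l - l' := by
  have : l % 3 = 0 ∨ l % 3 = 1 ∨ l % 3 = 2 := by omega
  rcases this with h | h | h
  · exact ⟨0, by simp, by omega⟩
  · exact ⟨1, by simp, by omega⟩
  · exact ⟨-1, by simp, by omega⟩

namespace TriFact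

variable {G : Type u} [Group G] {a b x y : G} {H : Subgroup G} {n p m : ℕ}

/-- By `mul_pow_third` the power n/3 acts on each coordinate separately, and x^(in/3) = 1 exactly if
3 ∣ i. -/
theorem cubeCond_of_pow (T : TriFact a b x y H n) (h : ((a * b) ^ 3) ^ (n / 3) = 1) :
    CubeCond a b x y n := by
  rintro ⟨m, rfl⟩
  rw [Nat.mul_div_cancel_left m (by norm_num)] at h
  obtain ⟨i, j, hij⟩ := T.span _ T.cube_mem
  rw [hij, T.mul_pow_third] at h
  have h1 : (x ^ m) ^ i * (y ^ m) ^ j = (x ^ m) ^ (0 : ℤ) * (y ^ m) ^ (0 : ℤ) := by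
    have e : ∀ (v : G) (i : ℤ), (v ^ m) ^ i = (v ^ i) ^ m := fun v i => by
      rw [← zpow_natCast, ← zpow_natCast, ← zpow_mul, ← zpow_mul, mul_comm]
    rw [e, e, h]; simp
  obtain ⟨h2, h3⟩ := T.uniq_pow h1
  obtain ⟨i', hi⟩ : (3 : ℤ) ∣ i := by simpa using h2
  obtain ⟨j', hj⟩ : (3 : ℤ) ∣ j := by simpa using h3
  exact ⟨i', j', by rw [hij, hi, hj]⟩

/-- (ab)³ is fixed under conjugation by ab, which sends x³ to y³ and y³ to x⁻³y⁻³. Comparing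
coordinates mod 9q gives 3i ≡ -3j and 9j ≡ 0. -/
theorem cube_eq {q : ℕ} (T : TriFact a b x y H (9 * q)) (hu : CubeCond a b x y (9 * q))
    (ha : cj a y = x⁻¹ * y⁻¹) (hzx : Commute (x⁻¹ * y⁻¹ * x * y) x)
    (hzy : Commute (x⁻¹ * y⁻¹ * x * y) y) (hz3 : (x⁻¹ * y⁻¹ * x * y) ^ 3 = 1) :
    ∃ r : ℤ, (a * b) ^ 3 = x ^ (r * (3 * q : ℕ)) * y ^ (-(r * (3 * q : ℕ))) := by
  obtain ⟨i, j, hij⟩ := hu ⟨3 * q, by ring⟩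
  have hy3 : Commute (y ^ 3) x := commute_pow_three hzy hz3
  have hcx : cj b (cj a x) = y := by rw [T.cj_a_x, T.cj_b_x]
  have hcy : cj b (cj a y) = y⁻¹ * x⁻¹ := by
    rw [ha, map_mul, map_inv, map_inv, T.cj_b_x, T.cj_b_y]
  have h1 : y⁻¹ * x⁻¹ = x⁻¹ * y⁻¹ * (x⁻¹ * y⁻¹ * x * y)⁻¹ := by
    rw [← (hzx.inv_inv.mul_right hzy.inv_inv).eq]; group
  have hcube : (y⁻¹ * x⁻¹) ^ 3 = (x ^ 3)⁻¹ * (y ^ 3)⁻¹ := by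
    have h2 := mul_cube_of_comm h1 hzx.inv_inv hzy.inv_inv (by rw [inv_pow, hz3, inv_one])
    have h3 : (y⁻¹ * x⁻¹) ^ 3 = (x⁻¹ * y⁻¹) ^ 3 := by
      rw [h1, ((hzx.inv_inv.mul_right hzy.inv_inv).symm).mul_pow, inv_pow, hz3, inv_one, mul_one]
    rw [h3, h2, inv_pow, inv_pow]
  have hc : cj b (cj a ((a * b) ^ 3)) = (a * b) ^ 3 := by
    rw [← cj_mul, cj_eq_self_iff]; exact Commute.self_pow _ 3
  have hxy3 : Commute (x ^ 3) (y ^ 3) := (hy3.pow_right 3).symm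
  have h4 : x ^ (-(3 * j)) * y ^ (3 * i + -(3 * j)) = x ^ (3 * i) * y ^ (3 * j) := by
    rw [← hij, ← hc, hij, map_mul, map_mul, map_zpow, map_zpow, map_zpow, map_zpow, hcx, hcy,
      zpow_mul (y⁻¹ * x⁻¹), show (y⁻¹ * x⁻¹) ^ (3 : ℤ) = (y⁻¹ * x⁻¹) ^ 3 from zpow_natCast _ 3, hcube,
      hxy3.inv_inv.mul_zpow, inv_zpow', inv_zpow', ← zpow_natCast, ← zpow_natCast, ← zpow_mul,
      ← zpow_mul, zpow_add, ← mul_assoc]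
    have h5 : Commute (x ^ (-(3 * j))) (y ^ (3 * i)) := by
      rw [zpow_mul y, show -(3 * j) = 3 * (-j) by ring, zpow_mul x]
      exact ((show Commute (x ^ (3 : ℤ)) (y ^ (3 : ℤ)) by exact_mod_cast hxy3).zpow_zpow _ _)
    rw [h5.eq]
    simp [mul_assoc]
  obtain ⟨⟨c, hc⟩, ⟨d, hd⟩⟩ := T.uniq h4
  have hj : j = q * (d - c) := by push_cast at hc hd; linarith
  refine ⟨-(d - c), ?_⟩
  have e1 : x ^ (3 * i) = x ^ (-(d - c) * (3 * q : ℕ)) := by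
    rw [← mul_inv_eq_one, ← zpow_neg, ← zpow_add, T.x_zpow_eq_one]
    refine ⟨-c, ?_⟩
    push_cast at hc hd ⊢; linarith
  rw [hij, e1, hj]
  congr 2
  push_cast; ring

/-- The group is of type four if `H` is nonabelian and `(ab)³` is a product of third powers. -/
theorem exists_typeFour (T : TriFact a b x y H n) (hu : CubeCond a b x y n)
    (hne : ¬ Commute x y) : ∃ q : ℕ, n = 9 * q ∧ ∃ l : ℤ, (l = 0 ∨ l = 1 ∨ l = -1) ∧
      ∃ j : ℤˣ, TypeFour (a ^ (j : ℤ)) b (x ^ (j : ℤ)) (y ^ (j : ℤ)) (3 * q) l := by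
  obtain ⟨ha, h⟩ := relations n T hu
  obtain ⟨q, rfl, s, hs⟩ := h.resolve_left hne
  have T3 : TriFact a b x y H (3 * (3 * q)) := by rwa [show 3 * (3 * q) = 9 * q by ring]
  have hc := commute_x_pow _ T3 Nat.prime_three rfl
  set ζ := x ^ (3 * q) * (y ^ (3 * q))⁻¹ with hζ
  have hζx : Commute ζ x :=
    (Commute.pow_self x _).mul_left (T.commute_b hc).inv_left
  have hζy : Commute ζ y := hc.mul_left (Commute.pow_self y _).inv_left
  have hζ3 : ζ ^ 3 = 1 := by
    have := T3.layer_pow hc 1 (-1)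
    rwa [zpow_one, zpow_neg_one] at this
  have hζz : ∀ t : ℤ, ζ ^ (3 * t) = 1 := fun t => by
    rw [zpow_mul, show ζ ^ (3 : ℤ) = ζ ^ 3 from zpow_natCast ζ 3, hζ3, one_zpow]
  have hzx : Commute (x⁻¹ * y⁻¹ * x * y) x := hs ▸ hζx.zpow_left s
  have hzy : Commute (x⁻¹ * y⁻¹ * x * y) y := hs ▸ hζy.zpow_left s
  have hz3 : (x⁻¹ * y⁻¹ * x * y) ^ 3 = 1 := by
    rw [hs, ← zpow_natCast, ← zpow_mul, mul_comm]; exact hζz s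
  obtain ⟨r, hr⟩ := T.cube_eq hu ha hzx hzy hz3
  have hbi : b⁻¹ = b := inv_eq_of_mul_eq_one_left T.b_sq
  refine ⟨q, rfl, ?_⟩
  obtain ⟨s', hs', t, ht⟩ := exists_residue s
  have hs2 : x⁻¹ * y⁻¹ * x * y = ζ ^ s' := by
    rw [hs, show s = s' + 3 * t by linarith, zpow_add, hζz, mul_one]
  rcases hs' with rfl | rfl | rfl
  · exact absurd (commute_iff_commutator_eq_one.2 (by rw [hs2, zpow_zero])) hne
  · obtain ⟨l, hl, hd⟩ := exists_residue r
    refine ⟨l, hl, 1, TypeFour.of_dvd (l := r) ?_ hd⟩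
    simp only [Units.val_one, zpow_one]
    exact ⟨T.x_eq, T.y_eq, T.b_sq, T3.x_pow, by rw [hs2, zpow_one], ha, hr⟩
  -- Replacing `a` by its inverse leaves [x,y] unchanged, as it is central in H, but inverts x^m
  -- y^(-m). This repairs the sign and changes r to -r.
  · obtain ⟨l, hl, hd⟩ := exists_residue (-r)
    refine ⟨l, hl, -1, TypeFour.of_dvd (l := -r) ?_ hd⟩
    simp only [Units.val_neg, Units.val_one, zpow_neg, zpow_one]
    refine ⟨by rw [T.x_eq, inv_pow], by rw [map_inv, T.cj_b_x], T.b_sq,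
      by rw [inv_pow, T3.x_pow, inv_one], ?_, ?_, ?_⟩
    · have h1 : x⁻¹⁻¹ * y⁻¹⁻¹ * x⁻¹ * y⁻¹ = x⁻¹ * y⁻¹ * x * y := by
        have h2 : Commute (x⁻¹ * y⁻¹ * x * y) (y * x) := hzy.mul_right hzx
        have h3 : x⁻¹⁻¹ * y⁻¹⁻¹ * x⁻¹ * y⁻¹ = (y * x) * (x⁻¹ * y⁻¹ * x * y) * (y * x)⁻¹ := by group
        rw [h3, ← h2.eq]; group
      rw [h1, hs2, zpow_neg_one, hζ, mul_inv_rev, inv_inv, inv_pow, inv_pow, inv_inv,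
        (hc.pow_right (3 * q)).inv_left.eq]
    · have h1 : y = x⁻¹ * (cj a⁻¹ y)⁻¹ := by
        have := congrArg (cj a⁻¹) ha
        rw [← cj_mul, mul_inv_cancel, map_mul, map_inv, map_inv] at this
        have hx : cj a⁻¹ x = x := by rw [T.x_eq, cj_apply]; group
        rw [hx] at this
        rw [← this, cj_apply]; group
      have h2 : cj a⁻¹ y = y⁻¹ * x⁻¹ := by
        rw [eq_inv_mul_iff_mul_eq] at h1
        rw [← inv_inj, ← h1]; group
      rw [map_inv, h2]; group
    · have h1 : (a⁻¹ * b) ^ 3 = (cj b ((a * b) ^ 3))⁻¹ := by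
        rw [map_pow, ← inv_pow, cj_apply, hbi]
        congr 1
        rw [mul_inv_rev, mul_inv_rev, mul_inv_rev, hbi, ← mul_assoc, ← mul_assoc, T.b_sq, one_mul]
      rw [h1, hr, map_mul, map_zpow, map_zpow, T.cj_b_x, T.cj_b_y, mul_inv_rev, ← zpow_neg,
        ← zpow_neg, inv_zpow', inv_zpow']
      simp

end TriFact

/-! ### The order of a group with the relations of G₄ -/

namespace TypeFour

variable {G : Type u} [Group G] {a b x y : G} {m : ℕ} {l : ℤ}

theorem y_pow (h : TypeFour a b x y m l) : y ^ (3 * m) = 1 := by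
  rw [h.y_eq, ← map_pow, h.x_pow, map_one]

theorem cj_a_x (h : TypeFour a b x y m l) : cj a x = x := by
  rw [h.x_eq, cj_apply]; group

theorem cj_b_x (h : TypeFour a b x y m l) : cj b x = y := h.y_eq.symm

theorem cj_b_y (h : TypeFour a b x y m l) : cj b y = x := by
  rw [h.y_eq, ← cj_mul, h.b_sq, cj_apply]; group

theorem cj_c_x (h : TypeFour a b x y m l) : cj (a * b) x = y := by
  rw [cj_mul, h.cj_a_x, h.cj_b_x]

theorem cj_c_y (h : TypeFour a b x y m l) : cj (a * b) y = y⁻¹ * x⁻¹ := by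
  rw [cj_mul, h.cj_a_y, map_mul, map_inv, map_inv, h.cj_b_x, h.cj_b_y]

/-- Rotating the relation for `[x,y]` by `ab` yields `(yx)² = x²y²`. -/
theorem yx_sq (h : TypeFour a b x y m l) : y * x * (y * x) = x ^ 2 * y ^ 2 := by
  -- ab permutes x, y, t cyclically, so [y,t] and [t,x] have the analogous values; the product of
  -- the three telescopes to 1.
  set t := y⁻¹ * x⁻¹ with ht
  have hct : cj (a * b) t = x := by
    rw [ht, map_mul, map_inv, map_inv, h.cj_c_x, h.cj_c_y]; group
  have h1 := h.comm
  have h2 := congrArg (cj (a * b)) h1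
  simp only [map_mul, map_inv, map_pow, h.cj_c_x, h.cj_c_y] at h2
  rw [← ht] at h2
  have h3 := congrArg (cj (a * b)) h2
  simp only [map_mul, map_inv, map_pow, h.cj_c_y, hct] at h3
  rw [← ht] at h3
  have h4 : (x⁻¹ * y⁻¹ * x * y) * (y⁻¹ * t⁻¹ * y * t) * (t⁻¹ * x⁻¹ * t * x) = 1 := by
    rw [h1, h2, h3]; group
  have h5 : (x⁻¹ * y⁻¹ * x * y) * (y⁻¹ * t⁻¹ * y * t) * (t⁻¹ * x⁻¹ * t * x)
      = x⁻¹ * y⁻¹ * (x ^ 2 * y ^ 2) * x⁻¹ * y⁻¹ := by rw [ht, pow_two, pow_two]; group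
  rw [h5, mul_inv_eq_one, mul_inv_eq_iff_eq_mul] at h4
  have h6 : x ^ 2 * y ^ 2 = y * x * (x⁻¹ * y⁻¹ * (x ^ 2 * y ^ 2)) := by group
  rw [h6, h4]

/-- x·x²y² = x(yx)² = (xy)²x, and the b-conjugate relation (xy)² = y²x² finishes. -/
theorem commute_pow_three_sq (h : TypeFour a b x y m l) : Commute (x ^ 3) (y ^ 2) := by
  have h1 := h.yx_sq
  have h2 := congrArg (cj b) h1
  simp only [map_mul, map_pow, h.cj_b_x, h.cj_b_y] at h2
  have h3 : x ^ 3 * y ^ 2 = (x * y * (x * y)) * x := by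
    rw [pow_succ' x 2, mul_assoc, ← h1]; simp only [mul_assoc]
  change x ^ 3 * y ^ 2 = y ^ 2 * x ^ 3
  rw [h3, h2, mul_assoc, ← pow_succ]

theorem commute_x_pow_y (h : TypeFour a b x y m l) (hm : 3 ∣ m) : Commute (x ^ m) y := by
  obtain ⟨q, rfl⟩ := hm
  have h1 := h.commute_pow_three_sq
  have h2 := h1.map_cj b
  rw [map_pow, map_pow, h.cj_b_x, h.cj_b_y] at h2
  -- The order of x divides 9q, so x^(3q) = x^(12q). Thus x^m is both a power of x³, commuting with
  -- y², and a power of x², commuting with y³.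
  have hx : x ^ (3 * q) = (x ^ 2) ^ (6 * q) := by
    rw [← pow_mul, show 2 * (6 * q) = 3 * q + 3 * (3 * q) by ring, pow_add, h.x_pow, mul_one]
  have e1 : Commute (x ^ (3 * q)) (y ^ 2) := by rw [pow_mul]; exact h1.pow_left q
  have e2 : Commute (x ^ (3 * q)) (y ^ 3) := by
    rw [hx]; exact h2.symm.pow_left _
  have e3 := e2.mul_right e1.inv_right
  rwa [show y ^ 3 * (y ^ 2)⁻¹ = y by rw [pow_succ']; group] at e3

theorem commute_y_pow_x (h : TypeFour a b x y m l) (hm : 3 ∣ m) : Commute (y ^ m) x := by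
  have := (h.commute_x_pow_y hm).map_cj b
  rwa [map_pow, h.cj_b_x, h.cj_b_y] at this

/-- [x,y] = x^m y^(-m) is centralised by x and y, so moving y past x^i only changes the two
exponents. -/
theorem exists_of_mem_closure (h : TypeFour a b x y m l) (hm : 3 ∣ m) {g : G}
    (hg : g ∈ Subgroup.closure {x, y}) : ∃ i j : ℤ, g = x ^ i * y ^ j := by
  have hαy := h.commute_x_pow_y hm
  have hβx := h.commute_y_pow_x hm
  set α := x ^ m with hα
  set β := y ^ m with hβ
  have hαx : Commute α x := Commute.pow_self x m
  have hβy : Commute β y := Commute.pow_self y m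
  have hαβ : Commute α β := hαy.pow_right m
  have key : ∀ i : ℤ, y * x ^ i = x ^ (i + -(m * i)) * y ^ (m * i + 1) := by
    intro i
    have h1 : y * x * y⁻¹ = x * (α⁻¹ * β) := by
      have : y * x * y⁻¹ = x * (x⁻¹ * y⁻¹ * x * y)⁻¹ := by
        have e : Commute (x⁻¹ * y⁻¹ * x * y)⁻¹ y := by
          rw [h.comm]; exact (hαy.mul_left hβy.inv_left).inv_left
        rw [show y * x * y⁻¹ = x * (y * (x⁻¹ * y⁻¹ * x * y)⁻¹ * y⁻¹) by group, ← e.eq]; group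
      rw [this, h.comm, mul_inv_rev, inv_inv, hαβ.inv_left.eq]
    have h2 : y * x ^ i * y⁻¹ = x ^ i * (α ^ (-i) * β ^ i) := by
      have e : y * x ^ i * y⁻¹ = (y * x * y⁻¹) ^ i := conj_zpow.symm
      rw [e, h1, (hαx.inv_left.mul_left hβx).symm.mul_zpow, hαβ.inv_left.mul_zpow, inv_zpow']
    rw [mul_inv_eq_iff_eq_mul] at h2
    rw [h2, hα, hβ, ← zpow_natCast, ← zpow_natCast, ← zpow_mul, ← zpow_mul, zpow_add, zpow_add,
      zpow_one, mul_neg]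
    simp only [mul_assoc]
  have key' : ∀ i : ℤ, y⁻¹ * x ^ i = x ^ (i + m * i) * y ^ (-(m * i) + -1) := by
    intro i
    have h2 : y⁻¹ * x ^ i * y = x ^ i * (α ^ i * β ^ (-i)) := by
      rw [← cj_apply, map_zpow, cj_eq_mul_commutator, h.comm,
        (hαx.mul_left hβx.inv_left).symm.mul_zpow, hαβ.inv_right.mul_zpow, inv_zpow']
    rw [← eq_mul_inv_iff_mul_eq] at h2
    rw [h2, hα, hβ, ← zpow_natCast, ← zpow_natCast, ← zpow_mul, ← zpow_mul, zpow_add, zpow_add,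
      zpow_neg_one, mul_neg]
    simp only [mul_assoc]
  induction hg using Subgroup.closure_induction_left with
  | one => exact ⟨0, 0, by simp⟩
  | mul_left v hv w _ hw =>
    obtain ⟨i, j, rfl⟩ := hw
    rcases hv with rfl | rfl
    · exact ⟨1 + i, j, by rw [zpow_add, zpow_one, mul_assoc]⟩
    · exact ⟨i + -(m * i), m * i + 1 + j, by rw [← mul_assoc, key, mul_assoc, ← zpow_add]⟩
  | inv_mul_cancel v hv w _ hw =>
    obtain ⟨i, j, rfl⟩ := hw
    rcases hv with rfl | rfl
    · exact ⟨-1 + i, j, by rw [zpow_add, zpow_neg_one, mul_assoc]⟩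
    · exact ⟨i + m * i, -(m * i) + -1 + j, by rw [← mul_assoc, key', mul_assoc, ← zpow_add]⟩

theorem exists_rev (h : TypeFour a b x y m l) (hm : 3 ∣ m) {g : G}
    (hg : g ∈ Subgroup.closure {x, y}) : ∃ i j : ℤ, g = y ^ i * x ^ j := by
  obtain ⟨i, j, hij⟩ := h.exists_of_mem_closure hm (inv_mem hg)
  exact ⟨-j, -i, by rw [← inv_inj, hij]; group⟩

/-- The factorization ⟨x⟩⟨y⟩ pulled back along conjugation by `a`, which fixes x and sends y⁻¹x⁻¹ to
y. -/
theorem exists_third (h : TypeFour a b x y m l) (hm : 3 ∣ m) {g : G}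
    (hg : g ∈ Subgroup.closure {x, y}) : ∃ i j : ℤ, g = x ^ i * (y⁻¹ * x⁻¹) ^ j := by
  have hx : x ∈ Subgroup.closure {x, y} := Subgroup.subset_closure (by simp)
  have hy : y ∈ Subgroup.closure {x, y} := Subgroup.subset_closure (by simp)
  obtain ⟨i, j, rfl⟩ := h.exists_of_mem_closure hm hg
  obtain ⟨r, s, hrs⟩ := h.exists_of_mem_closure hm (g := cj a (x ^ i * y ^ j)) (by
    rw [map_mul, map_zpow, map_zpow, h.cj_a_x, h.cj_a_y]
    exact mul_mem (zpow_mem hx i) (zpow_mem (mul_mem (inv_mem hx) (inv_mem hy)) j))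
  refine ⟨r, s, cj_injective a ?_⟩
  rw [hrs, map_mul, map_zpow, map_zpow, map_mul, map_inv, map_inv, h.cj_a_x, h.cj_a_y]
  group

/-- Every element lies in one of `3n` cosets of `⟨a⟩`. -/
theorem exists_coset (h : TypeFour a b x y m l) (hm : 3 ∣ m)
    (hgen : Subgroup.closure {a, b} = ⊤) (g : G) : ∃ i k : ℤ,
      g = y ^ i * a ^ k ∨ g = x ^ i * b * a ^ k ∨ g = x ^ i * (a * b) * a ^ k := by
  have hx : x ∈ Subgroup.closure {x, y} := Subgroup.subset_closure (by simp)
  have hy : y ∈ Subgroup.closure {x, y} := Subgroup.subset_closure (by simp)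
  have hax : ∀ i : ℤ, a * x ^ i = x ^ i * a := fun i => by rw [h.x_eq]; group
  have hxa : ∀ i : ℤ, x ^ i = a ^ (2 * i) := fun i => by rw [h.x_eq, zpow_mul]; simp
  have hbi : b⁻¹ = b := inv_eq_of_mul_eq_one_left h.b_sq
  have hbx : ∀ i : ℤ, b * x ^ i = y ^ i * b := fun i => by
    have : y ^ i = b⁻¹ * x ^ i * b := by rw [h.y_eq, ← map_zpow, cj_apply]
    rw [this, mul_assoc, h.b_sq, mul_one, hbi]
  have hby : ∀ i : ℤ, b * y ^ i = x ^ i * b := fun i => by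
    have : x ^ i = b⁻¹ * y ^ i * b := by rw [← cj_apply, map_zpow, h.cj_b_y]
    rw [this, mul_assoc, h.b_sq, mul_one, hbi]
  have hay : ∀ i : ℤ, a * y ^ i = (y⁻¹ * x⁻¹) ^ i * a := fun i => by
    have : y ^ i = a⁻¹ * (y⁻¹ * x⁻¹) ^ i * a := by
      rw [← cj_apply, map_zpow, map_mul, map_inv, map_inv, h.cj_a_x, h.cj_a_y]; group
    rw [this]; group
  have hay' : ∀ i : ℤ, a⁻¹ * y ^ i = (x⁻¹ * y⁻¹) ^ i * a⁻¹ := fun i => by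
    have : (x⁻¹ * y⁻¹) ^ i = a⁻¹ * y ^ i * a := by
      rw [← h.cj_a_y, ← map_zpow, cj_apply]
    rw [this]; group
  have hca : ∀ i : ℤ, (y⁻¹ * x⁻¹) ^ i * (a * b) = a * b * x ^ i := fun i => by
    have : x ^ i = (a * b)⁻¹ * (y⁻¹ * x⁻¹) ^ i * (a * b) := by
      rw [← cj_apply, map_zpow, map_mul, map_inv, map_inv, h.cj_c_x, h.cj_c_y]; group
    rw [this]; group
  have hb_mul : ∀ g : G, (∃ i k : ℤ,
      g = y ^ i * a ^ k ∨ g = x ^ i * b * a ^ k ∨ g = x ^ i * (a * b) * a ^ k) → ∃ i k : ℤ,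
      b * g = y ^ i * a ^ k ∨ b * g = x ^ i * b * a ^ k ∨ b * g = x ^ i * (a * b) * a ^ k := by
    rintro _ ⟨i, k, rfl | rfl | rfl⟩
    · exact ⟨i, k, Or.inr (Or.inl (by rw [← mul_assoc, hby]))⟩
    · exact ⟨i, k, Or.inl (by rw [mul_assoc, ← mul_assoc, hbx, mul_assoc, ← mul_assoc b, h.b_sq,
        one_mul])⟩
    -- The only product that leaves the listed cosets formally; it is rewritten using the relation
    -- for (ab)³.
    · have hbab : b * (a * b) = x ^ (l * m - 1) * (a * b) * a ^ (-(2 * (l * m)) - 1) := by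
        have h1 : b * (a * b) = a⁻¹ * (a * b) ^ 3 * b * a⁻¹ := by
          simp only [pow_succ, pow_zero, one_mul]
          rw [show a⁻¹ * (a * b * (a * b) * (a * b)) * b * a⁻¹ = b * (a * b) * a * (b * b) * a⁻¹ by
            group, h.b_sq]; group
        rw [h1, h.cube, ← mul_assoc, mul_assoc _ (y ^ _), ← hbx]
        have h2 : a⁻¹ * x ^ (l * m) = x ^ (l * m - 1) * a := by
          rw [hxa, hxa]; group
        rw [h2, hxa (-(l * m))]
        group
      obtain ⟨r, s, hrs⟩ := h.exists_third hm (mul_mem (zpow_mem hy i) (zpow_mem hx (l * m - 1)))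
      refine ⟨r, 2 * s + (-(2 * (l * m)) - 1) + k, Or.inr (Or.inr ?_)⟩
      calc b * (x ^ i * (a * b) * a ^ k) = (b * x ^ i) * (a * b) * a ^ k := by group
        _ = y ^ i * (b * (a * b)) * a ^ k := by rw [hbx]; group
        _ = (y ^ i * x ^ (l * m - 1)) * (a * b) * a ^ (-(2 * (l * m)) - 1) * a ^ k := by
          rw [hbab]; group
        _ = x ^ r * ((y⁻¹ * x⁻¹) ^ s * (a * b)) * a ^ (-(2 * (l * m)) - 1) * a ^ k := by
          rw [hrs]; group
        _ = _ := by rw [hca, hxa s, zpow_add, zpow_add]; simp only [mul_assoc]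
  have hg : g ∈ Subgroup.closure {a, b} := by rw [hgen]; trivial
  induction hg using Subgroup.closure_induction_left with
  | one => exact ⟨0, 0, Or.inl (by simp)⟩
  | mul_left v hv w _ hw =>
    rcases hv with rfl | rfl
    · obtain ⟨i, k, rfl | rfl | rfl⟩ := hw
      · obtain ⟨r, s, hrs⟩ := h.exists_rev hm (zpow_mem (mul_mem (inv_mem hy) (inv_mem hx)) i)
        refine ⟨r, 2 * s + 1 + k, Or.inl ?_⟩
        rw [← mul_assoc, hay, hrs, hxa s, zpow_add, zpow_add, zpow_one]; simp only [mul_assoc]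
      · exact ⟨i, k, Or.inr (Or.inr (by
          rw [mul_assoc, ← mul_assoc, hax]; simp only [mul_assoc]))⟩
      · refine ⟨i + 1, k, Or.inr (Or.inl ?_)⟩
        rw [zpow_add, zpow_one, h.x_eq]
        rw [← h.x_eq, ← mul_assoc, ← mul_assoc, hax]
        nth_rewrite 3 [h.x_eq]
        simp only [pow_two, mul_assoc]
    · exact hb_mul w hw
  | inv_mul_cancel v hv w _ hw =>
    rcases hv with rfl | rfl
    · obtain ⟨i, k, rfl | rfl | rfl⟩ := hw
      · obtain ⟨r, s, hrs⟩ := h.exists_rev hm (zpow_mem (mul_mem (inv_mem hx) (inv_mem hy)) i)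
        refine ⟨r, 2 * s + -1 + k, Or.inl ?_⟩
        rw [← mul_assoc, hay', hrs, hxa s, zpow_add, zpow_add, zpow_neg_one]; simp only [mul_assoc]
      · refine ⟨i - 1, k, Or.inr (Or.inr ?_)⟩
        rw [hxa, hxa]; group
      · refine ⟨i, k, Or.inr (Or.inl ?_)⟩
        rw [hxa]; group
    · rw [hbi]; exact hb_mul w hw

theorem finite_and_card_le (h : TypeFour a b x y m l) (hm : 3 ∣ m) (hm0 : 0 < m)
    (hgen : Subgroup.closure {a, b} = ⊤) :
    Finite G ∧ Nat.card G ≤ 3 * (3 * m) * (2 * (3 * m)) := by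
  have ha : a ^ (2 * (3 * m)) = 1 := by rw [pow_mul, ← h.x_eq, h.x_pow]
  let f : Fin 3 × Fin (3 * m) × Fin (2 * (3 * m)) → G := fun p =>
    match p with
    | (0, i, k) => y ^ i.val * a ^ k.val
    | (1, i, k) => x ^ i.val * b * a ^ k.val
    | (2, i, k) => x ^ i.val * (a * b) * a ^ k.val
  have hf : Function.Surjective f := by
    intro g
    obtain ⟨i, k, hg⟩ := h.exists_coset hm hgen g
    have hi : (i % (3 * m : ℕ)).toNat < 3 * m := by
      have := Int.emod_lt_of_pos i (by omega : (0 : ℤ) < (3 * m : ℕ)); omega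
    have hk : (k % (2 * (3 * m) : ℕ)).toNat < 2 * (3 * m) := by
      have := Int.emod_lt_of_pos k (by omega : (0 : ℤ) < (2 * (3 * m) : ℕ)); omega
    rw [TriFact.zpow_toNat (by omega) h.y_pow i, TriFact.zpow_toNat (by omega) h.x_pow i,
      TriFact.zpow_toNat (by omega) ha k] at hg
    rcases hg with rfl | rfl | rfl
    · exact ⟨(0, ⟨_, hi⟩, ⟨_, hk⟩), rfl⟩
    · exact ⟨(1, ⟨_, hi⟩, ⟨_, hk⟩), rfl⟩
    · exact ⟨(2, ⟨_, hi⟩, ⟨_, hk⟩), rfl⟩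
  refine ⟨Finite.of_surjective f hf, (Nat.card_le_card_of_surjective f hf).trans ?_⟩
  simp [mul_assoc]

end TypeFour

/-! ### An explicit action on the 3n vertices -/

namespace TripartiteModel

variable {R : Type*} [CommRing R]

/-- The action of `a` on the `3n` vertices. -/
def permA (μ : R) (h2 : μ * μ = 0) : Equiv.Perm (Fin 3 × R) where
  -- The points (0,j), (1,i), (2,i) are to be read as the cosets y^j⟨a⟩, x^i b⟨a⟩, x^i ab⟨a⟩ under
  -- left multiplication, with μ = n/3 and ν = l.
  toFun := fun p => match p with
    | (0, j) => (0, -j + μ * j * (j - 1))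
    | (1, i) => (2, i)
    | (2, i) => (1, i + 1)
  invFun := fun p => match p with
    | (0, j) => (0, -j + μ * j * (j + 1))
    | (1, i) => (2, i - 1)
    | (2, i) => (1, i)
  left_inv := by
    rintro ⟨p, i⟩
    fin_cases p <;> simp <;> grind
  right_inv := by
    rintro ⟨p, i⟩
    fin_cases p <;> simp <;> grind

/-- The action of `b` on the `3n` vertices. -/
def funB (μ ν : R) (p : Fin 3 × R) : Fin 3 × R :=
  match p with
  | (0, j) => (1, j)
  | (1, j) => (0, j)
  | (2, i) => (2, -1 - i + ν * μ + μ * i * (i + 1))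

theorem funB_funB (μ ν : R) (h2 : μ * μ = 0) (p : Fin 3 × R) : funB μ ν (funB μ ν p) = p := by
  obtain ⟨p, i⟩ := p
  fin_cases p <;> simp [funB] <;> grind

/-- The action of `b` on the `3n` vertices, as a permutation. -/
def permB (μ ν : R) (h2 : μ * μ = 0) : Equiv.Perm (Fin 3 × R) :=
  (show Function.Involutive (funB μ ν) from funB_funB μ ν h2).toPerm

variable (μ ν : R) (h2 : μ * μ = 0)

theorem permA_zero (j : R) : permA μ h2 (0, j) = (0, -j + μ * j * (j - 1)) := rfl
theorem permA_one (j : R) : permA μ h2 (1, j) = (2, j) := rfl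
theorem permA_two (j : R) : permA μ h2 (2, j) = (1, j + 1) := rfl
theorem permB_zero (j : R) : permB μ ν h2 (0, j) = (1, j) := rfl
theorem permB_one (j : R) : permB μ ν h2 (1, j) = (0, j) := rfl
theorem permB_two (i : R) :
    permB μ ν h2 (2, i) = (2, -1 - i + ν * μ + μ * i * (i + 1)) := rfl

theorem permB_mul_self : permB μ ν h2 * permB μ ν h2 = 1 := by
  ext1 p
  exact funB_funB μ ν h2 p

theorem permA_sq_pow (h3 : 3 * μ = 0) (k : ℕ) :
    (∀ j : R, ((permA μ h2 ^ 2) ^ k) (0, j) = (0, j * (1 - k * μ))) ∧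
    (∀ j : R, ((permA μ h2 ^ 2) ^ k) (1, j) = (1, j + k)) ∧
    (∀ j : R, ((permA μ h2 ^ 2) ^ k) (2, j) = (2, j + k)) := by
  induction k with
  | zero => simp
  | succ k ih =>
    obtain ⟨i0, i1, i2⟩ := ih
    simp only [pow_succ' _ k, Equiv.Perm.mul_apply, i0, i1, i2]
    simp only [pow_two, Equiv.Perm.mul_apply, permA_zero, permA_one, permA_two]
    refine ⟨fun j => ?_, fun j => ?_, fun j => ?_⟩ <;> congr 1 <;> push_cast <;> grind

theorem cj_permB_pow_apply (v : Equiv.Perm (Fin 3 × R)) (k : ℕ) (p : Fin 3 × R) :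
    (cj (permB μ ν h2) v ^ k) p = permB μ ν h2 ((v ^ k) (permB μ ν h2 p)) := by
  rw [← map_pow, cj_apply, inv_eq_of_mul_eq_one_left (permB_mul_self μ ν h2)]
  rfl

theorem cj_permB_sq_pow (h3 : 3 * μ = 0) (k : ℕ) :
    (∀ j : R, (cj (permB μ ν h2) (permA μ h2 ^ 2) ^ k) (0, j) = (0, j + k)) ∧
    (∀ j : R, (cj (permB μ ν h2) (permA μ h2 ^ 2) ^ k) (1, j) = (1, j * (1 - k * μ))) ∧
    (∀ j : R, (cj (permB μ ν h2) (permA μ h2 ^ 2) ^ k) (2, j) =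
      (2, j - k + μ * (k ^ 2 - k + j * k))) := by
  obtain ⟨h0, h1, h2'⟩ := permA_sq_pow μ h2 h3 k
  simp only [cj_permB_pow_apply, permB_zero, permB_one, permB_two, h0, h1, h2', implies_true,
    true_and]
  intro j
  congr 1
  grind

theorem typeFour {m l : ℕ} (hm : (m : R) = μ) (hν : (l : R) = ν) (h3 : 3 * μ = 0) :
    TypeFour (permA μ h2) (permB μ ν h2) (permA μ h2 ^ 2) (cj (permB μ ν h2) (permA μ h2 ^ 2)) m l := by
  have hX := permA_sq_pow μ h2 h3
  have hY := cj_permB_sq_pow μ ν h2 h3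
  have hX1 := permA_sq_pow μ h2 h3 1
  have hY1 := cj_permB_sq_pow μ ν h2 h3 1
  set A := permA μ h2 with hA
  set B := permB μ ν h2 with hB
  set X := A ^ 2
  set Y := cj B X
  rw [pow_one] at hX1 hY1
  refine ⟨rfl, rfl, permB_mul_self μ ν h2, ?_, ?_, ?_, ?_⟩
  · ext1 ⟨p, i⟩
    fin_cases p <;> simp [hX] <;> grind
  · have : X * Y * Y ^ m = Y * X * X ^ m := by
      ext1 ⟨p, i⟩
      fin_cases p <;>
      simp only [Fin.zero_eta, Fin.mk_one, Fin.reduceFinMk,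
        Equiv.Perm.mul_apply, hX, hY, hX1, hY1, hm] <;>
       congr 1 <;> push_cast <;> grind
    rw [eq_mul_inv_iff_mul_eq]
    calc X⁻¹ * Y⁻¹ * X * Y * Y ^ m = (Y * X)⁻¹ * (X * Y * Y ^ m) := by
          simp only [mul_inv_rev, mul_assoc]
      _ = X ^ m := by rw [this, inv_mul_cancel_left]
  · have : Y * A * (Y * X) = A := by
      ext1 ⟨p, i⟩
      fin_cases p <;>
      simp only [Fin.zero_eta, Fin.mk_one, Fin.reduceFinMk,
        Equiv.Perm.mul_apply, hX1, hY1, hA, permA_zero, permA_one, permA_two] <;>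
       congr 1 <;> push_cast <;> grind
    rw [cj_apply, ← mul_inv_rev, eq_comm, inv_eq_iff_mul_eq_one]
    rw [← mul_right_inj A⁻¹] at this
    have h4 : A⁻¹ * Y * A * (Y * X) = 1 := by rw [mul_assoc A⁻¹, mul_assoc A⁻¹, this, inv_mul_cancel]
    exact mul_eq_one_comm.1 h4
  · have : (A * B) ^ 3 * Y ^ (l * m) = X ^ (l * m) := by
      ext1 ⟨p, i⟩
      fin_cases p <;>
      simp only [Fin.zero_eta, Fin.mk_one, Fin.reduceFinMk,
        pow_succ, pow_zero, one_mul, Equiv.Perm.mul_apply, hX, hY, hA, hB,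
        permA_zero, permA_one, permA_two, permB_zero, permB_one, permB_two] <;>
       congr 1 <;> push_cast <;> grind
    rw [zpow_neg, eq_mul_inv_iff_mul_eq]
    exact_mod_cast this

end TripartiteModel

/-! ### The presentation of G₄ and its universal property -/

namespace G4

theorem three_mul_third {k e : ℕ} (he : 1 ≤ e) : 3 * (3 ^ e * k / 3) = 3 ^ e * k :=
  Nat.mul_div_cancel' ((dvd_pow_self 3 (by omega)).mul_right k)

theorem three_dvd_third {k e : ℕ} (he : 2 ≤ e) : 3 ∣ 3 ^ e * k / 3 := by
  obtain ⟨e, rfl⟩ := Nat.exists_eq_add_of_le he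
  rw [show 3 ^ (2 + e) * k = 3 * (3 * (3 ^ e * k)) by ring, Nat.mul_div_cancel_left _ (by norm_num)]
  exact dvd_mul_right _ _

/-- The defining relations hold in `G₄(k,e,1,l)`. -/
theorem typeFour (k : ℕ) {e : ℕ} (he : 1 ≤ e) (l : ℤ) :
    TypeFour (a k e 1 l) (b k e 1 l) (a k e 1 l ^ 2) (cj (b k e 1 l) (a k e 1 l ^ 2))
      (3 ^ e * k / 3) l := by
  have hn := three_mul_third (k := k) he
  set φ := PresentedGroup.mk (rels k e 1 l)
  have ha : φ fa = a k e 1 l := rfl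
  have hb : φ fb = b k e 1 l := rfl
  have hx : φ fx = a k e 1 l ^ 2 := by rw [fx, map_pow, ha]
  have hy : φ fy = cj (b k e 1 l) (a k e 1 l ^ 2) := by
    rw [fy, map_mul, map_mul, map_inv, hx, hb, cj_apply]
  have rel : ∀ r ∈ rels k e 1 l, φ r = 1 := fun r hr => PresentedGroup.one_of_mem hr
  have h1 := rel _ (Or.inl rfl)
  have h3 := rel _ (Or.inr (Or.inr (Or.inl rfl)))
  have h4 := rel _ (Or.inr (Or.inr (Or.inr (Or.inl rfl))))
  have h5 := rel _ (Or.inr (Or.inr (Or.inr (Or.inr rfl))))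
  simp only [map_mul, map_inv, map_zpow, map_pow, hx, hy, ha, hb, mul_inv_eq_one] at h1 h3 h4 h5
  simp only [← map_pow (cj _)] at h3 h4 h5
  refine ⟨rfl, rfl, b_mul_b k e 1 l, ?_, ?_, ?_, ?_⟩
  · rw [hn, ← pow_mul, h1]
  · rw [h3, one_mul, zpow_neg, zpow_natCast, zpow_natCast]
  · rw [cj_apply (a k e 1 l), h4]
  · exact h5

/-- The universal property of `G₄(k,e,1,l)`. -/
theorem exists_lift {G : Type*} [Group G] {k e : ℕ} {l : ℤ} (he : 1 ≤ e) {a' b' x y : G}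
    (h : TypeFour a' b' x y (3 ^ e * k / 3) l) :
    ∃ f : G4 k e 1 l →* G, f (a k e 1 l) = a' ∧ f (b k e 1 l) = b' := by
  have hn := three_mul_third (k := k) he
  let s : Gen → G := fun g => match g with
    | .a => a'
    | .b => b'
  have ha : FreeGroup.lift s fa = a' := FreeGroup.lift_apply_of
  have hb : FreeGroup.lift s fb = b' := FreeGroup.lift_apply_of
  have hx : FreeGroup.lift s fx = x := by rw [fx, map_pow, ha, h.x_eq]
  have hy : FreeGroup.lift s fy = y := by
    rw [fy, map_mul, map_mul, map_inv, hx, hb, h.y_eq, cj_apply]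
  have hr : ∀ r ∈ rels k e 1 l, FreeGroup.lift s r = 1 := by
    intro r hr
    simp only [rels, Set.mem_insert_iff, Set.mem_singleton_iff] at hr
    rcases hr with rfl | rfl | rfl | rfl | rfl <;>
      simp only [map_mul, map_inv, map_zpow, map_pow, hx, hy, ha, hb, mul_inv_eq_one]
    · rw [pow_mul, ← h.x_eq, ← hn, h.x_pow]
    · rw [pow_two, h.b_sq]
    · rw [h.comm, one_mul, zpow_neg, zpow_natCast, zpow_natCast]
    · rw [← h.cj_a_y, cj_apply]
    · exact h.cube
  exact ⟨PresentedGroup.toGroup hr, PresentedGroup.toGroup.of hr, PresentedGroup.toGroup.of hr⟩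

end G4

/-! ### Arcs of K_{3[n]} as group elements -/

/-- The arcs of `K_{m[n]}` correspond to an ordered pair of parts and a vertex in each. -/
def completeEquipartiteDartEquiv (m n : ℕ) :
    (completeEquipartite m n).Dart ≃ {p : Fin m × Fin m // p.1 ≠ p.2} × Fin n × Fin n where
  toFun d := (⟨(d.fst.1, d.snd.1), d.adj⟩, d.fst.2, d.snd.2)
  invFun p := ⟨(⟨p.1.1.1, p.2.1⟩, ⟨p.1.1.2, p.2.2⟩), p.1.2⟩
  left_inv _ := rfl
  right_inv _ := rfl

theorem card_dart_tripartite (n : ℕ) :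
    Nat.card (completeEquipartite 3 n).Dart = 3 * n * (2 * n) := by
  rw [Nat.card_congr (completeEquipartiteDartEquiv 3 n), Nat.card_prod, Nat.card_prod,
    Nat.card_fin, Nat.card_eq_fintype_card,
    show Fintype.card {p : Fin 3 × Fin 3 // p.1 ≠ p.2} = 6 by decide]
  ring

namespace TripartiteModel

/-- A group acting on `Fin 3 × ZMod n` with generators acting by `permA` and `permB`. -/
structure Rep {G : Type*} [Group G] (a b : G) {n : ℕ} (μ ν : ZMod n) (h2 : μ * μ = 0) where
  hom : G →* Equiv.Perm (Fin 3 × ZMod n)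
  map_a : hom a = permA μ h2
  map_b : hom b = permB μ ν h2
  closure_eq_top : Subgroup.closure {a, b} = ⊤

namespace Rep

variable {G : Type*} [Group G] {a b : G} {n : ℕ} {μ ν : ZMod n} {h2 : μ * μ = 0}

theorem exists_part_perm (ρ : Rep a b μ ν h2) (g : G) :
    ∃ σ : Equiv.Perm (Fin 3), ∀ p, (ρ.hom g p).1 = σ p.1 := by
  have hg : g ∈ Subgroup.closure {a, b} := by rw [ρ.closure_eq_top]; trivial
  induction hg using Subgroup.closure_induction with
  | mem g hg =>
    rcases hg with rfl | rfl
    · refine ⟨Equiv.swap 1 2, fun ⟨p, i⟩ => ?_⟩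
      rw [ρ.map_a]
      fin_cases p <;> rfl
    · refine ⟨Equiv.swap 0 1, fun ⟨p, i⟩ => ?_⟩
      rw [ρ.map_b]
      fin_cases p <;> rfl
  | one => exact ⟨1, fun p => by simp⟩
  | mul g h _ _ hg hh =>
    obtain ⟨σ, hσ⟩ := hg
    obtain ⟨τ, hτ⟩ := hh
    exact ⟨σ * τ, fun p => by simp [hσ, hτ]⟩
  | inv g _ hg =>
    obtain ⟨σ, hσ⟩ := hg
    refine ⟨σ⁻¹, fun p => ?_⟩
    rw [Equiv.Perm.eq_inv_iff_eq, ← hσ, ← Equiv.Perm.mul_apply, ← map_mul, mul_inv_cancel, map_one]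
    rfl

theorem part_ne_iff (ρ : Rep a b μ ν h2) (g : G) (p q : Fin 3 × ZMod n) :
    (ρ.hom g p).1 ≠ (ρ.hom g q).1 ↔ p.1 ≠ q.1 := by
  obtain ⟨σ, hσ⟩ := ρ.exists_part_perm g
  rw [hσ, hσ, σ.injective.ne_iff]

theorem a_fixes (ρ : Rep a b μ ν h2) : ρ.hom a (0, 0) = (0, 0) := by
  rw [ρ.map_a, permA_zero]; simp

theorem b_zero (ρ : Rep a b μ ν h2) (j : ZMod n) : ρ.hom b (0, j) = (1, j) := by
  rw [ρ.map_b, permB_zero]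

theorem exists_pow_apply (ρ : Rep a b μ ν h2) [NeZero n] (h3 : 3 * μ = 0) {w : Fin 3 × ZMod n}
    (hw : 0 ≠ w.1) : ∃ i : ℕ, ρ.hom (a ^ i) (1, 0) = w := by
  have h : ∀ j : ZMod n, ρ.hom ((a ^ 2) ^ j.val) (1, 0) = (1, j) := fun j => by
    rw [map_pow, map_pow, ρ.map_a, (permA_sq_pow μ h2 h3 _).2.1 0, zero_add, ZMod.natCast_zmod_val]
  obtain ⟨p, j⟩ := w
  fin_cases p
  · exact absurd rfl hw
  · exact ⟨2 * j.val, by rw [pow_mul, h]; rfl⟩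
  · refine ⟨1 + 2 * j.val, ?_⟩
    rw [pow_add, map_mul, Equiv.Perm.mul_apply, pow_mul, h, pow_one, ρ.map_a, permA_one]
    rfl

theorem exists_apply_zero (ρ : Rep a b μ ν h2) [NeZero n] (h3 : 3 * μ = 0)
    (v : Fin 3 × ZMod n) : ∃ g : G, ρ.hom g (0, 0) = v := by
  by_cases hv : 0 = v.1
  · obtain ⟨i, hi⟩ := ρ.exists_pow_apply h3 (w := (1, v.2)) (by simp)
    refine ⟨b * a ^ i * b, ?_⟩
    rw [map_mul, map_mul, Equiv.Perm.mul_apply, Equiv.Perm.mul_apply, ρ.b_zero, hi, ρ.map_b,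
      permB_one]
    exact Prod.ext hv rfl
  · obtain ⟨i, hi⟩ := ρ.exists_pow_apply h3 hv
    exact ⟨a ^ i * b, by rw [map_mul, Equiv.Perm.mul_apply, ρ.b_zero, hi]⟩

theorem exists_apply_arc (ρ : Rep a b μ ν h2) [NeZero n] (h3 : 3 * μ = 0)
    {v w : Fin 3 × ZMod n} (h : v.1 ≠ w.1) :
    ∃ g : G, ρ.hom g (0, 0) = v ∧ ρ.hom g (1, 0) = w := by
  obtain ⟨g, rfl⟩ := ρ.exists_apply_zero h3 v
  have hw : w = ρ.hom g (ρ.hom g⁻¹ w) := by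
    rw [← Equiv.Perm.mul_apply, ← map_mul, mul_inv_cancel, map_one]; rfl
  rw [hw, part_ne_iff] at h
  obtain ⟨i, hi⟩ := ρ.exists_pow_apply h3 h
  refine ⟨g * a ^ i, ?_, ?_⟩
  · have : ∀ i : ℕ, ρ.hom (a ^ i) (0, 0) = (0, 0) := fun i => by
      rw [map_pow]; exact Equiv.Perm.pow_apply_eq_self_of_apply_eq_self ρ.a_fixes i
    rw [map_mul, Equiv.Perm.mul_apply, this]
  · rw [map_mul, Equiv.Perm.mul_apply, hi, ← hw]

/-- The vertices of `K_{3[n]}` as pairs. -/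
def vertexEquiv (n : ℕ) [NeZero n] : Fin 3 × ZMod n ≃ Σ _ : Fin 3, Fin n :=
  ((Equiv.refl _).prodCongr (ZMod.finEquiv n).symm.toEquiv).trans (Equiv.sigmaEquivProd _ _).symm

/-- The arc of `K_{3[n]}` that belongs to a group element. -/
def arc (ρ : Rep a b μ ν h2) [NeZero n] (g : G) : (completeEquipartite 3 n).Dart :=
  -- The inverse turns the action on left cosets into the right cosets ⟨a⟩g of an algebraic map, so
  -- that left multiplication by `a` keeps the initial vertex.
  ⟨(vertexEquiv n (ρ.hom g⁻¹ (0, 0)), vertexEquiv n (ρ.hom g⁻¹ (1, 0))),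
    (ρ.part_ne_iff g⁻¹ (0, 0) (1, 0)).2 (by simp)⟩

theorem arc_fst (ρ : Rep a b μ ν h2) [NeZero n] (g : G) :
    (ρ.arc g).fst = vertexEquiv n (ρ.hom g⁻¹ (0, 0)) := rfl

theorem arc_snd (ρ : Rep a b μ ν h2) [NeZero n] (g : G) :
    (ρ.arc g).snd = vertexEquiv n (ρ.hom g⁻¹ (1, 0)) := rfl

theorem arc_surjective (ρ : Rep a b μ ν h2) [NeZero n] (h3 : 3 * μ = 0) :
    Function.Surjective ρ.arc := by
  intro d
  obtain ⟨g, hg, hg'⟩ := ρ.exists_apply_arc h3 (v := (vertexEquiv n).symm d.fst)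
    (w := (vertexEquiv n).symm d.snd) d.adj
  refine ⟨g⁻¹, SimpleGraph.Dart.ext _ _ (Prod.ext ?_ ?_)⟩
  · exact (ρ.arc_fst _).trans (by rw [inv_inv, hg, Equiv.apply_symm_apply])
  · exact (ρ.arc_snd _).trans (by rw [inv_inv, hg', Equiv.apply_symm_apply])

/-- The upper bound for the order meets the number 6n² of arcs, so transitivity on arcs is already
regularity. -/
theorem arc_bijective (ρ : Rep a b μ ν h2) [NeZero n] (h3 : 3 * μ = 0) [Finite G]
    (hc : Nat.card G ≤ 3 * n * (2 * n)) : Function.Bijective ρ.arc := by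
  have hs := ρ.arc_surjective h3
  have : Finite (completeEquipartite 3 n).Dart := Finite.of_surjective _ hs
  refine (Nat.bijective_iff_surjective_and_card _).2 ⟨hs, le_antisymm ?_ ?_⟩
  · rwa [card_dart_tripartite]
  · exact Nat.card_le_card_of_surjective _ hs

/-- The stabiliser of a vertex is generated by `a`. -/
theorem apply_zero_eq_iff (ρ : Rep a b μ ν h2) [NeZero n] (h3 : 3 * μ = 0)
    (hi : Function.Injective ρ.arc) (g : G) :
    ρ.hom g (0, 0) = (0, 0) ↔ g ∈ Subgroup.zpowers a := by
  have hpow : ∀ i : ℤ, ρ.hom (a ^ i) (0, 0) = (0, 0) := fun i => by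
    rw [map_zpow]; exact Equiv.Perm.zpow_apply_eq_self_of_apply_eq_self ρ.a_fixes i
  constructor
  · intro hg
    have h1 := (ρ.part_ne_iff g (0, 0) (1, 0)).2 (by simp)
    rw [hg] at h1
    obtain ⟨i, hi'⟩ := ρ.exists_pow_apply h3 h1
    have : (g⁻¹ : G) = (a ^ i)⁻¹ := by
      apply hi
      refine SimpleGraph.Dart.ext _ _ (Prod.ext ?_ ?_)
      · refine (ρ.arc_fst _).trans (Eq.trans ?_ (ρ.arc_fst _).symm)
        rw [inv_inv, inv_inv, hg, ← zpow_natCast, hpow]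
      · refine (ρ.arc_snd _).trans (Eq.trans ?_ (ρ.arc_snd _).symm)
        rw [inv_inv, inv_inv, hi']
    rw [inv_inj] at this
    exact ⟨i, by rw [this]; exact zpow_natCast a i⟩
  · rintro ⟨i, rfl⟩
    exact hpow i

end Rep

end TripartiteModel

/-- The representation of `G₄(k,e,1,l)` on the vertices of `K_{3[n]}`. -/
theorem G4.nonempty_rep (k : ℕ) {e : ℕ} (he : 2 ≤ e) (l : ℤ) :
    ∃ (μ ν : ZMod (3 ^ e * k)) (h2 : μ * μ = 0), 3 * μ = 0 ∧
      Nonempty (TripartiteModel.Rep (a k e 1 l) (b k e 1 l) μ ν h2) := by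
  set m := 3 ^ e * k / 3
  have hn : 3 * m = 3 ^ e * k := three_mul_third (by omega)
  obtain ⟨q, hq⟩ : 3 ∣ m := three_dvd_third he
  have h3 : 3 * (m : ZMod (3 ^ e * k)) = 0 := by
    rw [← hn]; exact_mod_cast ZMod.natCast_self (3 * m)
  have h2 : (m : ZMod (3 ^ e * k)) * m = 0 := by
    nth_rw 1 [hq]
    push_cast
    linear_combination (q : ZMod (3 ^ e * k)) * h3
  have hl : ((l % 3).toNat : ℤ) = l % 3 := Int.toNat_of_nonneg (Int.emod_nonneg _ (by norm_num))
  -- The model is computed for a natural exponent; the relations depend on l only mod 3.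
  have hT := (TripartiteModel.typeFour (m := m) (l := (l % 3).toNat) (R := ZMod (3 ^ e * k)) m
    ((l % 3).toNat : ZMod (3 ^ e * k)) h2 rfl rfl h3).of_dvd (l' := l) (by omega)
  obtain ⟨f, hfa, hfb⟩ := exists_lift (by omega) hT
  refine ⟨m, _, h2, h3, ⟨f, hfa, hfb, ?_⟩⟩
  simpa using closure_eq_top k e 1 l 1

/-! ### Embedding, chirality and type of M₄ -/

theorem Subgroup.zpowers_zpow_units {G : Type*} [Group G] (a : G) (j : ℤˣ) :
    Subgroup.zpowers (a ^ (j : ℤ)) = Subgroup.zpowers a := by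
  rcases Int.units_eq_one_or j with rfl | rfl <;> simp

theorem Equiv.mulLeft_zpow_apply {G : Type*} [Group G] (g d : G) (i : ℤ) :
    ((Equiv.mulLeft g) ^ i) d = g ^ i * d := by
  have h : (MulAction.toPermHom G G (g ^ i)) d = g ^ i * d := rfl
  rw [map_zpow] at h
  exact h

theorem minimalPeriod_mul_left {G : Type*} [Group G] (g d : G) :
    Function.minimalPeriod (fun c => g * c) d = orderOf g := by
  refine Function.minimalPeriod_eq_minimalPeriod_iff.2 fun i => ?_
  simp [Function.IsPeriodicPt, Function.IsFixedPt, mul_left_iterate]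

theorem orderOf_mul_symm {G : Type*} [Group G] (g h : G) : orderOf (g * h) = orderOf (h * g) := by
  have := orderOf_injective (MulAut.conj h).toMonoidHom (MulAut.conj h).injective (g * h)
  rw [← this]
  congr 1
  simp [mul_assoc]

namespace OrientedMap

/-- Automorphisms of a connected map are determined by the image of one dart. -/
theorem autPlus_ext {M : OrientedMap.{u}} {g h : M.autPlus} {d : M.Dart}
    (hd : (g : Equiv.Perm M.Dart) d = (h : Equiv.Perm M.Dart) d) : g = h := by
  refine Subtype.ext (Equiv.ext fun d' => ?_)
  obtain ⟨w, hw, rfl⟩ := M.connected d d'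
  have key : ∀ k : M.autPlus, (k : Equiv.Perm M.Dart) (w d) = w ((k : Equiv.Perm M.Dart) d) := by
    intro k
    have hk : (k : Equiv.Perm M.Dart) ∈ Subgroup.centralizer
        (Subgroup.closure {M.rot, M.inv} : Set (Equiv.Perm M.Dart)) := by
      rw [Subgroup.centralizer_closure]; exact k.2
    exact (congrArg (fun σ : Equiv.Perm M.Dart => σ d)
      (Subgroup.mem_centralizer_iff.1 hk w hw)).symm
  rw [key, key, hd]

end OrientedMap

/-- Algebraic maps are orientably-regular: right multiplications are automorphisms. -/
theorem algebraicMap_isOrientablyRegular {G : Type u} [Group G] (a b : G) (hb : b * b = 1)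
    (hb1 : b ≠ 1) (hgen : Subgroup.closure {a, b} = ⊤) :
    (algebraicMap a b hb hb1 hgen).IsOrientablyRegular := by
  intro (d : G) (d' : G)
  have hmem : Equiv.mulRight (d⁻¹ * d') ∈ (algebraicMap a b hb hb1 hgen).autPlus := by
    refine Subgroup.mem_centralizer_iff.2 ?_
    rintro _ (rfl | rfl) <;> exact Equiv.ext fun c : G => (mul_assoc _ c _).symm
  have hd : Equiv.mulRight (d⁻¹ * d') d = d' := mul_inv_cancel_left d d'
  exact ⟨⟨_, hmem⟩, hd, fun g hg => OrientedMap.autPlus_ext (hg.trans hd.symm)⟩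

namespace TripartiteModel.Rep

section

variable {G : Type*} [Group G] {a b : G} {n : ℕ} {μ ν : ZMod n} {h2 : μ * μ = 0}

theorem arc_symm (ρ : Rep a b μ ν h2) [NeZero n] (hb : b * b = 1) (g : G) :
    ρ.arc (b * g) = (ρ.arc g).symm := by
  have hb' : b⁻¹ = b := inv_eq_of_mul_eq_one_right hb
  refine SimpleGraph.Dart.ext _ _ (Prod.ext ?_ ?_)
  · change (ρ.arc (b * g)).fst = (ρ.arc g).snd
    rw [arc_fst, arc_snd, mul_inv_rev, map_mul, Equiv.Perm.mul_apply, hb', b_zero]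
  · change (ρ.arc (b * g)).snd = (ρ.arc g).fst
    rw [arc_fst, arc_snd, mul_inv_rev, map_mul, Equiv.Perm.mul_apply, hb', ← ρ.b_zero,
      ← Equiv.Perm.mul_apply (ρ.hom b), ← map_mul, hb, map_one, Equiv.Perm.one_apply]

theorem dvd_of_pow_eq_one (ρ : Rep a b μ ν h2) (h3 : 3 * μ = 0) {i : ℕ} (hi : a ^ i = 1) :
    2 * n ∣ i := by
  have h : ∀ k : ℕ, ρ.hom ((a ^ 2) ^ k) (1, 0) = (1, (k : ZMod n)) := fun k => by
    rw [map_pow, map_pow, ρ.map_a, (permA_sq_pow μ h2 h3 _).2.1 0, zero_add]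
  have h1 : ρ.hom (a ^ i) (1, 0) = (1, 0) := by rw [hi, map_one]; rfl
  obtain ⟨k, rfl | rfl⟩ := Nat.even_or_odd' i
  · rw [pow_mul, h] at h1
    exact Nat.mul_dvd_mul_left 2 ((ZMod.natCast_eq_zero_iff k n).1 (Prod.ext_iff.1 h1).2)
  · rw [pow_succ', map_mul, pow_mul, Equiv.Perm.mul_apply, h, ρ.map_a, permA_one] at h1
    exact absurd (Prod.ext_iff.1 h1).1 (by simp)

/-- x^i fixes the vertex (0,0), whereas y^i moves it to (0,i). This separates x^m from y^m, for type
9, and x^(2m) from y^(2m), for chirality. -/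
theorem dvd_of_pow_eq_pow (ρ : Rep a b μ ν h2) (h3 : 3 * μ = 0) (hb : b * b = 1) {i : ℕ}
    (hi : (a ^ 2) ^ i = cj b (a ^ 2) ^ i) : n ∣ i := by
  have hb' : b⁻¹ = b := inv_eq_of_mul_eq_one_right hb
  have h := congrArg (fun g => ρ.hom g (0, 0)) hi
  rw [← map_pow, cj_apply, hb'] at h
  simp only [map_mul, map_pow, Equiv.Perm.mul_apply, b_zero, ρ.map_a,
    (permA_sq_pow μ h2 h3 _).1, (permA_sq_pow μ h2 h3 _).2.1] at h
  rw [ρ.map_b, permB_one] at h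
  have h5 := (Prod.ext_iff.1 h).2
  simp only [zero_mul, zero_add] at h5
  exact (ZMod.natCast_eq_zero_iff i n).1 h5.symm

theorem mul_ne_one (ρ : Rep a b μ ν h2) : a * b ≠ 1 := by
  intro h
  have h1 : ρ.hom (a * b) (0, 0) = (0, 0) := by rw [h, map_one]; rfl
  rw [map_mul, Equiv.Perm.mul_apply, b_zero, ρ.map_a, permA_one] at h1
  exact absurd (Prod.ext_iff.1 h1).1 (by simp)

/-- The embedding of an algebraic map in `K_{3[n]}` that belongs to a representation. -/
theorem nonempty_embedding {G : Type u} [Group G] {a b : G} {h2 : μ * μ = 0}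
    (ρ : Rep a b μ ν h2) [NeZero n] (h3 : 3 * μ = 0) (hb : b * b = 1)
    (hb1 : b ≠ 1) [Finite G] (hc : Nat.card G ≤ 3 * n * (2 * n)) (j : ℤˣ)
    (hgen : Subgroup.closure {a ^ (j : ℤ), b} = ⊤) :
    Nonempty ((algebraicMap (a ^ (j : ℤ)) b hb hb1 hgen).Embedding (completeEquipartite 3 n)) := by
  have hbij := ρ.arc_bijective h3 hc
  refine ⟨⟨Equiv.ofBijective ρ.arc hbij, fun d => ρ.arc_symm hb d, fun (d : G) (d' : G) => ?_,
    fun v => ?_⟩⟩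
  · change (Equiv.mulLeft (a ^ (j : ℤ))).SameCycle d d' ↔ (ρ.arc d).fst = (ρ.arc d').fst
    have h1 : (Equiv.mulLeft (a ^ (j : ℤ))).SameCycle d d' ↔ d' * d⁻¹ ∈ Subgroup.zpowers a := by
      rw [← Subgroup.zpowers_zpow_units a j, Subgroup.mem_zpowers_iff]
      simp only [Equiv.Perm.SameCycle, Equiv.mulLeft_zpow_apply, eq_mul_inv_iff_mul_eq]
    rw [h1, ← ρ.apply_zero_eq_iff h3 hbij.1, arc_fst, arc_fst, (vertexEquiv n).injective.eq_iff,
      map_mul, Equiv.Perm.mul_apply, map_inv, map_inv, eq_comm (a := (ρ.hom d)⁻¹ _),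
      Equiv.Perm.inv_eq_iff_eq, eq_comm]
  · obtain ⟨g, hg⟩ := ρ.exists_apply_zero h3 ((vertexEquiv n).symm v)
    refine ⟨(g⁻¹ : G), (ρ.arc_fst _).trans ?_⟩
    rw [inv_inv, hg, Equiv.apply_symm_apply]

end

end TripartiteModel.Rep

/-- A group with the relations of `G₄` and an automorphism-like permutation inverting `a` and fixing
`b` satisfies `x^(2m) = y^(2m)`. -/
theorem TypeFour.pow_eq_of_reversing {G : Type*} [Group G] {a b x y : G} {m : ℕ} {l : ℤ}
    (h : TypeFour a b x y m l) (hm : 3 ∣ m) (f : Equiv.Perm G)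
    (ha : ∀ d, f (a * d) = a⁻¹ * f d) (hb : ∀ d, f (b * d) = b * f d) :
    x ^ (2 * m) = y ^ (2 * m) := by
  have hxy := h.commute_x_pow_y hm
  have hyx := h.commute_y_pow_x hm
  -- Conjugation by f in the left regular representation sends `a` to its inverse and fixes `b`, so
  -- the relation for [x,y] also holds for x⁻¹ and y⁻¹. Their commutator is again [x,y], whence x^m
  -- y^(-m) = x^(-m)y^m.
  set F : G →* Equiv.Perm G := (MulAut.conj f).toMonoidHom.comp (MulAction.toPermHom G G) with hF
  set L : G →* Equiv.Perm G := MulAction.toPermHom G G with hL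
  have hFa : F a = L a⁻¹ := Equiv.ext fun d => by
    simpa [hF, hL] using ha (f.symm d)
  have hFb : F b = L b := Equiv.ext fun d => by
    simpa [hF, hL] using hb (f.symm d)
  have hFx : F x = L x⁻¹ := by
    rw [h.x_eq, map_pow, hFa, ← map_pow, inv_pow]
  have hFy : F y = L y⁻¹ := by
    rw [h.y_eq, cj_apply, map_mul, map_mul, map_inv, hFb, hFx, ← map_inv, ← map_mul, ← map_mul]
    congr 1
    group
  have h1 := congrArg F h.comm
  simp only [map_mul, map_inv, map_pow, hFx, hFy] at h1
  simp only [← map_inv, ← map_pow, ← map_mul, inv_inv] at h1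
  have h4 := MulAction.toPerm_injective (α := G) (β := G) h1
  have hz : Commute (y * x) (x ^ m * (y ^ m)⁻¹) :=
    ((hxy.symm.mul_left ((Commute.refl x).pow_right m))).mul_right
      (((Commute.refl y).pow_right m).mul_left hyx.symm).inv_right
  have h5 : x * y * x⁻¹ * y⁻¹ = x ^ m * (y ^ m)⁻¹ := by
    calc x * y * x⁻¹ * y⁻¹ = (y * x) * (x⁻¹ * y⁻¹ * x * y) * (y * x)⁻¹ := by group
      _ = _ := by rw [h.comm, hz.eq, mul_inv_cancel_right]
  rw [h5, inv_pow, inv_pow, inv_inv] at h4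
  rw [mul_inv_eq_iff_eq_mul, mul_assoc, eq_inv_mul_iff_mul_eq] at h4
  rw [two_mul, pow_add, pow_add, h4]

namespace G4

variable {k e : ℕ}

/-- The properties of `M₄(k,e,1,l,j)`. -/
theorem embedding_chiral_type (hk : k ≠ 0) (he : 2 ≤ e) (l : ℤ) (hl : l = 0 ∨ l = 1 ∨ l = -1)
    (j : ℤˣ) :
    Nonempty ((M4 k e 1 l j).Embedding (completeEquipartite 3 (3 ^ e * k))) ∧
      (M4 k e 1 l j).IsChiral ∧
      (l = 0 → (M4 k e 1 l j).HasType 3 (2 * (3 ^ e * k))) ∧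
      (l = 1 ∨ l = -1 → (M4 k e 1 l j).HasType 9 (2 * (3 ^ e * k))) := by
  have hn := three_mul_third (k := k) (show 1 ≤ e by omega)
  have hm3 := three_dvd_third (k := k) he
  have hT := typeFour k (show 1 ≤ e by omega) l
  have hn0 : 0 < 3 ^ e * k := by positivity
  have : NeZero (3 ^ e * k) := ⟨hn0.ne'⟩
  obtain ⟨μ, ν, h2, h3, ⟨ρ⟩⟩ := nonempty_rep k he l
  obtain ⟨hfin, hcard⟩ := hT.finite_and_card_le hm3 (by omega) ρ.closure_eq_top
  rw [hn] at hcard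
  have hb := b_mul_b k e 1 l
  set m := 3 ^ e * k / 3
  set a' := a k e 1 l
  set b' := b k e 1 l
  have hord : orderOf (a' ^ (j : ℤ)) = 2 * (3 ^ e * k) := by
    have h : orderOf a' = 2 * (3 ^ e * k) := by
      refine Nat.dvd_antisymm (orderOf_dvd_of_pow_eq_one ?_)
        (ρ.dvd_of_pow_eq_one h3 (pow_orderOf_eq_one a'))
      rw [← hn, pow_mul]
      exact hT.x_pow
    rcases Int.units_eq_one_or j with rfl | rfl <;> simp [h]
  have htype : ∀ s, orderOf (a' * b') = s → (M4 k e 1 l j).HasType s (2 * (3 ^ e * k)) := by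
    intro s hs
    refine ⟨fun (d : G4 k e 1 l) => ?_, fun d => ?_⟩
    · change Function.minimalPeriod (fun c : G4 k e 1 l => a' ^ (j : ℤ) * (b' * c)) d = s
      simp only [← mul_assoc]
      rw [minimalPeriod_mul_left, ← hs]
      rcases Int.units_eq_one_or j with rfl | rfl
      · simp
      · rw [Units.val_neg, Units.val_one, zpow_neg_one, ← orderOf_inv, mul_inv_rev, inv_inv,
          inv_eq_of_mul_eq_one_right hb, orderOf_mul_symm]
    · exact (minimalPeriod_mul_left _ _).trans hord
  refine ⟨ρ.nonempty_embedding h3 hb (b_ne_one k e 1 l) hcard j _,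
    ⟨algebraicMap_isOrientablyRegular _ _ _ _ _, ?_⟩, ?_, ?_⟩
  · rintro ⟨f, hf⟩
    change Equiv.Perm (G4 k e 1 l) at f
    have h1 : ∀ d, f (a' ^ (j : ℤ) * d) = (a' ^ (j : ℤ))⁻¹ * f d := fun d => (hf d).1
    have h6 : ∀ d, f (a' * d) = a'⁻¹ * f d := by
      rcases Int.units_eq_one_or j with rfl | rfl
      · simpa using h1
      · intro d
        have := h1 (a' * d)
        simp only [Units.val_neg, Units.val_one, zpow_neg_one, inv_mul_cancel_left, inv_inv] at this
        rw [this, inv_mul_cancel_left]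
    have h7 := ρ.dvd_of_pow_eq_pow h3 hb
      (hT.pow_eq_of_reversing hm3 f h6 fun d => (hf d).2)
    have := Nat.le_of_dvd (by omega) h7
    omega
  · rintro rfl
    refine htype 3 (orderOf_eq_prime ?_ ρ.mul_ne_one)
    rw [hT.cube]
    simp
  · intro hl1
    have hne : ¬ (a' ^ 2) ^ m = cj b' (a' ^ 2) ^ m := fun h => by
      have := Nat.le_of_dvd (by omega) (ρ.dvd_of_pow_eq_pow h3 hb h)
      omega
    refine htype (3 ^ (1 + 1)) (orderOf_eq_prime_pow ?_ ?_)
    · rw [pow_one, hT.cube]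
      rcases hl1 with rfl | rfl
      · rw [one_mul, zpow_neg, zpow_natCast, zpow_natCast, mul_inv_eq_one]
        exact hne
      · rw [neg_one_mul, neg_neg, zpow_neg, zpow_natCast, zpow_natCast, inv_mul_eq_one]
        exact hne
    · have hx : ((a' ^ 2) ^ (l * (m : ℤ))) ^ 3 = 1 := by
        rw [← zpow_natCast, ← zpow_mul, show l * m * ((3 : ℕ) : ℤ) = ((3 * m : ℕ) : ℤ) * l by
          push_cast; ring, zpow_mul, zpow_natCast, hT.x_pow, one_zpow]
      have hy : (cj b' (a' ^ 2) ^ (-(l * (m : ℤ)))) ^ 3 = 1 := by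
        rw [← map_zpow, ← map_pow, zpow_neg, inv_pow, hx, inv_one, map_one]
      have hcomm : Commute ((a' ^ 2) ^ (l * (m : ℤ))) (cj b' (a' ^ 2) ^ (-(l * (m : ℤ)))) := by
        rw [mul_comm, zpow_mul, zpow_natCast]
        exact ((hT.commute_x_pow_y hm3).zpow_left l).zpow_right _
      rw [pow_succ 3 1, pow_one, pow_mul, hT.cube, hcomm.mul_pow, hx, hy, one_mul]

end G4

/-! ### Automorphisms of a regular embedding of K_{3[n]} -/

namespace OrientedMap

variable {M : OrientedMap.{u}}

theorem rot_smul (g : M.autPlus) (d : M.Dart) : M.rot (g • d) = g • M.rot d :=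
  congrArg (fun σ : Equiv.Perm M.Dart => σ d)
    (Subgroup.mem_centralizer_iff.1 g.2 M.rot (Or.inl rfl))

theorem inv_smul_dart (g : M.autPlus) (d : M.Dart) : M.inv (g • d) = g • M.inv d :=
  congrArg (fun σ : Equiv.Perm M.Dart => σ d)
    (Subgroup.mem_centralizer_iff.1 g.2 M.inv (Or.inr rfl))

theorem smul_left_injective_dart {g h : M.autPlus} {d : M.Dart} (hd : g • d = h • d) : g = h :=
  autPlus_ext hd

/-- The automorphisms that turn and reverse a given dart generate. -/
theorem closure_pair_eq_top {d₀ : M.Dart} {a b : M.autPlus} (ha : a • M.rot d₀ = d₀)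
    (hb : b • d₀ = M.inv d₀) : Subgroup.closure {a, b} = ⊤ := by
  set K := Subgroup.closure {a, b}
  have haK : a ∈ K := Subgroup.subset_closure (by simp)
  have hbK : b ∈ K := Subgroup.subset_closure (by simp)
  -- Rotation and reversal commute with automorphisms, so on the orbit of d₀ they act as right
  -- multiplication by elements of K. The K-orbit of d₀ is therefore closed under both, and by
  -- connectedness it is everything.
  have hmul : ∀ c ∈ K, ∀ σ : Equiv.Perm M.Dart, (∀ h : M.autPlus, σ (h • d₀) = (h * c) • d₀) →
      ∀ d, (∃ h ∈ K, σ d = h • d₀) ↔ ∃ h ∈ K, d = h • d₀ := by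
    intro c hc σ hσ d
    constructor
    · rintro ⟨h, hh, hd⟩
      refine ⟨h * c⁻¹, K.mul_mem hh (K.inv_mem hc), σ.injective ?_⟩
      rw [hd, hσ, inv_mul_cancel_right]
    · rintro ⟨h, hh, rfl⟩
      exact ⟨h * c, K.mul_mem hh hc, hσ h⟩
  have key : ∀ w ∈ Subgroup.closure {M.rot, M.inv}, ∀ d,
      (∃ h ∈ K, w d = h • d₀) ↔ ∃ h ∈ K, d = h • d₀ := by
    intro w hw
    induction hw using Subgroup.closure_induction with
    | mem w hw =>
      rcases hw with rfl | rfl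
      · refine hmul a⁻¹ (K.inv_mem haK) _ fun h => ?_
        rw [rot_smul, mul_smul, ← eq_inv_smul_iff.2 ha]
      · refine hmul b hbK _ fun h => ?_
        rw [inv_smul_dart, mul_smul, hb]
    | one => exact fun d => Iff.rfl
    | mul v w _ _ hv hw => exact fun d => (hv (w d)).trans (hw d)
    | inv w _ hw =>
      intro d
      rw [← hw, ← Equiv.Perm.mul_apply, mul_inv_cancel, Equiv.Perm.one_apply]
  refine eq_top_iff.2 fun g _ => ?_
  obtain ⟨w, hw, hd⟩ := M.connected d₀ (g • d₀)
  obtain ⟨h, hh, hd'⟩ := (key w hw d₀).2 ⟨1, K.one_mem, (one_smul _ _).symm⟩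
  rwa [smul_left_injective_dart (hd.symm.trans hd')]

namespace Embedding

section

variable {V : Type*} {Γ : SimpleGraph V} (φ : M.Embedding Γ)

/-- The initial vertex of a dart. -/
def vert (d : M.Dart) : V := (φ.toEquiv d).fst

theorem vert_inv (d : M.Dart) : φ.vert (M.inv d) = (φ.toEquiv d).snd := by
  rw [vert, φ.map_inv]; rfl

theorem vert_smul_iff (g : M.autPlus) (d d' : M.Dart) :
    φ.vert (g • d) = φ.vert (g • d') ↔ φ.vert d = φ.vert d' := by
  rw [vert, vert, vert, vert, ← φ.sameCycle_iff, ← φ.sameCycle_iff]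
  have h : M.rot = (g : Equiv.Perm M.Dart)⁻¹ * M.rot * ((g : Equiv.Perm M.Dart)⁻¹)⁻¹ := by
    rw [_root_.inv_inv, mul_assoc, Subgroup.mem_centralizer_iff.1 g.2 M.rot (Or.inl rfl),
      inv_mul_cancel_left]
  conv_rhs => rw [h, Equiv.Perm.sameCycle_conj, _root_.inv_inv]
  rfl

theorem dart_ext {d d' : M.Dart} (h : φ.vert d = φ.vert d')
    (h' : φ.vert (M.inv d) = φ.vert (M.inv d')) : d = d' := by
  rw [vert_inv, vert_inv] at h'
  exact φ.toEquiv.injective (SimpleGraph.Dart.ext _ _ (Prod.ext h h'))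

theorem adj_iff (d d' : M.Dart) : Γ.Adj (φ.vert d) (φ.vert d') ↔
    ∃ f, φ.vert f = φ.vert d ∧ φ.vert (M.inv f) = φ.vert d' := by
  constructor
  · intro h
    refine ⟨φ.toEquiv.symm ⟨(φ.vert d, φ.vert d'), h⟩, ?_, ?_⟩
    · rw [vert, Equiv.apply_symm_apply]
    · rw [vert_inv, Equiv.apply_symm_apply]
  · rintro ⟨f, hf, hf'⟩
    rw [← hf, ← hf', vert_inv]
    exact (φ.toEquiv f).adj

theorem adj_smul_iff (g : M.autPlus) (d d' : M.Dart) :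
    Γ.Adj (φ.vert (g • d)) (φ.vert (g • d')) ↔ Γ.Adj (φ.vert d) (φ.vert d') := by
  rw [adj_iff, adj_iff]
  constructor
  · rintro ⟨f, hf, hf'⟩
    obtain ⟨f, rfl⟩ := MulAction.surjective g f
    rw [inv_smul_dart, vert_smul_iff] at hf'
    exact ⟨f, (φ.vert_smul_iff g _ _).1 hf, hf'⟩
  · rintro ⟨f, hf, hf'⟩
    refine ⟨g • f, (φ.vert_smul_iff g _ _).2 hf, ?_⟩
    rwa [inv_smul_dart, vert_smul_iff]

theorem vert_zpow_smul {d₀ : M.Dart} {a : M.autPlus} (ha : a • M.rot d₀ = d₀) (i : ℤ) :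
    φ.vert (a ^ i • d₀) = φ.vert d₀ := by
  have h1 : φ.vert (a • d₀) = φ.vert d₀ := by
    conv_rhs => rw [← ha]
    rw [vert_smul_iff]
    exact (φ.sameCycle_iff _ _).1 ⟨1, by simp⟩
  have h2 : φ.vert (a⁻¹ • d₀) = φ.vert d₀ := by
    rw [← φ.vert_smul_iff a, smul_inv_smul, h1]
  induction i with
  | zero => simp
  | succ i ih => rw [zpow_add_one, mul_smul, (φ.vert_smul_iff _ _ _).2 h1, ih]
  | pred i ih => rw [zpow_sub_one, mul_smul, (φ.vert_smul_iff _ _ _).2 h2, ih]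

theorem exists_zpow_smul {d₀ : M.Dart} {a : M.autPlus} (ha : a • M.rot d₀ = d₀) {f : M.Dart}
    (hf : φ.vert f = φ.vert d₀) : ∃ i : ℤ, f = a ^ i • d₀ := by
  obtain ⟨i, hi⟩ := (φ.sameCycle_iff d₀ f).2 hf.symm
  have ha' : M.rot d₀ = a⁻¹ • d₀ := eq_inv_smul_iff.2 ha
  have hrot : ∀ i : ℕ, (M.rot ^ i) d₀ = a⁻¹ ^ i • d₀ := fun i => by
    induction i with
    | zero => simp
    | succ i ih => rw [pow_succ', Equiv.Perm.mul_apply, ih, rot_smul, ha', ← mul_smul, ← pow_succ]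
  have hrot' : ∀ i : ℕ, (M.rot⁻¹ ^ i) d₀ = a ^ i • d₀ := fun i => by
    induction i with
    | zero => simp
    | succ i ih =>
      rw [pow_succ', Equiv.Perm.mul_apply, ih, Equiv.Perm.inv_eq_iff_eq, rot_smul, ha', ← mul_smul,
        pow_succ, mul_inv_cancel_right]
  refine ⟨-i, ?_⟩
  rw [← hi]
  obtain ⟨k, rfl | rfl⟩ := i.eq_nat_or_neg
  · rw [zpow_natCast, hrot, zpow_neg, zpow_natCast, inv_pow]
  · rw [zpow_neg, zpow_natCast, ← inv_pow, hrot', neg_neg, zpow_natCast]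

end

end Embedding

end OrientedMap

/-- The number of arcs of `K_{3[n]}` that start in a given vertex. -/
theorem card_dart_fst_tripartite (n : ℕ) (v : Σ _ : Fin 3, Fin n) :
    Nat.card {d : (completeEquipartite 3 n).Dart // d.fst = v} = 2 * n := by
  have e : {d : (completeEquipartite 3 n).Dart // d.fst = v} ≃ {p : Fin 3 // v.1 ≠ p} × Fin n :=
    { toFun := fun d => (⟨d.1.snd.1, by obtain ⟨d, rfl⟩ := d; exact d.adj⟩, d.1.snd.2)
      invFun := fun p => ⟨⟨(v, ⟨p.1.1, p.2⟩), p.1.2⟩, rfl⟩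
      left_inv := by rintro ⟨d, rfl⟩; rfl
      right_inv := fun _ => rfl }
  have h : ∀ q : Fin 3, Fintype.card {p : Fin 3 // q ≠ p} = 2 := by decide
  rw [Nat.card_congr e, Nat.card_prod, Nat.card_fin, Nat.card_eq_fintype_card, h]

namespace OrientedMap.Embedding

variable {M : OrientedMap.{u}} {n : ℕ} (φ : M.Embedding (completeEquipartite 3 n))

/-- The part of the initial vertex of a dart. -/
def part (d : M.Dart) : Fin 3 := (φ.vert d).1

theorem adj_iff_part (d d' : M.Dart) :
    (completeEquipartite 3 n).Adj (φ.vert d) (φ.vert d') ↔ φ.part d ≠ φ.part d' := Iff.rfl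

theorem part_inv_ne (d : M.Dart) : φ.part d ≠ φ.part (M.inv d) := by
  rw [← adj_iff_part, adj_iff]; exact ⟨d, rfl, rfl⟩

theorem part_smul_iff (g : M.autPlus) (d d' : M.Dart) :
    φ.part (g • d) = φ.part (g • d') ↔ φ.part d = φ.part d' := by
  rw [← not_iff_not]; exact φ.adj_smul_iff g d d'

theorem mem_autZero {g : M.autPlus} : g ∈ autZero φ ↔ ∀ d, φ.part (g • d) = φ.part d := Iff.rfl

theorem exists_part [NeZero n] (p : Fin 3) : ∃ d, φ.part d = p := by
  obtain ⟨d, hd⟩ := φ.exists_dart ⟨p, 0⟩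
  exact ⟨d, congrArg Sigma.fst hd⟩

/-- Automorphisms permute the parts. -/
theorem exists_perm_part [NeZero n] (g : M.autPlus) :
    ∃ σ : Equiv.Perm (Fin 3), ∀ d, φ.part (g • d) = σ (φ.part d) := by
  choose D hD using φ.exists_part
  have hinj : Function.Injective fun p => φ.part (g • D p) := fun p q h => by
    rw [← hD p, ← hD q]; exact (φ.part_smul_iff g _ _).1 h
  refine ⟨Equiv.ofBijective _ (Finite.injective_iff_bijective.1 hinj), fun d => ?_⟩
  exact (φ.part_smul_iff g _ _).2 (hD _).symm

theorem autZero_normal : (autZero φ).Normal := by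
  refine ⟨fun h hh g d => ?_⟩
  have h1 : φ.part (g • h • g⁻¹ • d) = φ.part (g • g⁻¹ • d) :=
    (φ.part_smul_iff g _ _).2 (hh (g⁻¹ • d))
  rw [smul_inv_smul, smul_smul, smul_smul] at h1
  exact h1

theorem orderOf_rot_eq {M : OrientedMap.{u}} {n : ℕ} (φ : M.Embedding (completeEquipartite 3 n))
    {d₀ : M.Dart} {a : M.autPlus} (ha : a • M.rot d₀ = d₀) :
    orderOf a = 2 * n := by
  rw [← card_dart_fst_tripartite n (φ.vert d₀), ← Nat.card_zpowers]
  refine Nat.card_eq_of_bijective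
    (fun g : Subgroup.zpowers a => (⟨φ.toEquiv (g.1 • d₀), by
      obtain ⟨_, i, rfl⟩ := g; exact φ.vert_zpow_smul ha i⟩ :
        {d : (completeEquipartite 3 n).Dart // d.fst = φ.vert d₀})) ⟨fun g h hgh => ?_, ?_⟩
  · exact Subtype.ext (smul_left_injective_dart (φ.toEquiv.injective (Subtype.ext_iff.1 hgh)))
  · rintro ⟨d, hd⟩
    obtain ⟨i, hi⟩ := φ.exists_zpow_smul ha (f := φ.toEquiv.symm d)
      (by rw [← hd, vert, Equiv.apply_symm_apply])
    exact ⟨⟨a ^ i, i, rfl⟩, Subtype.ext ((congrArg φ.toEquiv hi.symm).trans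
      (φ.toEquiv.apply_symm_apply d))⟩

set_option maxRecDepth 4000 in
/-- The action of the generators on the parts. -/
theorem zpow_part_and_mem [NeZero n] {d₀ : M.Dart} {a b : M.autPlus} (ha : a • M.rot d₀ = d₀)
    (hb : b • d₀ = M.inv d₀) :
    (∀ i : ℤ, φ.part (a ^ i • M.inv d₀) = φ.part (M.inv d₀) → Even i) ∧
      a ^ 2 ∈ autZero φ ∧ (a * b) ^ 3 ∈ autZero φ := by
  obtain ⟨σ, hσ⟩ := φ.exists_perm_part a
  obtain ⟨τ, hτ⟩ := φ.exists_perm_part b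
  have hσ0 : σ (φ.part d₀) = φ.part d₀ := by
    rw [← hσ, part, ← zpow_one a, φ.vert_zpow_smul ha]; rfl
  have hτ0 : τ (φ.part d₀) = φ.part (M.inv d₀) := by rw [← hτ, hb]
  have hτ1 : τ (φ.part (M.inv d₀)) = φ.part d₀ := by
    rw [← hτ, ← inv_smul_dart, hb, M.inv_inv]
  have hne := φ.part_inv_ne d₀
  have hpow : ∀ i : ℤ, ∀ d, φ.part (a ^ i • d) = (σ ^ i) (φ.part d) := by
    intro i
    induction i with
    | zero => simp
    | succ i ih =>
      intro d
      rw [zpow_add_one, zpow_add_one, mul_smul, ih, hσ]; rfl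
    | pred i ih =>
      intro d
      rw [zpow_sub_one, zpow_sub_one, mul_smul, ih, Equiv.Perm.mul_apply]
      congr 1
      rw [Equiv.Perm.eq_inv_iff_eq, ← hσ, smul_inv_smul]
  -- The powers of `a` reach all arcs at the initial vertex of d₀. If `a` fixed every part, all
  -- neighbours would lie in one part, but there is a third part.
  have hσ1 : σ ≠ 1 := by
    rintro rfl
    obtain ⟨p, hp0, hp1⟩ : ∃ p, φ.part d₀ ≠ p ∧ p ≠ φ.part (M.inv d₀) :=
      (by decide : ∀ p q : Fin 3, ∃ r, p ≠ r ∧ r ≠ q) _ _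
    obtain ⟨d, rfl⟩ := φ.exists_part p
    obtain ⟨f, hf, hf'⟩ := (φ.adj_iff d₀ d).1 hp0
    obtain ⟨i, rfl⟩ := φ.exists_zpow_smul ha hf
    rw [inv_smul_dart] at hf'
    refine hp1 ?_
    rw [part, ← hf', ← part, hpow, one_zpow, Equiv.Perm.one_apply]
  have hσ2 : σ ^ 2 = 1 :=
    (by decide : ∀ (σ : Equiv.Perm (Fin 3)) p, σ p = p → σ ^ 2 = 1) σ _ hσ0
  refine ⟨fun i hi => ?_, fun d => ?_, fun d => ?_⟩
  · by_contra hodd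
    obtain ⟨k, rfl⟩ := Int.not_even_iff_odd.1 hodd
    rw [hpow, zpow_add, zpow_mul, zpow_ofNat, hσ2, one_zpow, one_mul, zpow_one] at hi
    exact hσ1 ((by decide : ∀ (σ : Equiv.Perm (Fin 3)) p q, σ p = p → σ q = q → p ≠ q → σ = 1)
      σ _ _ hσ0 hi hne)
  · change φ.part (a ^ 2 • d) = φ.part d
    rw [pow_two, mul_smul, hσ, hσ, ← Equiv.Perm.mul_apply, ← pow_two, hσ2, Equiv.Perm.one_apply]
  · have h3 : (σ * τ) ^ 3 = 1 :=
      (by decide : ∀ (σ τ : Equiv.Perm (Fin 3)) p q,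
        p ≠ q ∧ σ p = p ∧ σ ≠ 1 ∧ τ p = q ∧ τ q = p → (σ * τ) ^ 3 = 1)
        σ τ _ _ ⟨hne, hσ0, hσ1, hτ0, hτ1⟩
    change φ.part ((a * b) ^ 3 • d) = φ.part d
    have h4 := congrArg (fun ρ : Equiv.Perm (Fin 3) => ρ (φ.part d)) h3
    simp only [pow_succ, pow_zero, one_mul, Equiv.Perm.mul_apply, Equiv.Perm.one_apply, ← hσ,
      ← hτ] at h4
    simpa only [pow_succ, pow_zero, one_mul, mul_smul] using h4

/-- The automorphism group of a regular embedding of `K_{3[n]}` is triangular over the subgroup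
preserving the parts. -/
theorem triFact [NeZero n] {d₀ : M.Dart} {a b : M.autPlus} (ha : a • M.rot d₀ = d₀)
    (hb : b • d₀ = M.inv d₀) : TriFact a b (a ^ 2) (cj b (a ^ 2)) (autZero φ) n := by
  obtain ⟨heven, hx, hu⟩ := φ.zpow_part_and_mem ha hb
  have hord := φ.orderOf_rot_eq ha
  have hbb : b * b = 1 := smul_left_injective_dart (d := d₀) (by
    rw [mul_smul, hb, ← inv_smul_dart, hb, M.inv_inv, one_smul])
  have hb' : b⁻¹ = b := inv_eq_of_mul_eq_one_right hbb
  have hcj : ∀ (g : M.autPlus) (i : ℤ), cj b g ^ i = b * g ^ i * b := fun g i => by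
    rw [← map_zpow, cj_apply, hb']
  refine ⟨NeZero.pos n, closure_pair_eq_top ha hb, hbb, rfl, rfl, φ.autZero_normal, hx, hu, ?_, ?_,
    ?_⟩
  · rw [← pow_mul, ← hord, pow_orderOf_eq_one]
  · have key : ∀ h ∈ autZero φ, ∃ i j : ℤ, h = cj b (a ^ 2) ^ i * (a ^ 2) ^ j := by
      intro h hh
      -- h keeps the initial vertex of d₀ in its part, so its image is still adjacent to the
      -- terminal vertex. A rotation about the terminal vertex, a conjugate under `b` of a power of
      -- `a`, moves the initial vertex there; evenness makes it a power of y. What remains of h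
      -- fixes the initial vertex and is a power of x.
      obtain ⟨f, hf, hf'⟩ := (φ.adj_iff (M.inv d₀) (h • d₀)).1 (by
        rw [adj_iff_part, φ.mem_autZero.1 hh]; exact (φ.part_inv_ne d₀).symm)
      have h1 : φ.vert (b • f) = φ.vert d₀ := by
        rw [(φ.vert_smul_iff b f _).2 hf, ← inv_smul_dart, hb, M.inv_inv]
      obtain ⟨k, hk⟩ := φ.exists_zpow_smul ha h1
      have hf2 : M.inv f = (b * a ^ k * b) • d₀ := by
        rw [mul_smul, mul_smul, hb, ← inv_smul_dart, ← inv_smul_dart, ← hk, ← mul_smul, hbb,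
          one_smul]
      have hk2 : Even k := by
        refine heven k ?_
        have h2 : φ.part (b • a ^ k • M.inv d₀) = φ.part (b • M.inv d₀) := by
          rw [← hb, ← mul_smul b b, hbb, one_smul, ← mul_smul, ← mul_smul, ← hf2,
            part, hf', ← part, φ.mem_autZero.1 hh]
        exact (φ.part_smul_iff b _ _).1 h2
      obtain ⟨i, rfl⟩ := hk2.two_dvd
      have hy : b * a ^ (2 * i) * b = cj b (a ^ 2) ^ i := by
        rw [hcj, zpow_mul]; rfl
      rw [hy] at hf2
      rw [hf2] at hf'
      have h3 : φ.vert (((cj b (a ^ 2) ^ i)⁻¹ * h) • d₀) = φ.vert d₀ := by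
        rw [← φ.vert_smul_iff (cj b (a ^ 2) ^ i), ← mul_smul, mul_inv_cancel_left, hf']
      obtain ⟨j, hj⟩ := φ.exists_zpow_smul ha h3
      have h4 := smul_left_injective_dart hj
      have h5 : a ^ j ∈ autZero φ := by
        rw [← h4]
        refine mul_mem (inv_mem (zpow_mem ?_ _)) hh
        rw [cj_apply, hb']
        have := φ.autZero_normal.conj_mem _ hx b
        rwa [hb'] at this
      obtain ⟨t, rfl⟩ := (heven j (φ.mem_autZero.1 h5 _)).two_dvd
      refine ⟨i, t, ?_⟩
      rw [← inv_mul_eq_iff_eq_mul, h4, zpow_mul]; rfl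
    intro h hh
    obtain ⟨i, j, hij⟩ := key h⁻¹ (inv_mem hh)
    refine ⟨-j, -i, ?_⟩
    rw [← _root_.inv_inv h, hij, mul_inv_rev, zpow_neg, zpow_neg]
  · intro i j hij
    have h1 : φ.vert ((a ^ 2) ^ i • d₀) = φ.vert d₀ := by
      rw [← zpow_natCast, ← zpow_mul]; exact φ.vert_zpow_smul ha _
    -- An element of ⟨x⟩ ∩ ⟨y⟩ fixes both ends of d₀, hence d₀ itself, the graph being simple.
    have h2 : φ.vert (M.inv ((a ^ 2) ^ i • d₀)) = φ.vert (M.inv d₀) := by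
      rw [inv_smul_dart, hij, hcj, ← hb, ← mul_smul, mul_assoc, hbb, mul_one, mul_smul,
        vert_smul_iff, ← zpow_natCast, ← zpow_mul]
      exact φ.vert_zpow_smul ha _
    have h3 : (a ^ 2) ^ i = 1 := smul_left_injective_dart (d := d₀) (by
      rw [one_smul]; exact φ.dart_ext h1 h2)
    rw [← zpow_natCast, ← zpow_mul, ← orderOf_dvd_iff_zpow_eq_one, hord] at h3
    exact (mul_dvd_mul_iff_left (two_ne_zero (α := ℤ))).1 (by exact_mod_cast h3)

end OrientedMap.Embedding

/-! ### Identification with M₄ -/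

/-- By `mul_pow_third` the power n/3 of (ab)³ lies in the 3-layer, where cubes vanish. This loses
only one factor 3, which the exponent of the Sylow subgroup then recovers. -/
theorem TriFact.cube_pow_eq_one {G : Type u} [Group G] {a b x y : G} {H : Subgroup G} {n : ℕ}
    (T : TriFact a b x y H n) (hn : 3 ∣ n) : ((a * b) ^ 3) ^ n = 1 := by
  obtain ⟨m, rfl⟩ := hn
  obtain ⟨i, j, hij⟩ := T.span _ T.cube_mem
  have h := T.layer_pow (TriFact.commute_x_pow (3 * m) T Nat.prime_three rfl) i j
  have hx : (x ^ m) ^ i = (x ^ i) ^ m := by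
    rw [← zpow_natCast, ← zpow_natCast, ← zpow_mul, ← zpow_mul, mul_comm]
  have hy : (y ^ m) ^ j = (y ^ j) ^ m := by
    rw [← zpow_natCast, ← zpow_natCast, ← zpow_mul, ← zpow_mul, mul_comm]
  rw [hx, hy, ← TriFact.mul_pow_third m T, ← hij, ← pow_mul, mul_comm] at h
  exact h

/-- If a Sylow `p`-subgroup has exponent `p^e`, every element of `p`-power order has order dividing
`p^e`. -/
theorem pow_eq_one_of_sylow_exponent {G : Type*} [Group G] [Finite G] {p e : ℕ} [Fact p.Prime]
    (P : Sylow p G) (hP : Monoid.exponent P = p ^ e) {g : G} {s : ℕ} (hg : g ^ p ^ s = 1) :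
    g ^ p ^ e = 1 := by
  have hz : IsPGroup p (Subgroup.zpowers g) := by
    rintro ⟨_, i, rfl⟩
    refine ⟨s, Subtype.ext ?_⟩
    change (g ^ i) ^ p ^ s = 1
    rw [← zpow_natCast, zpow_comm, zpow_natCast, hg, one_zpow]
  obtain ⟨Q, hQ⟩ := hz.exists_le_sylow
  have h1 := Monoid.pow_exponent_eq_one (⟨g, hQ (Subgroup.mem_zpowers g)⟩ : (Q : Subgroup G))
  have h2 : Monoid.exponent Q = p ^ e := (Monoid.exponent_eq_of_mulEquiv (P.equiv Q)).symm.trans hP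
  rw [h2] at h1
  exact congrArg Subtype.val h1

theorem two_le_of_nine_dvd {k e : ℕ} (hk : ¬ 3 ∣ k) (h : 9 ∣ 3 ^ e * k) : 2 ≤ e := by
  by_contra he
  have h3 : e = 0 ∨ e = 1 := by omega
  rcases h3 with rfl | rfl <;> omega

/-- A regular embedding whose generators satisfy the relations of `G₄` is `M₄`. -/
theorem OrientedMap.iso_M4 {M : OrientedMap.{u}} {k e : ℕ} (hk : k ≠ 0) (he : 2 ≤ e)
    (φ : M.Embedding (completeEquipartite 3 (3 ^ e * k))) (hreg : M.IsOrientablyRegular)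
    {d₀ : M.Dart} {a b x y : M.autPlus} (ha : a • M.rot d₀ = d₀) (hb : b • d₀ = M.inv d₀)
    {l : ℤ} {j : ℤˣ} (h : TypeFour (a ^ (j : ℤ)) b x y (3 ^ e * k / 3) l) :
    M.Iso (M4 k e 1 l j) := by
  have he1 : 1 ≤ e := by omega
  obtain ⟨f, hfa, hfb⟩ := G4.exists_lift he1 h
  have hn := G4.three_mul_third (k := k) he1
  have hn0 : 0 < 3 ^ e * k := by positivity
  obtain ⟨hfin, hcard⟩ := (G4.typeFour k he1 l).finite_and_card_le (G4.three_dvd_third he) (by omega)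
    (by simpa using G4.closure_eq_top k e 1 l 1)
  rw [hn] at hcard
  have hfa' : f (G4.a k e 1 l ^ (j : ℤ)) = a := by
    rw [map_zpow, hfa, ← zpow_mul, ← Units.val_mul, Int.units_mul_self, Units.val_one, zpow_one]
  have hsurj : Function.Surjective f := by
    rw [← MonoidHom.range_eq_top, MonoidHom.range_eq_map, ← G4.closure_eq_top k e 1 l j,
      MonoidHom.map_closure, Set.image_pair, hfa', hfb, closure_pair_eq_top ha hb]
  -- The inverse turns the left multiplications of the algebraic map into rotation and reversal;
  -- since `a` carries M.rot d₀ back to d₀, it is a⁻¹ that produces M.rot d₀.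
  set ψ : G4 k e 1 l → M.Dart := fun g => (f g)⁻¹ • d₀ with hψ
  have hψs : Function.Surjective ψ := by
    intro d
    obtain ⟨g, hg, -⟩ := hreg d₀ d
    obtain ⟨g', hg'⟩ := hsurj g⁻¹
    exact ⟨g', by rw [hψ]; simp only [hg', _root_.inv_inv]; exact hg⟩
  have hψb : Function.Bijective ψ := by
    have : Finite M.Dart := Finite.of_surjective _ hψs
    refine (Nat.bijective_iff_surjective_and_card _).2 ⟨hψs, le_antisymm ?_ ?_⟩
    · rwa [Nat.card_congr φ.toEquiv, card_dart_tripartite]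
    · exact Nat.card_le_card_of_surjective _ hψs
  set Ψ : G4 k e 1 l ≃ M.Dart := Equiv.ofBijective ψ hψb
  have hrot : ∀ g, Ψ (G4.a k e 1 l ^ (j : ℤ) * g) = M.rot (Ψ g) := fun g => by
    change (f _)⁻¹ • d₀ = M.rot ((f g)⁻¹ • d₀)
    rw [map_mul, hfa', mul_inv_rev, mul_smul, rot_smul, ← eq_inv_smul_iff.2 ha]
  have hinv : ∀ g, Ψ (G4.b k e 1 l * g) = M.inv (Ψ g) := fun g => by
    change (f _)⁻¹ • d₀ = M.inv ((f g)⁻¹ • d₀)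
    rw [map_mul, hfb, mul_inv_rev, mul_smul, inv_smul_dart]
    congr 1
    rw [inv_smul_eq_iff, ← inv_smul_dart, hb, M.inv_inv]
  refine ⟨Ψ.symm, fun d => ?_⟩
  obtain ⟨g, rfl⟩ := Ψ.surjective d
  have hs : ∀ g, Ψ.symm (Ψ g) = g := Ψ.symm_apply_apply
  constructor
  · refine (congrArg Ψ.symm (hrot g).symm).trans ((hs _).trans ?_)
    exact congrArg (G4.a k e 1 l ^ (j : ℤ) * ·) (hs g).symm
  · refine (congrArg Ψ.symm (hinv g).symm).trans ((hs _).trans ?_)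
    exact congrArg (G4.b k e 1 l * ·) (hs g).symm

theorem OrientedMap.exists_iso_M4 {M : OrientedMap.{u}} {k e : ℕ} (hk : ¬ 3 ∣ k)
    (φ : M.Embedding (completeEquipartite 3 (3 ^ e * k))) (hreg : M.IsOrientablyRegular)
    (hH : ∃ g ∈ autZero φ, ∃ h ∈ autZero φ, g * h ≠ h * g) (P : Sylow 3 M.autPlus)
    (hP : Monoid.exponent P = 3 ^ e) :
    2 ≤ e ∧ ∃ l : ℤ, (l = 0 ∨ l = 1 ∨ l = -1) ∧ ∃ j : ℤˣ, M.Iso (M4 k e 1 l j) := by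
  have hk0 : k ≠ 0 := fun h => hk (h ▸ dvd_zero 3)
  have hn0 : 0 < 3 ^ e * k := by positivity
  have : NeZero (3 ^ e * k) := ⟨hn0.ne'⟩
  obtain ⟨d₀, -⟩ := φ.exists_part 0
  obtain ⟨a, ha : a • M.rot d₀ = d₀, -⟩ := hreg (M.rot d₀) d₀
  obtain ⟨b, hb : b • d₀ = M.inv d₀, -⟩ := hreg d₀ (M.inv d₀)
  have T := φ.triFact ha hb
  have : Finite M.autPlus := by
    have : Finite M.Dart := Nat.finite_of_card_ne_zero (by
      rw [Nat.card_congr φ.toEquiv, card_dart_tripartite]; positivity)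
    exact Finite.of_injective (fun g : M.autPlus => g • d₀) fun _ _ h => smul_left_injective_dart h
  have hne : ¬ Commute (a ^ 2) (cj b (a ^ 2)) := by
    intro hc
    obtain ⟨g, hg, h, hh, hgh⟩ := hH
    obtain ⟨i, j, rfl⟩ := T.span g hg
    obtain ⟨i', j', rfl⟩ := T.span h hh
    refine hgh (Commute.mul_left (Commute.mul_right ?_ ?_) (Commute.mul_right ?_ ?_))
    · exact (Commute.refl _).zpow_zpow i i'
    · exact hc.zpow_zpow i j'
    · exact hc.symm.zpow_zpow j i'
    · exact (Commute.refl _).zpow_zpow j j'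
  have hcube : TriFact.CubeCond a b (a ^ 2) (cj b (a ^ 2)) (3 ^ e * k) := by
    intro h3
    refine T.cubeCond_of_pow ?_ h3
    have hu := T.cube_pow_eq_one h3
    -- (ab)^k has 3-power order, so the exponent of P lowers e+1 to e. This is (ab)^n = 1, the
    -- (n/3)rd power of (ab)³.
    have h1 : ((a * b) ^ k) ^ 3 ^ (e + 1) = 1 := by
      rw [← pow_mul, ← hu, ← pow_mul]
      congr 1
      ring
    have h2 := pow_eq_one_of_sylow_exponent P hP h1
    rwa [← pow_mul, Nat.mul_div_cancel' h3, mul_comm, pow_mul]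
  obtain ⟨q, hq, l, hl, j, hT⟩ := T.exists_typeFour hcube hne
  have he := two_le_of_nine_dvd hk ⟨q, hq⟩
  have hm : 3 ^ e * k / 3 = 3 * q := by omega
  rw [← hm] at hT
  exact ⟨he, l, hl, j, iso_M4 hk0 he φ hreg ha hb hT⟩

theorem theorem4p3 (k e : ℕ) (hk : ¬ 3 ∣ k) :
    (∀ (M : OrientedMap.{u}) (φ : M.Embedding (completeEquipartite 3 (3 ^ e * k))),
      M.IsOrientablyRegular →
      (∃ g ∈ OrientedMap.autZero φ, ∃ h ∈ OrientedMap.autZero φ, g * h ≠ h * g) →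
      ∀ P : Sylow 3 M.autPlus, Monoid.exponent P = 3 ^ e →
        2 ≤ e ∧ ∃ l : ℤ, (l = 0 ∨ l = 1 ∨ l = -1) ∧ ∃ j : ℤˣ, M.Iso (M4 k e 1 l j)) ∧
    (2 ≤ e → ∀ l : ℤ, (l = 0 ∨ l = 1 ∨ l = -1) → ∀ j : ℤˣ,
      Nonempty ((M4 k e 1 l j).Embedding (completeEquipartite 3 (3 ^ e * k))) ∧
      (M4 k e 1 l j).IsChiral ∧
      (l = 0 → (M4 k e 1 l j).HasType 3 (2 * (3 ^ e * k))) ∧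
      (l = 1 ∨ l = -1 → (M4 k e 1 l j).HasType 9 (2 * (3 ^ e * k)))) :=
  ⟨fun _ φ hreg hH P hP => OrientedMap.exists_iso_M4 hk φ hreg hH P hP,
    fun he l hl j => G4.embedding_chiral_type (by rintro rfl; exact hk (dvd_zero 3)) he l hl j⟩
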